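/- **Definitions.** A *partial field* $\mathbb P$ is a set with elements $0\neq 1$, a commutative multiplication with $0\cdot p=0$ under which $\mathbb P^*=\mathbb P\setminus\{0\}$ is an abelian group with identity $1$, and a partial commutative addition such that $p+0=p$; every $p$ has a unique additive inverse $-p$; for $p\ne 0$, $p(q+r)$ is defined if and only if $pq+pr$ is, and then they are equal; and the following associative law holds: if one way of completely bracketing the sum of a finite multiset $S$ has all its partial sums (including the total) defined, with total $s$, and another way of completely bracketing it has all its partial sums except possibly the last one defined, then the last one is also defined, and its total is $s$. A sum $p_1+\dots+p_n$ is *defined* if, after adding finitely many pairs $z,-z$ to the multiset of its terms, some complete bracketing has all its partial sums defined. A matrix with entries in $\mathbb P$ (with finite row set $X$ and column set $Y$, $X\cap Y=\emptyset$) is a *$\mathbb P$-matrix* if the determinants (Leibniz sums) of all its square submatrices are defined. Write $A\sim A'$ if $A'$ arises from $A$ by multiplying rows and columns by elements of $\mathbb P^*$. *Pivoting* over $A_{xy}\neq0$ replaces $A_{xy}$ by $A_{xy}^{-1}$, the other entries $A_{xv}$ of its row by $A_{xy}^{-1}A_{xv}$, the other entries $A_{uy}$ of its column by $-A_{xy}^{-1}A_{uy}$,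 every remaining entry $A_{uv}$ by $A_{uv}-A_{xy}^{-1}A_{uy}A_{xv}$, and exchanges the labels $x$ and $y$. A *minor* of $A$ is a matrix obtained from $A$ by a sequence of row and column scalings by elements of $\mathbb P^*$, deletions and permutations of rows and columns, and pivots. Two matrices of the same size are *strongly equivalent* ($\approx$) if each is a minor of the other. An element $p\in\mathbb P$ is *fundamental* if $1-p$ is defined in $\mathbb P$; $\mathcal F(\mathbb P)$ is the set of fundamental elements. $G(A)$ is the bipartite graph with vertex set $X\cup Y$ and an edge $xy$ for every $A_{xy}\neq 0$. Put $\sigma_A(xy)=A_{xy}$ and $\sigma_A(yx)=A_{xy}^{-1}$ for $x\in X$, $y\in Y$; the *signature* of a cycle $C=(v_0,v_1,\dots,v_{2n}=v_0)$ is $\sigma_A(C)=(-1)^{n}\prod_{i=0}^{2n-1}\sigma_A(v_iv_{i+1})$. A *homomorphism* $\varphi:\hat{\mathbb P}\to\mathbb P$ of partial fields is a map with $\varphi(pq)=\varphi(p)\varphi(q)$ for all $p,q$ and such that, whenever $p+q$ is defined, $\varphi(p)+\varphi(q)$ is defined and equals $\varphi(p+q)$. A *lifting function* for $\varphi$ is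 a map ${}^\uparrow:\mathcal F(\mathbb P)\to\hat{\mathbb P}$ such that for all $p,q\in\mathcal F(\mathbb P)$: $\varphi(p^\uparrow)=p$; if $p+q$ is defined and equals $1$, then $p^\uparrow+q^\uparrow$ is defined and equals $1$; if $pq=1$, then $p^\uparrow q^\uparrow=1$. A *local $\uparrow$-lift* of an $X\times Y$ $\mathbb P$-matrix $A$ is an $X\times Y$ $\hat{\mathbb P}$-matrix $\hat A$ such that $\varphi(\hat A)\sim A$ and $\sigma_A(C)^\uparrow=\sigma_{\hat A}(C)$ for every induced cycle $C$ of $G(A)$. A *global $\uparrow$-lift* of $A$ is an $X\times Y$ matrix $\hat A$ over $\hat{\mathbb P}$ such that $\varphi(\hat A)\sim A$ and every $\hat A'\approx\hat A$ is a local $\uparrow$-lift of $\varphi(\hat A')$. **Theorem (Lift Theorem).** Let $\mathbb P,\hat{\mathbb P}$ be partial fields, let $\varphi:\hat{\mathbb P}\to\mathbb P$ be a homomorphism, and let ${}^\uparrow:\mathcal F(\mathbb P)\to\hat{\mathbb P}$ be a lifting function for $\varphi$. Let $A$ be an $X\times Y$ $\mathbb P$-matrix. Then exactly one of the following is true: 1.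 $A$ has a global $\uparrow$-lift. 2. $A$ has a minor $B$ such that $B$ has no local $\uparrow$-lift, and $B$ or $B^T$ equals (up to the names of rows and columns) $$\begin{bmatrix}0&1&1&1\\1&0&1&1\\1&1&0&1\end{bmatrix}\quad\text{or}\quad\begin{bmatrix}1&1&1\\1&p&q\end{bmatrix}$$ for some distinct $p,q\in\mathcal F(\mathbb P)\setminus\{0,1\}$. -/

import Mathlib

/-- Finite binary trees whose leaves carry elements of `P`; such a tree records one way of
bracketing a sum of the multiset of its leaf labels. -/
inductive SumTree (P : Type*) : Type _
  | leaf : P → SumTree P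
  | node : SumTree P → SumTree P → SumTree P

namespace SumTree

/-- The multiset of leaf labels. -/
def leaves {P : Type*} : SumTree P → Multiset P
  | leaf p => {p}
  | node l r => l.leaves + r.leaves

/-- Evaluate the tree with respect to a partial addition (`none` means undefined). The tree is an
association of its multiset of leaves when this is not `none`; the value is the label of the
root. -/
def eval {P : Type*} (padd : P → P → Option P) : SumTree P → Option P
  | leaf p => some p
  | node l r => (l.eval padd).bind fun u => (r.eval padd).bind fun w => padd u w

end SumTree

/-- A partial field. Multiplication is total and commutative, and the nonzero elements form an
abelian group (with the usual convention `0 * p = 0`). Addition is partial: `padd p q = some r`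
means that `p + q` is defined and equal to `r`, and `padd p q = none` that it is undefined. -/
class PartialField (P : Type*) extends CommGroupWithZero P where
  /-- the partial addition -/
  padd : P → P → Option P
  padd_zero : ∀ p : P, padd p 0 = some p
  exists_unique_neg : ∀ p : P, ∃! q : P, padd p q = some 0
  padd_comm : ∀ p q : P, padd p q = padd q p
  /-- Distributivity: for `p ≠ 0`, `p * (q + r)` is defined if and only if `p * q + p * r` is, and
  then they are equal. -/
  mul_padd : ∀ p q r : P, p ≠ 0 → padd (p * q) (p * r) = (padd q r).map (fun s => p * s)
  /-- The associative law: if the tree `T` is an association of `S` with value `s`, and the tree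
  with root subtrees `l`, `r` is a pre-association of `S` (so both `l` and `r` can be evaluated,
  to `u` and `w` say), then `u + w` is defined and equal to `s`. -/
  assoc_law : ∀ (T l r : SumTree P) (s u w : P),
    T.leaves = (SumTree.node l r).leaves → T.eval padd = some s →
    l.eval padd = some u → r.eval padd = some w → padd u w = some s

namespace PartialField

section Basic

variable {P : Type*} [PartialField P]

/-- The additive inverse: the unique `q` with `p + q` defined and equal to `0`. -/
noncomputable def pneg (p : P) : P := Classical.choose (exists_unique_neg p)

theorem padd_pneg (p : P) : padd p (pneg p) = some 0 :=
  (Classical.choose_spec (exists_unique_neg p)).1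

/-- `p` is fundamental: `1 - p` is defined. -/
def IsFundamental (p : P) : Prop := ∃ r : P, padd 1 (pneg p) = some r

/-- The sum of the multiset `S` is defined and has value `r`: after adding finitely many pairs
`z, -z` to `S` there is an association, with value `r`. -/
def SumsTo (S : Multiset P) (r : P) : Prop :=
  ∃ (Z : Multiset P) (T : SumTree P),
    T.leaves = S + (Z + Z.map pneg) ∧ T.eval padd = some r

/-- `p` or `-p`, according to the sign. -/
noncomputable def signMul (s : ℤˣ) (p : P) : P := if s = 1 then p else pneg p

/-- The determinant of the square matrix `A` is defined and equal to `d`. -/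
def DetEq {n : ℕ} (A : Matrix (Fin n) (Fin n) P) (d : P) : Prop :=
  SumsTo ((Finset.univ : Finset (Equiv.Perm (Fin n))).val.map
    fun σ => signMul (Equiv.Perm.sign σ) (∏ i, A i (σ i))) d

end Basic

section Matrices

variable {P : Type*} [PartialField P] {X Y : Type*}

/-- A matrix over `P` is a `P`-matrix if the determinants of all its square submatrices are
defined. -/
def IsPMatrix (A : Matrix X Y P) : Prop :=
  ∀ (n : ℕ) (f : Fin n ↪ X) (g : Fin n ↪ Y), ∃ d : P, DetEq (A.submatrix f g) d

/-- `A'` is obtained from `A` by scaling rows and columns by nonzero elements. -/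
def ScalingEquiv (A A' : Matrix X Y P) : Prop :=
  ∃ (r : X → P) (c : Y → P), (∀ x, r x ≠ 0) ∧ (∀ y, c y ≠ 0) ∧
    ∀ x y, A' x y = r x * A x y * c y

/-- `B` is obtained from `A` by pivoting over the nonzero entry in row `x` and column `y`.
(Row and column indices name positions: position `x` of `B` holds the row that carries the label
of the former column `y`, and position `y` the column that carries the label of the former
row `x`.) -/
def IsPivot (A : Matrix X Y P) (x : X) (y : Y) (B : Matrix X Y P) : Prop :=
  A x y ≠ 0 ∧
  B x y = (A x y)⁻¹ ∧
  (∀ v, v ≠ y → B x v = (A x y)⁻¹ * A x v) ∧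
  (∀ u, u ≠ x → B u y = pneg ((A x y)⁻¹ * A u y)) ∧
  (∀ u v, u ≠ x → v ≠ y → padd (A u v) (pneg ((A x y)⁻¹ * A u y * A x v)) = some (B u v))

end Matrices

section Minors

universe u₁ u₂

/-- `IsMinor A B`: the matrix `B` is a minor of `A`, i.e. it is obtained from `A` by a sequence of
scalings of rows and columns, deletions and permutations (relabellings) of rows and columns,
and pivots. -/
inductive IsMinor {P : Type*} [PartialField P] {X : Type u₁} {Y : Type u₂} (A : Matrix X Y P) :
    ∀ {X' : Type u₁} {Y' : Type u₂}, Matrix X' Y' P → Prop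
  | refl : IsMinor A A
  | scale {X' : Type u₁} {Y' : Type u₂} {B C : Matrix X' Y' P} :
      IsMinor A B → ScalingEquiv B C → IsMinor A C
  | delete {X' X'' : Type u₁} {Y' Y'' : Type u₂} {B : Matrix X' Y' P}
      (f : X'' ↪ X') (g : Y'' ↪ Y') :
      IsMinor A B → IsMinor A (B.submatrix f g)
  | pivot {X' : Type u₁} {Y' : Type u₂} {B C : Matrix X' Y' P} (x : X') (y : Y') :
      IsMinor A B → IsPivot B x y C → IsMinor A C

/-- Strong equivalence of two matrices of the same size: each is a minor of the other. -/
def StrongEquiv {P : Type*} [PartialField P] {X : Type u₁} {Y : Type u₂}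
    (A A' : Matrix X Y P) : Prop :=
  IsMinor A A' ∧ IsMinor A' A

end Minors

section Signature

variable {P : Type*} [PartialField P] {X Y : Type*}

/-- The bipartite graph `G(A)` on the disjoint union of rows and columns; edges are the nonzero
entries. -/
def bipGraph (A : Matrix X Y P) : SimpleGraph (X ⊕ Y) where
  Adj
    | Sum.inl x, Sum.inr y => A x y ≠ 0
    | Sum.inr y, Sum.inl x => A x y ≠ 0
    | _, _ => False
  symm := ⟨by rintro (x | y) (x' | y') h <;> exact h⟩
  loopless := ⟨by rintro (x | y) h <;> exact h⟩

/-- The signature on ordered pairs `xy` and `yx`; the value on other pairs is never used. -/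
def sig (A : Matrix X Y P) : X ⊕ Y → X ⊕ Y → P
  | Sum.inl x, Sum.inr y => A x y
  | Sum.inr y, Sum.inl x => (A x y)⁻¹
  | _, _ => 1

/-- The signature of a closed walk `C` in a graph on rows and columns:
`(-1) ^ (|V(C)| / 2)` times the product of the signatures of its steps. (A cycle has as many
vertices as steps.) -/
noncomputable def cycleSig (A : Matrix X Y P) {G : SimpleGraph (X ⊕ Y)} {v : X ⊕ Y}
    (C : G.Walk v v) : P :=
  (pneg 1) ^ (C.length / 2) * (C.darts.map fun d => sig A d.fst d.snd).prod

/-- `C` is an induced (chordless) cycle of `G`. -/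
def IsInducedCycle {V : Type*} {G : SimpleGraph V} {v : V} (C : G.Walk v v) : Prop :=
  C.IsCycle ∧ ∀ a ∈ C.support, ∀ b ∈ C.support, G.Adj a b → s(a, b) ∈ C.edges

end Signature

section Lifts

universe u₁ u₂

variable {Q P : Type*} [PartialField Q] [PartialField P]

/-- Partial-field homomorphisms. -/
def IsHom (φ : Q → P) : Prop :=
  (∀ p q : Q, φ (p * q) = φ p * φ q) ∧
  (∀ p q r : Q, padd p q = some r → padd (φ p) (φ q) = some (φ r))

/-- Lifting functions for `φ`, defined on the fundamental elements of `P`. -/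
def IsLiftingFunction (φ : Q → P) (up : {p : P // IsFundamental p} → Q) : Prop :=
  (∀ p, φ (up p) = p) ∧
  (∀ p q : {p : P // IsFundamental p},
    padd (p : P) (q : P) = some 1 → padd (up p) (up q) = some 1) ∧
  (∀ p q : {p : P // IsFundamental p}, (p : P) * (q : P) = 1 → up p * up q = 1)

/-- `A'` is a local lift of `A`. -/
def IsLocalLift (φ : Q → P) (up : {p : P // IsFundamental p} → Q) {X Y : Type*}
    (A : Matrix X Y P) (A' : Matrix X Y Q) : Prop :=
  ScalingEquiv (A'.map φ) A ∧
  IsPMatrix A' ∧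
  ∀ (v : X ⊕ Y) (C : (bipGraph A).Walk v v), IsInducedCycle C →
    ∃ h : IsFundamental (cycleSig A C), up ⟨cycleSig A C, h⟩ = cycleSig A' C

/-- `A'` is a global lift of `A`: up to scaling its image is `A`, and every matrix strongly
equivalent to `A'` is a local lift of its own image. -/
def IsGlobalLift (φ : Q → P) (up : {p : P // IsFundamental p} → Q)
    {X : Type u₁} {Y : Type u₂} (A : Matrix X Y P) (A' : Matrix X Y Q) : Prop :=
  ScalingEquiv (A'.map φ) A ∧
  ∀ A'' : Matrix X Y Q, StrongEquiv A'' A' → IsLocalLift φ up (A''.map φ) A''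

/-- `B` equals `N` after naming the rows and columns of `B` by `0, 1, …` in some order. -/
def EqUpToLabels {X Y : Type*} {m n : ℕ} (B : Matrix X Y P) (N : Matrix (Fin m) (Fin n) P) :
    Prop :=
  ∃ (e : Fin m ≃ X) (f : Fin n ≃ Y), B.submatrix e f = N

/-- The `3 × 4` matrix representing the Fano or the non-Fano matroid. -/
def fanoMatrix (P : Type*) [PartialField P] : Matrix (Fin 3) (Fin 4) P :=
  !![0, 1, 1, 1; 1, 0, 1, 1; 1, 1, 0, 1]

/-- The `2 × 3` matrix representing the five-point line. -/
def lineMatrix (p q : P) : Matrix (Fin 2) (Fin 3) P :=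
  !![1, 1, 1; 1, p, q]

/-- `B` is one of the two kinds of obstruction matrices. -/
def IsObstructionShape {X Y : Type*} (B : Matrix X Y P) : Prop :=
  EqUpToLabels B (fanoMatrix P) ∨
  ∃ p q : P, IsFundamental p ∧ IsFundamental q ∧ p ≠ 0 ∧ p ≠ 1 ∧ q ≠ 0 ∧ q ≠ 1 ∧ p ≠ q ∧
    EqUpToLabels B (lineMatrix p q)

end Lifts

end PartialField

universe u₁ u₂ v w

/-! Let `U` be the set of lifted elements, the image of the lifting function (`lifted`). The axioms
of a lifting function say that `U` contains `1` and is closed under `p ↦ 1 - p` and under inversion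
of nonzero elements (`IsCrossSet`); these are the changes that a cross ratio undergoes when rows or
columns are swapped or a pivot is made inside its 2 × 2 submatrix. Call a matrix over the lifting
partial field good if every bracket is defined and every cross ratio, with respect to every basis,
lies in `U` (`AllGood`).

A good matrix is a global lift of its image: pivots shorten an induced cycle to a 4-cycle without
changing its signature, so signatures of induced cycles are cross ratios and lie in `U`
(`cycleVal_crd_mem`). Good lifts are unique up to scaling, because elements of `U` are determined by
their images and a matrix with given support is determined up to scaling by the signatures of its
induced cycles (`exists_coboundary`, `scalingEquiv_of_map`).

If no obstruction occurs, a good lift is built by induction on the number of rows and columns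
(`liftsBelow`). After transposing, and perhaps one pivot, there are columns `a`, `b` whose deletion
does not disconnect the rows, or which lie in different components. Lifts of `A - a` and `A - b`
exist by induction; by uniqueness they agree on their overlap and can be glued
(`hasLift_of_deletions`). It remains to bound the cross ratios that use both `a` and `b`. If the two
rows share a third nonzero column, the line minor controls them; if they are joined by a path
through one further row, the transposed line minor and the Fano minor do; longer paths are shortened
by pivots (`goodAt_of_chain`). The assumption on minors is used only through these three local laws
(`minorLaws_of_liftable_obstructions`). The base cases are a single row, a single column, and 2 × 2
matrices.

All of this needs linear algebra, which a partial field does not support directly. Hence `P` is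
embedded in a commutative ring in such a way that a sum is defined with value `r` exactly when the
corresponding identity holds in the ring (`sumsTo_iff`, `padd_eq_some_iff`). A pivot becomes a
change of basis among the columns of `[I | A]`, governed by a three-term Grassmann–Plücker relation.

The alternatives exclude each other because a global lift restricts to a local lift of every minor
(`IsGlobalLift.exists_isLocalLift`). -/

namespace PartialField

/-! ### Embedding a partial field in a commutative ring -/

section UniversalRing

variable {P : Type*} [PartialField P]

theorem pneg_eq {p q : P} (h : padd p q = some 0) : pneg p = q :=
  (exists_unique_neg p).unique (padd_pneg p) h

theorem pneg_pneg (p : P) : pneg (pneg p) = p :=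
  pneg_eq (by rw [padd_comm]; exact padd_pneg p)

theorem pneg_zero : pneg (0 : P) = 0 := pneg_eq (padd_zero 0)

theorem mul_pneg (m p : P) : m * pneg p = pneg (m * p) := by
  rcases eq_or_ne m 0 with rfl | hm
  · simp [pneg_zero]
  · refine (pneg_eq ?_).symm
    rw [mul_padd _ _ _ hm, padd_pneg]; simp

theorem padd_mul_some (m : P) {p q r : P} (h : padd p q = some r) :
    padd (m * p) (m * q) = some (m * r) := by
  rcases eq_or_ne m 0 with rfl | hm
  · simp [padd_zero]
  · rw [mul_padd _ _ _ hm, h]; rfl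

theorem pneg_one_mul (p : P) : pneg 1 * p = pneg p := by
  rw [mul_comm, mul_pneg, mul_one]

theorem padd_pneg_some {p q r : P} (h : padd p q = some r) :
    padd (pneg p) (pneg q) = some (pneg r) := by
  rw [← pneg_one_mul, ← pneg_one_mul q, ← pneg_one_mul r]; exact padd_mul_some _ h

/-- The defining relations of the universal ring. -/
def addRelations (P : Type*) [PartialField P] : Set (FreeAbelianGroup P) :=
  {z | ∃ p q r : P, padd p q = some r ∧
    z = FreeAbelianGroup.of p + FreeAbelianGroup.of q - FreeAbelianGroup.of r}

/-- The universal commutative ring into which `P` embeds. -/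
def URing (P : Type*) [PartialField P] : Type _ :=
  FreeAbelianGroup P ⧸ Ideal.span (addRelations P)

noncomputable instance : CommRing (URing P) :=
  inferInstanceAs (CommRing (FreeAbelianGroup P ⧸ Ideal.span (addRelations P)))

theorem ideal_mk_of_relation {p q r : P} (h : padd p q = some r) :
    Ideal.Quotient.mk (Ideal.span (addRelations P)) (FreeAbelianGroup.of p) +
      Ideal.Quotient.mk (Ideal.span (addRelations P)) (FreeAbelianGroup.of q) =
    Ideal.Quotient.mk (Ideal.span (addRelations P)) (FreeAbelianGroup.of r) := by
  rw [← map_add, Ideal.Quotient.mk_eq_mk_iff_sub_mem]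
  exact Ideal.subset_span ⟨p, q, r, h, rfl⟩

/-- The embedding of a partial field in its universal ring. -/
noncomputable def ι : P →*₀ URing P where
  toFun p := Ideal.Quotient.mk (Ideal.span (addRelations P)) (FreeAbelianGroup.of p)
  map_zero' := add_eq_right.1 (ideal_mk_of_relation (padd_zero (0 : P)))
  map_one' := by rw [FreeAbelianGroup.of_one, map_one]; rfl
  map_mul' p q := by rw [FreeAbelianGroup.of_mul, map_mul]; rfl

theorem ι_apply (p : P) :
    ι p = Ideal.Quotient.mk (Ideal.span (addRelations P)) (FreeAbelianGroup.of p) := rfl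

theorem ι_padd {p q r : P} (h : padd p q = some r) : ι p + ι q = ι r :=
  ideal_mk_of_relation h

theorem ι_pneg (p : P) : ι (pneg p) = -ι p := by
  have := ι_padd (padd_pneg p)
  rw [map_zero] at this
  exact (neg_eq_of_add_eq_zero_right this).symm

/-- Terms that can be added to any association without changing its value. -/
def Absorbed (N : Multiset P) : Prop :=
  ∀ (T : SumTree P) (p : P), T.eval padd = some p →
    ∃ T' : SumTree P, T'.leaves = T.leaves + N ∧ T'.eval padd = some p

theorem absorbed_zero : Absorbed (0 : Multiset P) := fun T p h => ⟨T, by simp, h⟩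

theorem Absorbed.add {M N : Multiset P} (hM : Absorbed M) (hN : Absorbed N) :
    Absorbed (M + N) := by
  intro T p h
  obtain ⟨T', h1, h2⟩ := hM T p h
  obtain ⟨T'', h3, h4⟩ := hN T' p h2
  exact ⟨T'', by rw [h3, h1, add_assoc], h4⟩

theorem absorbed_pair (z : P) : Absorbed ({z, pneg z} : Multiset P) := by
  intro T p h
  refine ⟨.node T (.node (.leaf z) (.leaf (pneg z))), by simp only [SumTree.leaves]; rfl, ?_⟩
  simp [SumTree.eval, h, padd_pneg, padd_zero]

theorem absorbed_triple {p q r : P} (h : padd p q = some r) :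
    Absorbed ({p, q, pneg r} : Multiset P) := by
  intro T s hT
  refine ⟨.node T (.node (.node (.leaf p) (.leaf q)) (.leaf (pneg r))), ?_, ?_⟩
  · simp only [SumTree.leaves]; rfl
  · simp [SumTree.eval, h, hT, padd_pneg, padd_zero]

theorem absorbed_pairs (Z : Multiset P) : Absorbed (Z + Z.map pneg) := by
  induction Z using Multiset.induction_on with
  | empty => simpa using absorbed_zero
  | cons z Z ih =>
    have : (z ::ₘ Z) + (z ::ₘ Z).map pneg = {z, pneg z} + (Z + Z.map pneg) := by
      rw [Multiset.map_cons, ← Multiset.singleton_add, ← Multiset.singleton_add (pneg z),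
        Multiset.insert_eq_cons, ← Multiset.singleton_add]
      abel
    rw [this]
    exact (absorbed_pair z).add ih

/-- The formal sum of a multiset. -/
def formalSum (S : Multiset P) : FreeAbelianGroup P := (S.map FreeAbelianGroup.of).sum

theorem formalSum_add (S T : Multiset P) : formalSum (S + T) = formalSum S + formalSum T := by
  simp [formalSum]

/-- Coefficients in the free abelian group are multiplicities. This turns identities modulo the
relations back into equalities of multisets of leaves. -/
theorem formalSum_injective : Function.Injective (formalSum (P := P)) := by
  classical
  intro S T h
  have key : ∀ (S : Multiset P) (x : P),
      FreeAbelianGroup.toFinsupp (formalSum S) x = (S.count x : ℤ) := by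
    intro S x
    induction S using Multiset.induction_on with
    | empty => simp [formalSum]
    | cons a S ih =>
      have : formalSum (a ::ₘ S) = FreeAbelianGroup.of a + formalSum S := by simp [formalSum]
      rw [this, map_add, Finsupp.add_apply, ih, FreeAbelianGroup.toFinsupp_of,
        Finsupp.single_apply, Multiset.count_cons]
      by_cases hx : a = x
      · simp [hx]; ring
      · simp [hx, Ne.symm hx]
  ext x
  have := key S x
  rw [h, key T x] at this
  exact_mod_cast this.symm

/-- The relations are stable under multiplication by elements of `P`, so the ideal is merely the
additive group they generate. The relation `p + q - r` is the difference of the multisets `{p, q,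
-r}` and `{r, -r}`, whose sums vanish stepwise and can therefore be attached to any tree. -/
theorem exists_absorbed_of_mem {z : FreeAbelianGroup P} (hz : z ∈ Ideal.span (addRelations P)) :
    ∃ U W : Multiset P, z = formalSum U - formalSum W ∧ Absorbed U ∧ Absorbed (W.map pneg) := by
  have h1 : z ∈ AddSubgroup.closure (addRelations P) := by
    let J : Ideal (FreeAbelianGroup P) :=
      { carrier := AddSubgroup.closure (addRelations P)
        add_mem' := fun ha hb => add_mem ha hb
        zero_mem' := zero_mem _
        smul_mem' := by
          intro c x hx
          simp only [smul_eq_mul, SetLike.mem_coe] at hx ⊢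
          induction c using FreeAbelianGroup.induction_on with
          | zero => simp [zero_mem]
          | of m =>
            induction hx using AddSubgroup.closure_induction with
            | mem x hx =>
              obtain ⟨p, q, r, h, rfl⟩ := hx
              refine AddSubgroup.subset_closure ⟨m * p, m * q, m * r, padd_mul_some m h, ?_⟩
              simp only [mul_sub, mul_add, FreeAbelianGroup.of_mul]
            | zero => simp [zero_mem]
            | add x y _ _ hx hy => rw [mul_add]; exact add_mem hx hy
            | neg x _ hx => rw [mul_neg]; exact neg_mem hx
          | neg m hm => rw [neg_mul]; exact neg_mem hm
          | add a b ha hb => rw [add_mul]; exact add_mem ha hb }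
    exact (Ideal.span_le (I := J)).2 AddSubgroup.subset_closure hz
  -- The claim is strengthened to be symmetric in `U` and `W`, so that it passes to negatives.
  suffices ∃ U W : Multiset P, z = formalSum U - formalSum W ∧ Absorbed U ∧
      Absorbed (W.map pneg) ∧ Absorbed (U.map pneg) ∧ Absorbed W by
    obtain ⟨U, W, h⟩ := this; exact ⟨U, W, h.1, h.2.1, h.2.2.1⟩
  clear hz
  induction h1 using AddSubgroup.closure_induction with
  | mem x hx =>
    obtain ⟨p, q, r, h, rfl⟩ := hx
    refine ⟨{p, q, pneg r}, {r, pneg r}, ?_, absorbed_triple h, ?_, ?_, absorbed_pair r⟩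
    · simp [formalSum]; abel
    · simpa using absorbed_pair (pneg r)
    · simpa using absorbed_triple (padd_pneg_some h)
  | zero => exact ⟨0, 0, by simp, absorbed_zero, by simpa using absorbed_zero,
      by simpa using absorbed_zero, absorbed_zero⟩
  | add x y _ _ hx hy =>
    obtain ⟨U, W, h1, h2, h3, h4, h5⟩ := hx
    obtain ⟨U', W', h1', h2', h3', h4', h5'⟩ := hy
    refine ⟨U + U', W + W', ?_, h2.add h2', ?_, ?_, h5.add h5'⟩
    · rw [h1, h1', formalSum_add, formalSum_add]; abel
    · rw [Multiset.map_add]; exact h3.add h3'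
    · rw [Multiset.map_add]; exact h4.add h4'
  | neg x _ hx =>
    obtain ⟨U, W, h1, h2, h3, h4, h5⟩ := hx
    exact ⟨W, U, by rw [h1]; abel, h5, h4, h3, h2⟩

theorem sum_ι_of_eval {T : SumTree P} {r : P} (h : T.eval padd = some r) :
    (T.leaves.map ι).sum = ι r := by
  induction T generalizing r with
  | leaf p => simp only [SumTree.eval, Option.some.injEq] at h; simp [SumTree.leaves, h]
  | node l s hl hs =>
    simp only [SumTree.eval, Option.bind_eq_some_iff] at h
    obtain ⟨u, hu, w, hw, huw⟩ := h
    simp [SumTree.leaves, hl hu, hs hw, ι_padd huw]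

/-- An identity in the ring yields a bracketing because its proof modulo the relations can be
replayed by attaching absorbed terms to a single leaf. -/
theorem sumsTo_iff {S : Multiset P} {r : P} : SumsTo S r ↔ (S.map ι).sum = ι r := by
  constructor
  · rintro ⟨Z, T, hT, hr⟩
    have := sum_ι_of_eval hr
    rw [hT] at this
    simpa [Multiset.sum_map_neg, ι_pneg] using this
  · intro h
    have h1 : formalSum S - FreeAbelianGroup.of r ∈ Ideal.span (addRelations P) := by
      rw [← Ideal.Quotient.mk_eq_mk_iff_sub_mem, formalSum, map_multiset_sum, Multiset.map_map]
      exact h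
    obtain ⟨U, W, h2, hU, hW⟩ := exists_absorbed_of_mem h1
    have h3 : S + W = {r} + U := by
      apply formalSum_injective
      rw [formalSum_add, formalSum_add]
      have : formalSum {r} = FreeAbelianGroup.of r := by simp [formalSum]
      rw [this]
      linear_combination (exp := 1) h2
    -- The leaves of `T` are `r`, `U` and `-W`, which is `S + W + (-W)`: the multiset `S` together
    -- with pairs `z, -z`.
    obtain ⟨T, hT, hr⟩ := (hU.add hW) (.leaf r) r rfl
    refine ⟨W, T, ?_, hr⟩
    rw [hT, ← add_assoc, ← add_assoc, SumTree.leaves, ← h3]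

/-- The auxiliary pairs in the definition of a sum can be attached to `q` without changing its
value; the associative law then compares the resulting pre-association `p + q` with the given
bracketing. This is the only use of that law. -/
theorem padd_eq_some_iff {p q r : P} : padd p q = some r ↔ ι p + ι q = ι r := by
  refine ⟨ι_padd, fun h => ?_⟩
  obtain ⟨Z, T, hT, hr⟩ := (sumsTo_iff (S := {p, q}) (r := r)).2 (by simpa using h)
  obtain ⟨T', hT', hq⟩ := absorbed_pairs Z (.leaf q) q rfl
  refine assoc_law T (.leaf p) T' r p q ?_ hr rfl hq
  rw [hT, SumTree.leaves, hT', ← add_assoc, ← add_assoc, ← add_assoc]; rfl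

theorem ι_injective : Function.Injective (ι (P := P)) := by
  intro p q h
  have : padd p 0 = some q := padd_eq_some_iff.2 (by simpa using h)
  rw [padd_zero] at this
  exact Option.some.inj this

@[simp] theorem ι_inj {p q : P} : ι p = ι q ↔ p = q := ι_injective.eq_iff

@[simp] theorem ι_eq_zero {p : P} : ι p = 0 ↔ p = 0 := by
  rw [← map_zero ι, ι_inj]

instance : Nontrivial (URing P) := ⟨⟨ι 0, ι 1, fun h => zero_ne_one (ι_injective h)⟩⟩

theorem isUnit_ι {p : P} (hp : p ≠ 0) : IsUnit (ι p) := (IsUnit.mk0 p hp).map ι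

theorem padd_pneg_eq_some_iff {p q r : P} : padd p (pneg q) = some r ↔ ι p - ι q = ι r := by
  rw [padd_eq_some_iff, ι_pneg, sub_eq_add_neg]

theorem isFundamental_iff {p : P} : IsFundamental p ↔ ∃ r : P, 1 - ι p = ι r := by
  simp only [IsFundamental, padd_pneg_eq_some_iff, map_one]

theorem detEq_iff {n : ℕ} {A : Matrix (Fin n) (Fin n) P} {d : P} :
    DetEq A d ↔ (A.map ι).det = ι d := by
  rw [DetEq, sumsTo_iff, Multiset.map_map, ← Matrix.det_transpose, Matrix.det_apply]
  refine Eq.congr_left (Finset.sum_congr rfl fun σ _ => ?_)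
  rcases Int.units_eq_one_or (Equiv.Perm.sign σ) with h | h <;>
    simp [signMul, h, ι_pneg, map_prod]

theorem isPMatrix_iff {X Y : Type*} {A : Matrix X Y P} :
    IsPMatrix A ↔ ∀ (n : ℕ) (f : Fin n ↪ X) (g : Fin n ↪ Y),
      ∃ d : P, ((A.map ι).submatrix f g).det = ι d := by
  simp only [IsPMatrix, detEq_iff]; rfl

end UniversalRing

section Hom

variable {Q P : Type*} [PartialField Q] [PartialField P]

/-- The multiplicative homomorphism underlying a nonzero homomorphism of partial fields. -/
def IsHom.toMonoidWithZeroHom {φ : Q → P} (h : IsHom φ) (h1 : φ 1 = 1) : Q →*₀ P where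
  toFun := φ
  map_one' := h1
  map_mul' := h.1
  map_zero' := by
    have := h.2 0 0 0 (padd_zero 0)
    rw [padd_eq_some_iff] at this
    exact ι_eq_zero.1 (by simpa using this)

/-- The universal ring is functorial, so identities between determinants can be transported along
`φ`. -/
theorem exists_ringHom (φ : Q →*₀ P) (h : IsHom φ) :
    ∃ Φ : URing Q →+* URing P, ∀ q, Φ (ι q) = ι (φ q) := by
  let f : FreeAbelianGroup Q →+* URing P :=
    FreeAbelianGroup.liftMonoid (((ι : P →*₀ URing P) : P →* URing P).comp (φ : Q →* P))
  have hf : ∀ q, f (FreeAbelianGroup.of q) = ι (φ q) := fun q => by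
    simp [f, FreeAbelianGroup.liftMonoid_coe]
  have hI : ∀ z ∈ Ideal.span (addRelations Q), f z = 0 := by
    intro z hz
    have : Ideal.span (addRelations Q) ≤ RingHom.ker f := by
      rw [Ideal.span_le]
      rintro _ ⟨p, q, r, hpq, rfl⟩
      simp [RingHom.mem_ker, hf, ← ι_padd (h.2 _ _ _ hpq)]
    exact this hz
  exact ⟨Ideal.Quotient.lift _ f hI, fun q => by rw [ι_apply]; exact hf q⟩

end Hom

end PartialField

namespace PartialField

open Function

/-! ### Maximal minors over a commutative ring and Grassmann–Plücker relations -/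

section RingBrackets

variable {R : Type*} [CommRing R] {K E : Type*} [Fintype K] [DecidableEq K]

/-- The determinant of the columns of `V` selected by `T`. -/
def brk (V : Matrix K E R) (T : K → E) : R := (V.submatrix id T).det

theorem brk_eq_zero (V : Matrix K E R) {T : K → E} (hT : ¬ Injective T) : brk V T = 0 := by
  simp only [Injective, not_forall] at hT
  obtain ⟨i, j, h, hij⟩ := hT
  exact Matrix.det_zero_of_column_eq hij fun x => by simp [h]

theorem brk_comp_perm (V : Matrix K E R) (T : K → E) (σ : Equiv.Perm K) :
    brk V (T ∘ σ) = Equiv.Perm.sign σ * brk V T := by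
  rw [brk, brk, ← Matrix.det_permute']; rfl

theorem brk_update (V : Matrix K E R) (T : K → E) (k : K) (e : E) :
    brk V (update T k e) = Matrix.cramer (V.submatrix id T) (fun x => V x e) k := by
  rw [Matrix.cramer_apply, brk]
  congr 1
  ext x l
  rcases eq_or_ne l k with rfl | h
  · simp
  · simp [h]

theorem brk_update_sum {L : Type*} [Fintype L] (V : Matrix K E R) (T : K → E) (k : K) (e : E)
    (c : L → R) (S : L → E) (h : ∀ x, V x e = ∑ l, c l * V x (S l)) :
    brk V (update T k e) = ∑ l, c l * brk V (update T k (S l)) := by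
  simp only [brk_update]
  have : (fun x => V x e) = ∑ l, c l • (fun x => V x (S l)) := by
    ext x; simp [h x]
  rw [this, map_sum, Finset.sum_apply]
  simp

theorem brk_update_self_eq (V : Matrix K E R) (T : K → E) {k l : K} :
    brk V (update T k (T l)) = if l = k then brk V T else 0 := by
  split_ifs with h
  · rw [h, update_eq_self]
  · refine brk_eq_zero V fun hi => h ?_
    apply hi
    rw [update_self, update_of_ne h]

theorem exists_coords (V : Matrix K E R) {T : K → E} (hT : IsUnit (brk V T)) (e : E) :
    ∃ c : K → R, ∀ x, V x e = ∑ l, c l * V x (T l) := by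
  refine ⟨(V.submatrix id T)⁻¹.mulVec fun x => V x e, fun x => ?_⟩
  have : (V.submatrix id T).mulVec ((V.submatrix id T)⁻¹.mulVec fun x => V x e) x = V x e := by
    rw [Matrix.mulVec_mulVec, Matrix.mul_nonsing_inv _ hT, Matrix.one_mulVec]
  rw [← this, Matrix.mulVec, dotProduct]
  exact Finset.sum_congr rfl fun l _ => by rw [Matrix.submatrix_apply]; simp [mul_comm]

theorem brk_update_of_coords (V : Matrix K E R) (T : K → E) (k : K) {e : E} {c : K → R}
    (h : ∀ x, V x e = ∑ l, c l * V x (T l)) : brk V (update T k e) = c k * brk V T := by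
  rw [brk_update_sum V T k e c T h]
  simp [brk_update_self_eq]

theorem brk_expand (V : Matrix K E R) {T : K → E} (hT : IsUnit (brk V T)) (e : E) (x : K) :
    brk V T * V x e = ∑ l, brk V (update T l e) * V x (T l) := by
  obtain ⟨c, hc⟩ := exists_coords V hT e
  rw [hc, Finset.mul_sum]
  refine Finset.sum_congr rfl fun l _ => ?_
  rw [brk_update_of_coords V T l hc]; ring

/-- A three-term Grassmann–Plücker relation. -/
theorem brk_update_update (V : Matrix K E R) {T : K → E} (hT : IsUnit (brk V T)) {i k : K}
    (hik : i ≠ k) (y e : E) :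
    brk V (update (update T k y) i e) * brk V T =
      brk V (update T k y) * brk V (update T i e) -
        brk V (update T k e) * brk V (update T i y) := by
  obtain ⟨α, hα⟩ := exists_coords V hT y
  obtain ⟨β, hβ⟩ := exists_coords V hT e
  rw [brk_update_of_coords V T k hα, brk_update_of_coords V T i hα,
    brk_update_of_coords V T k hβ, brk_update_of_coords V T i hβ,
    brk_update_sum V (update T k y) i e β T hβ,
    Finset.sum_eq_add_of_mem i k (Finset.mem_univ _) (Finset.mem_univ _) hik]
  · have h1 : update (update T k y) i (T i) = update T k y := by
      rw [← update_of_ne hik y T, update_eq_self]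
    -- Only the `T i`-component of `y` survives, and it leaves `T` with the entries at `i` and `k`
    -- exchanged, whence the sign.
    have h2 : brk V (update (update T k y) i (T k)) = - (α i * brk V T) := by
      rw [update_comm hik.symm, brk_update_sum V _ k y α T hα,
        Finset.sum_eq_single_of_mem i (Finset.mem_univ _)]
      · have : update (update T i (T k)) k (T i) = T ∘ Equiv.swap i k := by
          ext l
          rcases eq_or_ne l k with rfl | hk
          · simp
          · rcases eq_or_ne l i with rfl | hi
            · simp [hik]
            · simp [hi, hk, Equiv.swap_apply_of_ne_of_ne hi hk]
        rw [this, brk_comp_perm, Equiv.Perm.sign_swap hik]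
        simp
      · intro l _ hl
        rw [brk_eq_zero, mul_zero]
        intro hi
        rcases eq_or_ne l k with rfl | hk
        · exact hik (hi (by simp [hik]))
        · exact hk (hi (a₁ := l) (a₂ := k) (by simp [hk, hl]))
    rw [h1, h2, brk_update_of_coords V T k hα]; ring
  · rintro l _ ⟨hi, hk⟩
    rw [brk_eq_zero, mul_zero]
    intro h
    exact hi (h (a₁ := l) (a₂ := i) (by simp [hk, hi]))

/-- The matrix is block triangular with an identity block. This identifies brackets of `[I | A]`
with subdeterminants of `A`. -/
theorem det_eq_det_submatrix (M : Matrix K K R) {n : ℕ} (f : Fin n ↪ K)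
    (h : ∀ k, k ∉ Set.range f → ∀ x, M x k = if x = k then 1 else 0) :
    M.det = (M.submatrix f f).det := by
  classical
  rw [Matrix.twoBlockTriangular_det M (fun k => k ∉ Set.range f)]
  · have h1 : M.toSquareBlockProp (fun k => k ∉ Set.range f) = 1 := by
      ext x k
      rw [Matrix.toSquareBlockProp_def, Matrix.of_apply, h _ k.2, Matrix.one_apply]
      simp [Subtype.ext_iff]
    rw [h1, Matrix.det_one, one_mul]
    let e : Fin n ≃ {k // ¬ k ∉ Set.range f} :=
      (Equiv.ofInjective f f.injective).trans (Equiv.subtypeEquivRight fun k => by simp)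
    rw [← Matrix.det_submatrix_equiv_self e]
    rfl
  · intro i hi j hj
    rw [h j hj, if_neg]
    rintro rfl
    exact hi hj

end RingBrackets

/-! ### Brackets and coordinates for the columns of `[I | A]` -/

section Brackets

variable {P : Type*} [PartialField P] {X Y : Type*}

/-- The matrix `[I | A]` over the universal ring. -/
noncomputable def extMatrix [DecidableEq X] (A : Matrix X Y P) : Matrix X (X ⊕ Y) (URing P) :=
  Matrix.fromCols 1 (A.map ι)

variable [Fintype X] [DecidableEq X]

/-- The bracket of `T` is an element of the partial field. -/
def Nice (A : Matrix X Y P) (T : X → X ⊕ Y) : Prop := ∃ p : P, brk (extMatrix A) T = ι p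

open Classical in
/-- The bracket of `T` as an element of the partial field (zero if it is not one). -/
noncomputable def chi (A : Matrix X Y P) (T : X → X ⊕ Y) : P :=
  if h : Nice A T then h.choose else 0

theorem Nice.ι_chi {A : Matrix X Y P} {T : X → X ⊕ Y} (h : Nice A T) :
    ι (chi A T) = brk (extMatrix A) T := by
  rw [chi, dif_pos h]; exact h.choose_spec.symm

theorem chi_eq {A : Matrix X Y P} {T : X → X ⊕ Y} {p : P} (h : brk (extMatrix A) T = ι p) :
    chi A T = p := ι_injective (by rw [Nice.ι_chi ⟨p, h⟩, h])

/-- The coordinate of the element `e` at position `k` with respect to the basis `T`. -/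
noncomputable def crd (A : Matrix X Y P) (T : X → X ⊕ Y) (k : X) (e : X ⊕ Y) : P :=
  chi A (update T k e) / chi A T

theorem chi_inl (A : Matrix X Y P) : chi A Sum.inl = 1 := by
  apply chi_eq
  have : (extMatrix A).submatrix id Sum.inl = 1 := by
    ext; simp [extMatrix]
  rw [brk, this]; simp

theorem brk_inl (A : Matrix X Y P) : brk (extMatrix A) Sum.inl = 1 := by
  have : (extMatrix A).submatrix id Sum.inl = 1 := by
    ext; simp [extMatrix]
  rw [brk, this]; simp

theorem extMatrix_inr_eq_sum (A : Matrix X Y P) (y : Y) (x : X) :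
    extMatrix A x (Sum.inr y) = ∑ l, ι (A l y) * extMatrix A x (Sum.inl l) := by
  simp [extMatrix, Matrix.one_apply]

theorem crd_inl_inr (A : Matrix X Y P) (x : X) (y : Y) : crd A Sum.inl x (Sum.inr y) = A x y := by
  rw [crd, chi_inl, div_one]
  apply chi_eq
  rw [brk_update_of_coords _ _ _ (extMatrix_inr_eq_sum A y), brk_inl, mul_one]

theorem isPMatrix_of_nice {A : Matrix X Y P} (h : ∀ T, Nice A T) : IsPMatrix A := by
  classical
  rw [isPMatrix_iff]
  intro n f g
  -- Exchanging the unit vector of row `f i` for the column `g i` gives a bracket equal to the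
  -- prescribed subdeterminant.
  let T : X → X ⊕ Y := fun x => if hx : ∃ i, f i = x then Sum.inr (g hx.choose) else Sum.inl x
  have hT : ∀ i, T (f i) = Sum.inr (g i) := by
    intro i
    have hx : ∃ j, f j = f i := ⟨i, rfl⟩
    have : hx.choose = i := f.injective hx.choose_spec
    simp only [T, dif_pos hx, this]
  obtain ⟨d, hd⟩ := h T
  refine ⟨d, ?_⟩
  rw [← hd, brk, det_eq_det_submatrix _ f]
  · congr 1
    ext i j
    simp [hT, extMatrix]
  · intro k hk x
    have : T k = Sum.inl k := dif_neg hk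
    simp [this, extMatrix, Matrix.one_apply]

/-- Apart from repeated entries, which give zero, a bracket is up to sign a subdeterminant of `A`:
permute the tuple so that each unit vector stands in its own position. -/
theorem IsPMatrix.nice {A : Matrix X Y P} (h : IsPMatrix A) (T : X → X ⊕ Y) : Nice A T := by
  classical
  rw [isPMatrix_iff] at h
  by_cases hT : Injective T
  swap
  · exact ⟨0, by rw [brk_eq_zero _ hT, map_zero]⟩
  let p : X → Prop := fun k => ∃ x, T k = Sum.inl x
  let q : X → Prop := fun x => ∃ k, T k = Sum.inl x
  let e0 : {k // p k} → {x // q x} := fun k => ⟨k.2.choose, k, k.2.choose_spec⟩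
  have he0 : ∀ k : {k // p k}, T k = Sum.inl (e0 k : X) := fun k => k.2.choose_spec
  have hb : Bijective e0 := by
    constructor
    · intro k l hkl
      apply Subtype.ext
      apply hT
      rw [he0, he0, hkl]
    · rintro ⟨x, k, hk⟩
      refine ⟨⟨k, x, hk⟩, Subtype.ext ?_⟩
      have := he0 ⟨k, x, hk⟩
      exact Sum.inl_injective (this.symm.trans hk)
  let e := Equiv.ofBijective e0 hb
  -- `e` sends the position of each unit vector in `T` to its row; any extension to a permutation of
  -- `X` will do, since the remaining positions hold columns of `A`.
  let σ : Equiv.Perm X := e.extendSubtype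
  have hσ : ∀ x, q x → T (σ.symm x) = Sum.inl x := by
    intro x hx
    obtain ⟨k, hk⟩ := hb.2 ⟨x, hx⟩
    have h1 : σ k = x := by
      rw [show σ k = e k from Equiv.extendSubtype_apply_of_mem e k k.2]
      exact congrArg Subtype.val hk
    have h2 : σ.symm x = k := by rw [← h1, Equiv.symm_apply_apply]
    rw [h2, he0, hk]
  have hσ' : ∀ x, ¬ q x → ∃ y, T (σ.symm x) = Sum.inr y := by
    intro x hx
    rcases hy : T (σ.symm x) with x' | y
    · exfalso
      apply hx
      have := Equiv.extendSubtype_mem e (σ.symm x) ⟨x', hy⟩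
      rwa [show e.extendSubtype (σ.symm x) = x from Equiv.apply_symm_apply σ x] at this
    · exact ⟨y, rfl⟩
  let en := Fintype.equivFin {x // ¬ q x}
  let f : Fin (Fintype.card {x // ¬ q x}) ↪ X :=
    en.symm.toEmbedding.trans (Embedding.subtype _)
  have hf : ∀ i, ¬ q (f i) := fun i => (en.symm i).2
  choose g hg using fun i => hσ' (f i) (hf i)
  have hgi : Injective g := by
    intro i j hij
    apply f.injective
    apply σ.symm.injective
    apply hT
    rw [hg, hg, hij]
  obtain ⟨d, hd⟩ := h _ f ⟨g, hgi⟩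
  have h1 : brk (extMatrix A) (T ∘ σ.symm) = ι d := by
    rw [← hd, brk, det_eq_det_submatrix _ f]
    · congr 1
      ext i j
      simp [hg, extMatrix]
    · intro k hk x
      have hqk : q k := by
        by_contra hq
        exact hk ⟨en ⟨k, hq⟩, by simp [f]⟩
      simp [hσ k hqk, extMatrix, Matrix.one_apply]
  rw [brk_comp_perm] at h1
  rcases Int.units_eq_one_or (Equiv.Perm.sign σ.symm) with hs | hs
  · exact ⟨d, by simpa [hs] using h1⟩
  · refine ⟨pneg d, ?_⟩
    rw [ι_pneg, ← h1, hs]; simp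

variable {A : Matrix X Y P} {T : X → X ⊕ Y}

theorem Nice.isUnit (h : Nice A T) (h0 : chi A T ≠ 0) : IsUnit (brk (extMatrix A) T) := by
  rw [← h.ι_chi]; exact isUnit_ι h0

theorem chi_update_self (A : Matrix X Y P) (T : X → X ⊕ Y) (k l : X) :
    chi A (update T k (T l)) = if l = k then chi A T else 0 := by
  split_ifs with h
  · rw [h, update_eq_self]
  · exact chi_eq (by rw [brk_update_self_eq, if_neg h, map_zero])

theorem crd_self (h0 : chi A T ≠ 0) (k : X) : crd A T k (T k) = 1 := by
  rw [crd, chi_update_self, if_pos rfl, div_self h0]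

theorem crd_of_ne (A : Matrix X Y P) (T : X → X ⊕ Y) {k l : X} (h : l ≠ k) :
    crd A T k (T l) = 0 := by
  rw [crd, chi_update_self, if_neg h, zero_div]

theorem chi_update_eq (h0 : chi A T ≠ 0) (k : X) (e : X ⊕ Y) :
    chi A (update T k e) = crd A T k e * chi A T := by
  rw [crd, div_mul_cancel₀ _ h0]

theorem ι_crd (h0 : chi A T ≠ 0) {k : X} {e : X ⊕ Y} (h : Nice A (update T k e)) (hT : Nice A T) :
    ι (crd A T k e) * brk (extMatrix A) T = brk (extMatrix A) (update T k e) := by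
  rw [← h.ι_chi, ← hT.ι_chi, ← map_mul, chi_update_eq h0]

theorem crd_expand (h : Nice A T) (h0 : chi A T ≠ 0) {e : X ⊕ Y}
    (he : ∀ k, Nice A (update T k e)) (x : X) :
    extMatrix A x e = ∑ l, ι (crd A T l e) * extMatrix A x (T l) := by
  have hu := h.isUnit h0
  rw [← hu.mul_right_inj, brk_expand _ hu, Finset.mul_sum]
  refine Finset.sum_congr rfl fun l _ => ?_
  rw [← ι_crd h0 (he l) h]; ring

theorem chi_update_ne_zero (h0 : chi A T ≠ 0) {k : X} {y : X ⊕ Y} (h : crd A T k y ≠ 0) :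
    chi A (update T k y) ≠ 0 := by
  rw [chi_update_eq h0]; exact mul_ne_zero h h0

/-- Pivoting: the row of the new basis element. -/
theorem crd_update_row (h0 : chi A T ≠ 0) (k : X) (y e : X ⊕ Y) :
    crd A (update T k y) k e = crd A T k e / crd A T k y := by
  rw [crd, update_idem, crd, crd, div_div_div_cancel_right₀ h0]

/-- Pivoting: the other rows. -/
theorem ι_crd_update (hT : Nice A T) (h0 : chi A T ≠ 0) {i k : X} (hik : i ≠ k) {y e : X ⊕ Y}
    (hy : crd A T k y ≠ 0)
    (h1 : Nice A (update T k y)) (h2 : Nice A (update T i y)) (h3 : Nice A (update T k e))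
    (h4 : Nice A (update T i e)) (h5 : Nice A (update (update T k y) i e)) :
    ι (crd A (update T k y) i e) =
      ι (crd A T i e) - ι (crd A T i y * crd A T k e / crd A T k y) := by
  have hu := hT.isUnit h0
  have gp := brk_update_update (extMatrix A) hu hik y e
  rw [← ι_crd (chi_update_ne_zero h0 hy) h5 h1, ← ι_crd h0 h1 hT, ← ι_crd h0 h2 hT,
    ← ι_crd h0 h3 hT, ← ι_crd h0 h4 hT] at gp
  have hk : ι (crd A T i y * crd A T k e / crd A T k y) * ι (crd A T k y) =
      ι (crd A T i y) * ι (crd A T k e) := by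
    rw [← map_mul, div_mul_cancel₀ _ hy, map_mul]
  rw [← (isUnit_ι hy).mul_left_inj, sub_mul, hk, ← hu.mul_left_inj, ← hu.mul_left_inj]
  linear_combination gp

end Brackets

end PartialField

namespace PartialField

open Function

/-! ### Pivots as basis exchanges; cross ratios -/

section Pivoting

variable {P : Type*} [PartialField P] {X Y : Type*} [Fintype X] [DecidableEq X]

/-- All brackets of tuples that differ from `T` in at most one position are defined. -/
def NiceAt (A : Matrix X Y P) (T : X → X ⊕ Y) : Prop := ∀ k e, Nice A (update T k e)

variable {A : Matrix X Y P} {T : X → X ⊕ Y}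

theorem NiceAt.nice (h : NiceAt A T) (k : X) : Nice A T := by
  have := h k (T k)
  rwa [update_eq_self] at this

variable {i j k : X} {y e f : X ⊕ Y}

theorem pivot_rule (h : NiceAt A T) (h0 : chi A T ≠ 0) (h' : NiceAt A (update T k y))
    (hy : crd A T k y ≠ 0) (hik : i ≠ k) (e : X ⊕ Y) :
    ι (crd A (update T k y) i e) =
      ι (crd A T i e) - ι (crd A T i y * crd A T k e / crd A T k y) :=
  ι_crd_update (h.nice k) h0 hik hy (h _ _) (h _ _) (h _ _) (h _ _) (h' _ _)

theorem pivot_same (h : NiceAt A T) (h0 : chi A T ≠ 0) (h' : NiceAt A (update T k y))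
    (hy : crd A T k y ≠ 0) (hik : i ≠ k) (hz : crd A T i y = 0 ∨ crd A T k e = 0) :
    crd A (update T k y) i e = crd A T i e := by
  apply ι_injective
  rw [pivot_rule h h0 h' hy hik]
  rcases hz with hz | hz <;> simp [hz]

theorem pivot_of_zero (h : NiceAt A T) (h0 : chi A T ≠ 0) (h' : NiceAt A (update T k y))
    (hy : crd A T k y ≠ 0) (hik : i ≠ k) (hz : crd A T i e = 0) :
    crd A (update T k y) i e = pneg (crd A T i y * crd A T k e / crd A T k y) := by
  apply ι_injective
  rw [pivot_rule h h0 h' hy hik, hz, ι_pneg]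
  simp

theorem pneg_eq_zero {p : P} : pneg p = 0 ↔ p = 0 := by
  rw [← ι_eq_zero, ι_pneg, neg_eq_zero, ι_eq_zero]

theorem pneg_ne_zero {p : P} (h : p ≠ 0) : pneg p ≠ 0 := mt pneg_eq_zero.1 h

theorem pivot_eq_zero_iff (h : NiceAt A T) (h0 : chi A T ≠ 0) (h' : NiceAt A (update T k y))
    (hy : crd A T k y ≠ 0) (hik : i ≠ k) :
    crd A (update T k y) i e = 0 ↔ crd A T i e = crd A T i y * crd A T k e / crd A T k y := by
  rw [← ι_eq_zero, pivot_rule h h0 h' hy hik, sub_eq_zero, ι_inj]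

theorem pivot_old (h : NiceAt A T) (h0 : chi A T ≠ 0) (h' : NiceAt A (update T k y))
    (hy : crd A T k y ≠ 0) (hik : i ≠ k) :
    crd A (update T k y) i (T k) = pneg (crd A T i y / crd A T k y) := by
  rw [pivot_of_zero h h0 h' hy hik (crd_of_ne _ _ hik.symm), crd_self h0, mul_one]

theorem pivot_old_row (h0 : chi A T ≠ 0) (k : X) (y : X ⊕ Y) :
    crd A (update T k y) k (T k) = (crd A T k y)⁻¹ := by
  rw [crd_update_row h0, crd_self h0, one_div]

/-- The unit vectors span, so no coordinate functional vanishes on all of them. This supplies pivots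
in any row whose column is an original row element, hence different from `a` and `b`. -/
theorem exists_crd_inl_ne_zero (h : NiceAt A T) (h0 : chi A T ≠ 0) (k : X) :
    ∃ x, crd A T k (Sum.inl x) ≠ 0 := by
  by_contra hx
  push Not at hx
  have h1 : brk (extMatrix A) (update T k (T k)) = 0 := by
    rw [brk_update_sum (extMatrix A) T k (T k) (fun l => extMatrix A l (T k)) Sum.inl]
    · refine Finset.sum_eq_zero fun l _ => ?_
      rw [← ι_crd h0 (h _ _) (h.nice k), hx, map_zero, zero_mul, mul_zero]
    · intro x; simp [extMatrix, Matrix.one_apply]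
  rw [update_eq_self, ← (h.nice k).ι_chi, ι_eq_zero] at h1
  exact h0 h1

/-- The cross ratio of rows `i`, `j` and columns `e`, `f` with respect to the basis `T`. -/
noncomputable def cr (A : Matrix X Y P) (T : X → X ⊕ Y) (i j : X) (e f : X ⊕ Y) : P :=
  crd A T i e * crd A T j f / (crd A T i f * crd A T j e)

/-- A set of candidates for cross ratios, closed under the symmetries of cross ratios. -/
structure IsCrossSet (U : Set P) : Prop where
  one_mem : 1 ∈ U
  inv_mem : ∀ p ∈ U, p ≠ 0 → p⁻¹ ∈ U
  compl_mem : ∀ p ∈ U, ∃ r ∈ U, 1 - ι p = ι r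

/-- If the `2 × 2` submatrix has no zero entry then its cross ratio is in `U`. -/
def GoodAt (U : Set P) (A : Matrix X Y P) (T : X → X ⊕ Y) (i j : X) (e f : X ⊕ Y) : Prop :=
  i ≠ j → crd A T i e ≠ 0 → crd A T i f ≠ 0 → crd A T j e ≠ 0 → crd A T j f ≠ 0 →
    cr A T i j e f ∈ U

variable {U : Set P}

theorem cr_ne_zero (h1 : crd A T i e ≠ 0) (h2 : crd A T i f ≠ 0) (h3 : crd A T j e ≠ 0)
    (h4 : crd A T j f ≠ 0) : cr A T i j e f ≠ 0 :=
  div_ne_zero (mul_ne_zero h1 h4) (mul_ne_zero h2 h3)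

theorem cr_inv_rows : (cr A T i j e f)⁻¹ = cr A T j i e f := by
  rw [cr, cr, inv_div, mul_comm, mul_comm (crd A T i e)]

theorem cr_inv_cols : (cr A T i j e f)⁻¹ = cr A T i j f e := by
  rw [cr, cr, inv_div]

theorem GoodAt.swap_rows (hU : IsCrossSet U) (h : GoodAt U A T i j e f) : GoodAt U A T j i e f := by
  intro hij h1 h2 h3 h4
  rw [← cr_inv_rows]
  exact hU.inv_mem _ (h hij.symm h3 h4 h1 h2) (cr_ne_zero h3 h4 h1 h2)

theorem GoodAt.swap_cols (hU : IsCrossSet U) (h : GoodAt U A T i j e f) : GoodAt U A T i j f e := by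
  intro hij h1 h2 h3 h4
  rw [← cr_inv_cols]
  exact hU.inv_mem _ (h hij h2 h1 h4 h3) (cr_ne_zero h2 h1 h4 h3)

theorem goodAt_same (hU : IsCrossSet U) (A : Matrix X Y P) (T : X → X ⊕ Y) (i j : X) (e : X ⊕ Y) :
    GoodAt U A T i j e e := by
  intro _ h1 _ h2 _
  rw [cr, div_self (mul_ne_zero h1 h2)]
  exact hU.one_mem

/-- Cross ratios in a full `2 × 3` submatrix are coherent. -/
def LineLaw (U : Set P) (A : Matrix X Y P) : Prop :=
  ∀ T, NiceAt A T → chi A T ≠ 0 → ∀ i j e f g, i ≠ j →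
    crd A T i e ≠ 0 → crd A T i f ≠ 0 → crd A T i g ≠ 0 →
    crd A T j e ≠ 0 → crd A T j f ≠ 0 → crd A T j g ≠ 0 →
    cr A T i j e f ∈ U → cr A T i j e g ∈ U → cr A T i j f g ∈ U

/-- Cross ratios in a full `3 × 2` submatrix are coherent. -/
def ColineLaw (U : Set P) (A : Matrix X Y P) : Prop :=
  ∀ T, NiceAt A T → chi A T ≠ 0 → ∀ i j k e f, i ≠ j → i ≠ k → j ≠ k →
    crd A T i e ≠ 0 → crd A T j e ≠ 0 → crd A T k e ≠ 0 →
    crd A T i f ≠ 0 → crd A T j f ≠ 0 → crd A T k f ≠ 0 →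
    cr A T i j e f ∈ U → cr A T i k e f ∈ U → cr A T j k e f ∈ U

/-- If a Fano or non-Fano submatrix occurs then `-1` is in `U`. -/
def FanoLaw (U : Set P) (A : Matrix X Y P) : Prop :=
  ∀ T, NiceAt A T → chi A T ≠ 0 → ∀ i j k w b a y, i ≠ j → i ≠ k → j ≠ k →
    crd A T j w = 0 → crd A T k b = 0 → crd A T i a = 0 →
    crd A T i y ≠ 0 → crd A T j y ≠ 0 → crd A T k y ≠ 0 →
    crd A T i w ≠ 0 → crd A T i b ≠ 0 → crd A T j a ≠ 0 →
    crd A T i w / crd A T i y = crd A T k w / crd A T k y →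
    crd A T i b / crd A T i y = crd A T j b / crd A T j y →
    crd A T j a / crd A T j y = crd A T k a / crd A T k y → pneg 1 ∈ U

/-- Cross ratios of the four elements of a `2 × 2` submatrix, after pivoting inside it. -/
theorem cr_mem_of_pivot_inside (hU : IsCrossSet U) (h : NiceAt A T) (h0 : chi A T ≠ 0)
    (h' : NiceAt A (update T k e)) (hik : i ≠ k) (h1 : crd A T i e ≠ 0) (h2 : crd A T i f ≠ 0)
    (h3 : crd A T k e ≠ 0) (h4 : crd A T k f ≠ 0)
    (hg : GoodAt U A (update T k e) i k (T k) f) : cr A T i k e f ∈ U := by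
  by_cases hz : crd A (update T k e) i f = 0
  · rw [pivot_eq_zero_iff h h0 h' h3 hik] at hz
    rw [cr, hz, div_mul_cancel₀ _ h3, div_self (mul_ne_zero h1 h4)]
    exact hU.one_mem
  · have e1 := pivot_old h h0 h' h3 hik
    have e2 := pivot_old_row (A := A) h0 k e
    have e3 := crd_update_row (A := A) h0 k e f
    have n1 : crd A (update T k e) i (T k) ≠ 0 := by
      rw [e1]; exact pneg_ne_zero (div_ne_zero h1 h3)
    have n2 : crd A (update T k e) k (T k) ≠ 0 := by rw [e2]; exact inv_ne_zero h3
    have n3 : crd A (update T k e) k f ≠ 0 := by rw [e3]; exact div_ne_zero h4 h3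
    -- If `c` is the old cross ratio and `c'` the new one, then `1 - 1/c' = 1/c`.
    obtain ⟨r, hr, hr'⟩ := hU.compl_mem _
      (hU.inv_mem _ (hg hik n1 hz n2 n3) (cr_ne_zero n1 hz n2 n3))
    have hrc : r = (cr A T i k e f)⁻¹ := by
      apply ι_injective
      rw [← hr', cr_inv_cols, cr_inv_cols, cr, cr, e1, e2, e3]
      have hrule := pivot_rule h h0 h' h3 hik f
      set z := crd A (update T k e) i f
      have a1 : z * (crd A T k e)⁻¹ /
          (pneg (crd A T i e / crd A T k e) * (crd A T k f / crd A T k e))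
          = pneg (z * (crd A T k e / (crd A T i e * crd A T k f))) := by
        rw [← mul_pneg, ← pneg_one_mul (_ / _), ← pneg_one_mul (_ / (_ * _))]
        have : pneg (1 : P) * pneg 1 = 1 := by rw [mul_pneg, mul_one, pneg_pneg]
        have hp : pneg (1 : P) ≠ 0 := pneg_ne_zero one_ne_zero
        field_simp
        rw [sq, this]
      have a2 : crd A T i f * crd A T k e / (crd A T i e * crd A T k f) =
          crd A T i f * (crd A T k e / (crd A T i e * crd A T k f)) := by rw [mul_div_assoc]
      have a3 : (crd A T i e * crd A T k f / crd A T k e) *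
          (crd A T k e / (crd A T i e * crd A T k f)) = 1 := by field_simp
      rw [a1, ι_pneg, map_mul, hrule, sub_mul, ← map_mul, ← map_mul, a3, a2,
        map_one]
      ring
    rw [← inv_inv (cr A T i k e f), ← hrc]
    refine hU.inv_mem _ hr ?_
    rw [hrc]
    exact inv_ne_zero (cr_ne_zero h1 h2 h3 h4)

/-- Removing the basis element at position `l` by a pivot in column `e`. -/
theorem cr_mem_of_pivot_column (hU : IsCrossSet U) (hn : ∀ T, Nice A T) (hL : ColineLaw U A)
    (h0 : chi A T ≠ 0) {l : X} (hil : i ≠ l) (hjl : j ≠ l) (hl : crd A T l e ≠ 0)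
    (g1 : GoodAt U A (update T l e) i j (T l) f) (g2 : GoodAt U A (update T l e) i l (T l) f)
    (g3 : GoodAt U A (update T l e) j l (T l) f) : GoodAt U A T i j e f := by
  intro hij h1 h2 h3 h4
  have h : NiceAt A T := fun _ _ => hn _
  have h' : NiceAt A (update T l e) := fun _ _ => hn _
  -- If row `l` vanishes in column `f`, the pivot fixes column `f` in rows `i`, `j` and puts a
  -- multiple of column `e` in place of `e`, so the cross ratio is unchanged. Otherwise `l` is a
  -- third full row: the cross ratios with `l` come from pivots inside the 2 × 2 blocks, and the
  -- coline law combines them.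
  by_cases hf : crd A T l f = 0
  · have e1 := pivot_old h h0 h' hl hil
    have e2 := pivot_old h h0 h' hl hjl
    have e3 : crd A (update T l e) i f = _ := pivot_same h h0 h' hl hil (Or.inr hf)
    have e4 : crd A (update T l e) j f = _ := pivot_same h h0 h' hl hjl (Or.inr hf)
    have n1 := pneg_ne_zero (div_ne_zero h1 hl)
    have n3 := pneg_ne_zero (div_ne_zero h3 hl)
    have := g1 hij (by rwa [e1]) (by rwa [e3]) (by rwa [e2]) (by rwa [e4])
    convert this using 1
    rw [cr, cr, e1, e2, e3, e4, ← pneg_one_mul, ← pneg_one_mul (_ / _)]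
    have hp : pneg (1 : P) ≠ 0 := pneg_ne_zero one_ne_zero
    field_simp
  · have c1 := cr_mem_of_pivot_inside hU h h0 h' hil h1 h2 hl hf g2
    have c2 := cr_mem_of_pivot_inside hU h h0 h' hjl h3 h4 hl hf g3
    refine hL T h h0 l i j e f hil.symm hjl.symm hij hl h1 h3 hf h2 h4 ?_ ?_
    · rw [← cr_inv_rows]; exact hU.inv_mem _ c1 (cr_ne_zero h1 h2 hl hf)
    · rw [← cr_inv_rows]; exact hU.inv_mem _ c2 (cr_ne_zero h3 h4 hl hf)

/-- Pivoting in a row that vanishes in the columns under consideration. -/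
theorem GoodAt.of_pivot_zero {l : X} (h : NiceAt A T) (h0 : chi A T ≠ 0)
    (h' : NiceAt A (update T l y)) (hil : i ≠ l) (hjl : j ≠ l) (hl : crd A T l y ≠ 0)
    (he : crd A T l e = 0 ∨ (crd A T i y = 0 ∧ crd A T j y = 0))
    (hf : crd A T l f = 0 ∨ (crd A T i y = 0 ∧ crd A T j y = 0))
    (g : GoodAt U A (update T l y) i j e f) : GoodAt U A T i j e f := by
  have e1 : crd A (update T l y) i e = _ := pivot_same h h0 h' hl hil (by tauto)
  have e2 : crd A (update T l y) j e = _ := pivot_same h h0 h' hl hjl (by tauto)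
  have e3 : crd A (update T l y) i f = _ := pivot_same h h0 h' hl hil (by tauto)
  have e4 : crd A (update T l y) j f = _ := pivot_same h h0 h' hl hjl (by tauto)
  rwa [GoodAt, cr, e1, e2, e3, e4] at g

/-- Pivoting in row `i` and a column that vanishes in row `j`. -/
theorem GoodAt.of_pivot_row (h : NiceAt A T) (h0 : chi A T ≠ 0)
    (h' : NiceAt A (update T i y)) (hi : crd A T i y ≠ 0) (hz : crd A T j y = 0)
    (g : GoodAt U A (update T i y) i j e f) : GoodAt U A T i j e f := by
  intro hij h1 h2 h3 h4
  have e1 := crd_update_row (A := A) h0 i y e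
  have e2 := crd_update_row (A := A) h0 i y f
  have e3 : crd A (update T i y) j e = _ := pivot_same h h0 h' hi hij.symm (Or.inl hz)
  have e4 : crd A (update T i y) j f = _ := pivot_same h h0 h' hi hij.symm (Or.inl hz)
  have := g hij (by rw [e1]; exact div_ne_zero h1 hi) (by rw [e2]; exact div_ne_zero h2 hi)
    (by rwa [e3]) (by rwa [e4])
  convert this using 1
  rw [cr, cr, e1, e2, e3, e4]
  field_simp

end Pivoting

end PartialField

namespace PartialField

open Function

/-! ### From deletions of two columns to the whole matrix -/

section Extension

variable {P : Type*} [PartialField P] {X Y : Type*} [Fintype X] [DecidableEq X]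

/-- All brackets are defined and all cross ratios are in `U`. -/
def AllGood (U : Set P) (A : Matrix X Y P) : Prop :=
  (∀ T, Nice A T) ∧ ∀ T, chi A T ≠ 0 → ∀ i j e f, GoodAt U A T i j e f

variable {A : Matrix X Y P} {U : Set P} {a b : X ⊕ Y}

/-- A difference is defined if the quotient is in a cross set. -/
theorem IsCrossSet.exists_sub (hU : IsCrossSet U) {p q : P}
    (h : p ≠ 0 → q ≠ 0 → p / q ∈ U) : ∃ r : P, ι p - ι q = ι r := by
  by_cases hq : q = 0
  · exact ⟨p, by simp [hq]⟩
  by_cases hp : p = 0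
  · exact ⟨pneg q, by simp [hp, ι_pneg]⟩
  obtain ⟨r, -, hr⟩ := hU.compl_mem _ (h hp hq)
  refine ⟨pneg (r * q), ?_⟩
  rw [ι_pneg, map_mul, ← hr, sub_mul, ← map_mul, div_mul_cancel₀ _ hq]
  ring

theorem avoid_update {K E : Type*} [DecidableEq K] {T : K → E} {p : E → Prop}
    (hT : ∀ l, p (T l)) (k : K) {e : E} (he : p e) (l : K) : p (update T k e l) := by
  rcases eq_or_ne l k with rfl | hl
  · rwa [update_self]
  · rw [update_of_ne hl]; exact hT l

theorem NiceAt.of_avoid (hab : a ≠ b)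
    (hC : ∀ T, ((∀ l, T l ≠ a) ∨ ∀ l, T l ≠ b) → Nice A T)
    {T : X → X ⊕ Y} (hT : ∀ l, T l ≠ a ∧ T l ≠ b) : NiceAt A T := by
  intro k e
  by_cases he : e = a
  · refine hC _ (Or.inr (avoid_update (p := (· ≠ b)) (fun l => (hT l).2) k ?_))
    rwa [he]
  · exact hC _ (Or.inl (avoid_update (p := (· ≠ a)) (fun l => (hT l).1) k he))

/-- Only brackets containing both `a` and `b` are in doubt. Trading `a` and `b` for unit vectors
gives a basis `S`, and a Grassmann–Plücker relation expresses the bracket as a difference of two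
products. That difference is defined because the quotient of the products is a cross ratio in
columns `a`, `b`. -/
theorem nice_of_pairs_good (hU : IsCrossSet U) (hab : a ≠ b)
    (ha : ∀ x, Sum.inl x ≠ a) (hb : ∀ x, Sum.inl x ≠ b)
    (hC : ∀ T, ((∀ l, T l ≠ a) ∨ ∀ l, T l ≠ b) → Nice A T)
    (h1 : ∀ T, (∀ l, T l ≠ a ∧ T l ≠ b) → chi A T ≠ 0 → ∀ i j, GoodAt U A T i j a b)
    (T : X → X ⊕ Y) : Nice A T := by
  by_cases hT : Injective T
  swap
  · exact ⟨0, by rw [brk_eq_zero _ hT, map_zero]⟩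
  by_cases hTa : ∀ l, T l ≠ a
  · exact hC T (Or.inl hTa)
  by_cases hTb : ∀ l, T l ≠ b
  · exact hC T (Or.inr hTb)
  push Not at hTa hTb
  obtain ⟨k, rfl⟩ := hTa
  obtain ⟨l, rfl⟩ := hTb
  have hkl : k ≠ l := fun h => hab (by rw [h])
  have hav : ∀ x x' m, update (update T k (Sum.inl x)) l (Sum.inl x') m ≠ T k ∧
      update (update T k (Sum.inl x)) l (Sum.inl x') m ≠ T l := by
    intro x x' m
    rcases eq_or_ne m l with rfl | hm
    · rw [update_self]; exact ⟨ha _, hb _⟩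
    · rw [update_of_ne hm]
      rcases eq_or_ne m k with rfl | hm'
      · rw [update_self]; exact ⟨ha _, hb _⟩
      · rw [update_of_ne hm']; exact ⟨hT.ne hm', hT.ne hm⟩
  have hni : ∀ x x', NiceAt A (update (update T k (Sum.inl x)) l (Sum.inl x')) :=
    fun x x' => NiceAt.of_avoid hab hC (hav x x')
  have hsum : ∀ e x, extMatrix A x e = ∑ m, extMatrix A m e * extMatrix A x (Sum.inl m) := by
    intro e x; simp [extMatrix, Matrix.one_apply]
  by_cases hz : ∃ x x', chi A (update (update T k (Sum.inl x)) l (Sum.inl x')) ≠ 0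
  · obtain ⟨x, x', h0⟩ := hz
    have hg := h1 _ (hav x x') h0 k l
    have hn := hni x x'
    set S := update (update T k (Sum.inl x)) l (Sum.inl x') with hS
    have hTS : T = update (update S k (T k)) l (T l) := by
      rw [hS, update_comm hkl, update_idem, update_comm hkl.symm, update_idem, update_comm hkl,
        update_eq_self, update_eq_self]
    have hu := (hn.nice k).isUnit h0
    have gp := brk_update_update (extMatrix A) hu hkl.symm (T k) (T l)
    rw [← hTS, ← ι_crd h0 (hn _ _) (hn.nice k), ← ι_crd h0 (hn _ _) (hn.nice k),
      ← ι_crd h0 (hn _ _) (hn.nice k), ← ι_crd h0 (hn _ _) (hn.nice k)] at gp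
    obtain ⟨r, hr⟩ := hU.exists_sub (p := crd A S k (T k) * crd A S l (T l))
      (q := crd A S k (T l) * crd A S l (T k)) fun hp hq =>
        hg hkl (left_ne_zero_of_mul hp) (left_ne_zero_of_mul hq) (right_ne_zero_of_mul hq)
          (right_ne_zero_of_mul hp)
    refine ⟨r * chi A S, ?_⟩
    rw [map_mul, ← hr, (hn.nice k).ι_chi, map_mul, map_mul, ← hu.mul_left_inj]
    linear_combination gp
  -- Every exchange of `a` and `b` for unit vectors gives zero, so expanding both columns
  -- multilinearly shows that the bracket is zero.
  · push Not at hz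
    refine ⟨0, ?_⟩
    have hs := brk_update_sum (extMatrix A) T k (T k) _ Sum.inl (hsum _)
    rw [update_eq_self] at hs
    rw [hs, map_zero]
    refine Finset.sum_eq_zero fun x _ => ?_
    have hl : update T k (Sum.inl x) l = T l := update_of_ne hkl.symm _ _
    have hs' := brk_update_sum (extMatrix A) (update T k (Sum.inl x)) l (T l) _ Sum.inl (hsum _)
    rw [← hl, update_eq_self] at hs'
    rw [hs', Finset.sum_eq_zero, mul_zero]
    intro x' _
    rw [← ((hni x x').nice k).ι_chi, hz, map_zero, mul_zero]

variable {T : X → X ⊕ Y} {i j : X} {e f : X ⊕ Y}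

/-- Cross ratios with the element `a` in the basis, `b` being outside of it. -/
theorem goodAt_of_mem_basis (hU : IsCrossSet U) (hab : a ≠ b)
    (ha : ∀ x, Sum.inl x ≠ a) (hb : ∀ x, Sum.inl x ≠ b)
    (hn : ∀ T, Nice A T) (hL : LineLaw U A) (hL' : ColineLaw U A)
    (hg : ∀ T, chi A T ≠ 0 → (∀ l, T l ≠ b) → ∀ i j e f, e ≠ b → f ≠ b → GoodAt U A T i j e f)
    (h1 : ∀ T, chi A T ≠ 0 → (∀ l, T l ≠ a ∧ T l ≠ b) → ∀ i j e f, GoodAt U A T i j e f)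
    (h0 : chi A T ≠ 0) {k : X} (hk : T k = a) (hTb : ∀ l, T l ≠ b) :
    GoodAt U A T i j e f := by
  have hN : ∀ T, NiceAt A T := fun _ _ _ => hn _
  have hinj : ∀ l, l ≠ k → T l ≠ a := by
    intro l hl h
    apply h0
    apply chi_eq
    rw [brk_eq_zero, map_zero]
    intro hi
    exact hl (hi (h.trans hk.symm))
  have hav : ∀ e, e ≠ a → e ≠ b → ∀ l, update T k e l ≠ a ∧ update T k e l ≠ b := by
    intro e he he' l
    rcases eq_or_ne l k with rfl | hl
    · rw [update_self]; exact ⟨he, he'⟩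
    · rw [update_of_ne hl]; exact ⟨hinj l hl, hTb l⟩
  -- A pivot in row `k` and column `e` removes `a` from the basis, where all cross ratios are
  -- already known.
  have key1 : ∀ T, chi A T ≠ 0 → T k = a → (∀ l, l ≠ k → T l ≠ a) → (∀ l, T l ≠ b) → ∀ i j e,
      i ≠ k → j ≠ k → e ≠ a → e ≠ b → crd A T k e ≠ 0 → ∀ f, GoodAt U A T i j e f := by
    intro T h0 hk hinj hTb i j e hi hj he he' hke f
    have hav : ∀ l, update T k e l ≠ a ∧ update T k e l ≠ b := by
      intro l
      rcases eq_or_ne l k with rfl | hl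
      · rw [update_self]; exact ⟨he, he'⟩
      · rw [update_of_ne hl]; exact ⟨hinj l hl, hTb l⟩
    have h0' := chi_update_ne_zero h0 hke
    exact cr_mem_of_pivot_column hU hn hL' h0 hi hj hke (h1 _ h0' hav _ _ _ _)
      (h1 _ h0' hav _ _ _ _) (h1 _ h0' hav _ _ _ _)
  have key : ∀ e, e ≠ b → GoodAt U A T i j e b := by
    intro e heb hij c1 c2 c3 c4
    have hea : e ≠ a := by
      rintro rfl
      rw [← hk] at c1 c3
      rcases eq_or_ne k i with h | h
      · subst h
        exact c3 (crd_of_ne _ _ hij)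
      · exact c1 (crd_of_ne _ _ h)
    by_cases hik : i = k
    · subst hik
      have h0' := chi_update_ne_zero h0 c1
      rw [← cr_inv_rows]
      refine hU.inv_mem _ ?_ (cr_ne_zero c3 c4 c1 c2)
      exact cr_mem_of_pivot_inside hU (hN _) h0 (hN _) hij.symm c3 c4 c1 c2
        (h1 _ h0' (hav e hea heb) _ _ _ _)
    by_cases hjk : j = k
    · subst hjk
      have h0' := chi_update_ne_zero h0 c3
      exact cr_mem_of_pivot_inside hU (hN _) h0 (hN _) hij c1 c2 c3 c4
        (h1 _ h0' (hav e hea heb) _ _ _ _)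
    by_cases hke : crd A T k e = 0
    swap
    · exact key1 T h0 hk hinj hTb i j e hik hjk hea heb hke b hij c1 c2 c3 c4
    -- Row `k` vanishes at `e`, so the pivot that removes `a` has to be made in an auxiliary column
    -- `x`; the cases depend on where `x` is nonzero in rows `i` and `j`.
    obtain ⟨x, hx⟩ := exists_crd_inl_ne_zero (hN T) h0 k
    have h0x := chi_update_ne_zero h0 hx
    by_cases hkb : crd A T k b = 0
    · exact GoodAt.of_pivot_zero (hN _) h0 (hN _) hik hjk hx (Or.inl hke) (Or.inl hkb)
        (h1 _ h0x (hav _ (ha x) (hb x)) _ _ _ _) hij c1 c2 c3 c4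
    -- If `x` is nonzero in just one of the two rows, a pivot there preserves the cross ratio and
    -- makes the entry of row `k` at `e` nonzero.
    have step : ∀ m n, m ≠ k → n ≠ k → n ≠ m → crd A T m (Sum.inl x) ≠ 0 →
        crd A T n (Sum.inl x) = 0 → crd A T m e ≠ 0 → GoodAt U A T m n e b := by
      intro m n hm hn' hnm hmx hnx hme
      refine GoodAt.of_pivot_row (hN _) h0 (hN _) hmx hnx ?_
      refine key1 _ (chi_update_ne_zero h0 hmx) ?_ ?_ ?_ _ _ _ hm hn' hea heb ?_ _
      · rwa [update_of_ne hm.symm]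
      · intro l hl
        rcases eq_or_ne l m with rfl | hl'
        · rw [update_self]; exact ha x
        · rw [update_of_ne hl']; exact hinj l hl
      · intro l
        rcases eq_or_ne l m with rfl | hl'
        · rw [update_self]; exact hb x
        · rw [update_of_ne hl']; exact hTb l
      · rw [pivot_of_zero (hN _) h0 (hN _) hmx hm.symm hke]
        exact pneg_ne_zero (div_ne_zero (mul_ne_zero hx hme) hmx)
    by_cases hix : crd A T i (Sum.inl x) = 0
    · by_cases hjx : crd A T j (Sum.inl x) = 0
      · exact GoodAt.of_pivot_zero (hN _) h0 (hN _) hik hjk hx (Or.inr ⟨hix, hjx⟩)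
          (Or.inr ⟨hix, hjx⟩) (h1 _ h0x (hav _ (ha x) (hb x)) _ _ _ _) hij c1 c2 c3 c4
      · exact (step j i hjk hik hij hjx hix c3).swap_rows hU hij c1 c2 c3 c4
    · by_cases hjx : crd A T j (Sum.inl x) = 0
      · exact step i j hik hjk hij.symm hix hjx c1 hij c1 c2 c3 c4
      -- With `x` nonzero in both rows, the line law reduces the columns `e`, `b` to the pairs `x`,
      -- `e` and `x`, `b`.
      · refine hL T (hN T) h0 i j (Sum.inl x) e b hij hix c1 c2 hjx c3 c4 ?_ ?_
        · exact hg T h0 hTb i j _ _ (hb x) heb hij hix c1 hjx c3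
        · exact key1 T h0 hk hinj hTb i j _ hik hjk (ha x) (hb x) hx b hij hix c2 hjx c4
  by_cases he : e = b
  · subst he
    by_cases hf : f = e
    · subst hf; exact goodAt_same hU _ _ _ _ _
    · exact (key f hf).swap_cols hU
  · by_cases hf : f = b
    · subst hf; exact key e he
    · exact hg T h0 hTb i j e f he hf

/-- A matrix is good if the deletions of `a` and `b` are, and the cross ratios in columns `a`, `b`
with respect to bases avoiding these are in `U`. -/
theorem allGood_of_pairs_good (hU : IsCrossSet U) (hab : a ≠ b)
    (ha : ∀ x, Sum.inl x ≠ a) (hb : ∀ x, Sum.inl x ≠ b)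
    (hC : ∀ T, ((∀ l, T l ≠ a) ∨ ∀ l, T l ≠ b) → Nice A T)
    (hL : LineLaw U A) (hL' : ColineLaw U A)
    (hga : ∀ T, chi A T ≠ 0 → (∀ l, T l ≠ a) → ∀ i j e f, e ≠ a → f ≠ a → GoodAt U A T i j e f)
    (hgb : ∀ T, chi A T ≠ 0 → (∀ l, T l ≠ b) → ∀ i j e f, e ≠ b → f ≠ b → GoodAt U A T i j e f)
    (h1 : ∀ T, (∀ l, T l ≠ a ∧ T l ≠ b) → chi A T ≠ 0 → ∀ i j, GoodAt U A T i j a b) :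
    AllGood U A := by
  have hn := nice_of_pairs_good hU hab ha hb hC h1
  have hN : ∀ T, NiceAt A T := fun _ _ _ => hn _
  have s1 : ∀ T, chi A T ≠ 0 → (∀ l, T l ≠ a ∧ T l ≠ b) → ∀ i j e f, GoodAt U A T i j e f := by
    intro T h0 hT i j e f
    by_cases hea : e = a
    · subst hea
      by_cases hfb : f = b
      · subst hfb; exact h1 T hT h0 i j
      · exact hgb T h0 (fun l => (hT l).2) i j _ _ hab hfb
    by_cases hfa : f = a
    · subst hfa
      by_cases heb : e = b
      · subst heb; exact (h1 T hT h0 i j).swap_cols hU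
      · exact hgb T h0 (fun l => (hT l).2) i j _ _ heb hab
    exact hga T h0 (fun l => (hT l).1) i j _ _ hea hfa
  have s2a : ∀ T, chi A T ≠ 0 → (∀ l, T l ≠ b) → ∀ i j e f, GoodAt U A T i j e f := by
    intro T h0 hT i j e f
    by_cases hTa : ∀ l, T l ≠ a
    · exact s1 T h0 (fun l => ⟨hTa l, hT l⟩) i j e f
    · push Not at hTa
      obtain ⟨k, hk⟩ := hTa
      exact goodAt_of_mem_basis hU hab ha hb hn hL hL' hgb s1 h0 hk hT
  refine ⟨hn, fun T h0 i j e f => ?_⟩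
  by_cases hT : ∀ l, T l ≠ b
  · exact s2a T h0 hT i j e f
  push Not at hT
  obtain ⟨l, hl⟩ := hT
  have hinj : ∀ m, m ≠ l → T m ≠ b := by
    intro m hm h
    apply h0
    apply chi_eq
    rw [brk_eq_zero, map_zero]
    intro hi
    exact hm (hi (h.trans hl.symm))
  have hav : ∀ e, e ≠ b → ∀ m, update T l e m ≠ b := by
    intro e he m
    rcases eq_or_ne m l with rfl | hm
    · rwa [update_self]
    · rw [update_of_ne hm]; exact hinj m hm
  intro hij c1 c2 c3 c4
  -- A column that is nonzero in two rows is not a basis element, so neither `e` nor `f` is `b`.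
  have hne : ∀ e, crd A T i e ≠ 0 → crd A T j e ≠ 0 → e ≠ b := by
    rintro e d1 d2 rfl
    rw [← hl] at d1 d2
    rcases eq_or_ne l i with h | h
    · subst h
      exact d2 (crd_of_ne _ _ hij)
    · exact d1 (crd_of_ne _ _ h)
  have heb := hne e c1 c3
  have hfb := hne f c2 c4
  by_cases hil : i = l
  · subst hil
    rw [← cr_inv_rows]
    refine hU.inv_mem _ ?_ (cr_ne_zero c3 c4 c1 c2)
    exact cr_mem_of_pivot_inside hU (hN _) h0 (hN _) hij.symm c3 c4 c1 c2
      (s2a _ (chi_update_ne_zero h0 c1) (hav e heb) _ _ _ _)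
  by_cases hjl : j = l
  · subst hjl
    exact cr_mem_of_pivot_inside hU (hN _) h0 (hN _) hij c1 c2 c3 c4
      (s2a _ (chi_update_ne_zero h0 c3) (hav e heb) _ _ _ _)
  have col : ∀ e f, e ≠ b → crd A T l e ≠ 0 → GoodAt U A T i j e f := fun e f he hle =>
    cr_mem_of_pivot_column hU hn hL' h0 hil hjl hle
      (s2a _ (chi_update_ne_zero h0 hle) (hav e he) _ _ _ _)
      (s2a _ (chi_update_ne_zero h0 hle) (hav e he) _ _ _ _)
      (s2a _ (chi_update_ne_zero h0 hle) (hav e he) _ _ _ _)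
  by_cases hle : crd A T l e = 0
  swap
  · exact col e f heb hle hij c1 c2 c3 c4
  by_cases hlf : crd A T l f = 0
  swap
  · exact (col f e hfb hlf).swap_cols hU hij c1 c2 c3 c4
  obtain ⟨x, hx⟩ := exists_crd_inl_ne_zero (hN T) h0 l
  exact GoodAt.of_pivot_zero (hN _) h0 (hN _) hil hjl hx (Or.inl hle) (Or.inl hlf)
    (s2a _ (chi_update_ne_zero h0 hx) (hav _ (hb x)) _ _ _ _) hij c1 c2 c3 c4

end Extension

end PartialField

namespace PartialField

open Function

/-! ### Chains of a relation and their shortcuts -/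

section Chains

variable {α : Type*} {r : α → α → Prop}

theorem exists_chain_of_reflTransGen {i j : α} (h : Relation.ReflTransGen r i j) :
    ∃ (n : ℕ) (f : ℕ → α), f 0 = i ∧ f n = j ∧ ∀ m < n, r (f m) (f (m + 1)) := by
  induction h with
  | refl => exact ⟨0, fun _ => i, rfl, rfl, fun m hm => absurd hm (Nat.not_lt_zero m)⟩
  | @tail b c _ hbc ih =>
    obtain ⟨n, f, h0, hn, hf⟩ := ih
    refine ⟨n + 1, fun t => if t ≤ n then f t else c, by simpa using h0, by simp, fun m hm => ?_⟩
    rcases Nat.lt_succ_iff_lt_or_eq.1 hm with hm | rfl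
    · have h1 : m + 1 ≤ n := hm
      simpa [h1, hm.le] using hf m hm
    · simpa [hn] using hbc

theorem exists_shorter_chain {n : ℕ} {f : ℕ → α} (hf : ∀ m < n, r (f m) (f (m + 1))) {m m' : ℕ}
    (h1 : m + 2 ≤ m') (h2 : m' ≤ n) (h : r (f m) (f m')) :
    ∃ n' < n, ∃ g : ℕ → α, g 0 = f 0 ∧ g n' = f n ∧ ∀ t < n', r (g t) (g (t + 1)) := by
  refine ⟨n - (m' - m - 1), by omega, fun t => if t ≤ m then f t else f (t + (m' - m - 1)), by simp,
    ?_, fun t ht => ?_⟩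
  · have : ¬ n - (m' - m - 1) ≤ m := by omega
    simp only [this, if_false]
    congr 1; omega
  · rcases lt_trichotomy t m with h' | rfl | h'
    · have h3 : t ≤ m := h'.le
      have h4 : t + 1 ≤ m := h'
      simpa [h3, h4] using hf t (by omega)
    · have h3 : t + 1 + (m' - t - 1) = m' := by omega
      simpa [h3] using h
    · have h3 : ¬ t ≤ m := by omega
      have h4 : ¬ t + 1 ≤ m := by omega
      have := hf (t + (m' - m - 1)) (by omega)
      simp only [h3, h4, if_false]
      rwa [show t + 1 + (m' - m - 1) = t + (m' - m - 1) + 1 by omega]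

end Chains

/-! ### Cross ratios in the two glued columns -/

section Pairs

variable {P : Type*} [PartialField P] {X Y : Type*} [Fintype X] [DecidableEq X]
  {A : Matrix X Y P} {U : Set P} {a b : X ⊕ Y} {T : X → X ⊕ Y} {i j k : X}

/-- The pairs `y`, `a` and `y`, `b` live in the deletions of `b` and of `a`; the line law gives the
pair `a`, `b`. -/
theorem goodAt_of_common_column
    (hN : NiceAt A T) (hL : LineLaw U A)
    (hga : ∀ i j e f, e ≠ a → f ≠ a → GoodAt U A T i j e f)
    (hgb : ∀ i j e f, e ≠ b → f ≠ b → GoodAt U A T i j e f)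
    (h0 : chi A T ≠ 0) (hab : a ≠ b) {y : X ⊕ Y} (hya : y ≠ a) (hyb : y ≠ b)
    (hi : crd A T i y ≠ 0) (hj : crd A T j y ≠ 0) : GoodAt U A T i j a b := by
  intro hij c1 c2 c3 c4
  exact hL T hN h0 i j y a b hij hi c1 c2 hj c3 c4 (hgb i j y a hyb hab hij hi c1 hj c3)
    (hga i j y b hya hab.symm hij hi c2 hj c4)

/-- `T` is a basis avoiding `a` and `b`. -/
def CleanBasis (A : Matrix X Y P) (a b : X ⊕ Y) (T : X → X ⊕ Y) : Prop :=
  (∀ l, T l ≠ a ∧ T l ≠ b) ∧ chi A T ≠ 0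

theorem CleanBasis.update (h : CleanBasis A a b T) {y : X ⊕ Y} (hya : y ≠ a) (hyb : y ≠ b)
    (hk : crd A T k y ≠ 0) : CleanBasis A a b (update T k y) :=
  ⟨avoid_update (p := fun e => e ≠ a ∧ e ≠ b) h.1 k ⟨hya, hyb⟩, chi_update_ne_zero h.2 hk⟩

/-- The situation in which the deletions of `a` and of `b` are good. -/
structure DeletionsGood (U : Set P) (A : Matrix X Y P) (a b : X ⊕ Y) : Prop where
  ne : a ≠ b
  cross : IsCrossSet U
  nice : ∀ T, ((∀ l, T l ≠ a) ∨ ∀ l, T l ≠ b) → Nice A T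
  line : LineLaw U A
  coline : ColineLaw U A
  fano : FanoLaw U A
  left : ∀ T, chi A T ≠ 0 → (∀ l, T l ≠ a) → ∀ i j e f, e ≠ a → f ≠ a → GoodAt U A T i j e f
  right : ∀ T, chi A T ≠ 0 → (∀ l, T l ≠ b) → ∀ i j e f, e ≠ b → f ≠ b → GoodAt U A T i j e f

namespace DeletionsGood

theorem symm (h : DeletionsGood U A a b) : DeletionsGood U A b a :=
  ⟨h.ne.symm, h.cross, fun T hT => h.nice T hT.symm, h.line, h.coline, h.fano, h.right, h.left⟩

theorem niceAt (h : DeletionsGood U A a b) (hT : CleanBasis A a b T) : NiceAt A T :=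
  NiceAt.of_avoid h.ne h.nice hT.1

theorem common (h : DeletionsGood U A a b) (hT : CleanBasis A a b T) {y : X ⊕ Y} (hya : y ≠ a)
    (hyb : y ≠ b) (hi : crd A T i y ≠ 0) (hj : crd A T j y ≠ 0) : GoodAt U A T i j a b :=
  goodAt_of_common_column (h.niceAt hT) h.line (h.left T hT.2 fun l => (hT.1 l).1)
    (h.right T hT.2 fun l => (hT.1 l).2) hT.2 h.ne hya hyb hi hj

/-- Rows `i` and `j` are joined by the path `i - y₀ - k - y₁ - j`. -/
structure TwoPath (A : Matrix X Y P) (a b : X ⊕ Y) (T : X → X ⊕ Y) (i k j : X) (y₀ y₁ : X ⊕ Y) :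
    Prop where
  hik : i ≠ k
  hij : i ≠ j
  hjk : j ≠ k
  y₀a : y₀ ≠ a
  y₀b : y₀ ≠ b
  y₁a : y₁ ≠ a
  y₁b : y₁ ≠ b
  i₀ : crd A T i y₀ ≠ 0
  k₀ : crd A T k y₀ ≠ 0
  j₀ : crd A T j y₀ = 0
  i₁ : crd A T i y₁ = 0
  k₁ : crd A T k y₁ ≠ 0
  j₁ : crd A T j y₁ ≠ 0

variable {y₀ y₁ : X ⊕ Y}

theorem TwoPath.symm (p : TwoPath A a b T i k j y₀ y₁) : TwoPath A a b T j k i y₁ y₀ :=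
  ⟨p.hjk, p.hij.symm, p.hik, p.y₁a, p.y₁b, p.y₀a, p.y₀b, p.j₁, p.k₁, p.i₁, p.j₀, p.k₀, p.i₀⟩

theorem TwoPath.flip (p : TwoPath A a b T i k j y₀ y₁) : TwoPath A b a T i k j y₀ y₁ :=
  ⟨p.hik, p.hij, p.hjk, p.y₀b, p.y₀a, p.y₁b, p.y₁a, p.i₀, p.k₀, p.j₀, p.i₁, p.k₁, p.j₁⟩

theorem TwoPath.clean (hT : CleanBasis A a b T) (p : TwoPath A a b T i k j y₀ y₁) :
    CleanBasis A a b (Function.update T i y₀) := hT.update p.y₀a p.y₀b p.i₀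

/-- The path after replacing the basis element at `i`. -/
theorem TwoPath.pivot (h : DeletionsGood U A a b) (hT : CleanBasis A a b T)
    (p : TwoPath A a b T i k j y₀ y₁) :
    TwoPath A a b (Function.update T i y₀) i k j (T i) y₁ := by
  have hN := h.niceAt hT
  have hN' := h.niceAt (p.clean hT)
  refine ⟨p.hik, p.hij, p.hjk, (hT.1 i).1, (hT.1 i).2, p.y₁a, p.y₁b, ?_, ?_, ?_, ?_, ?_, ?_⟩
  · rw [pivot_old_row hT.2]; exact inv_ne_zero p.i₀
  · rw [pivot_old hN hT.2 hN' p.i₀ p.hik.symm]; exact pneg_ne_zero (div_ne_zero p.k₀ p.i₀)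
  · rw [pivot_old hN hT.2 hN' p.i₀ p.hij.symm, p.j₀, zero_div, pneg_zero]
  · rw [crd_update_row hT.2, p.i₁, zero_div]
  · rw [pivot_same hN hT.2 hN' p.i₀ p.hik.symm (Or.inr p.i₁)]; exact p.k₁
  · rw [pivot_same hN hT.2 hN' p.i₀ p.hij.symm (Or.inr p.i₁)]; exact p.j₁

/-- If row `k` vanishes at both `a` and `b`, a pivot at `(k, y₀)` does not affect these columns in
rows `i`, `j` and makes `y₁` a common column of the two rows. If it vanishes at neither, `k` shares
a column with each of `i` and `j`, and the coline law applies. -/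
theorem goodAt_of_iff (h : DeletionsGood U A a b) (hT : CleanBasis A a b T)
    (p : TwoPath A a b T i k j y₀ y₁) (hab : crd A T k a = 0 ↔ crd A T k b = 0) :
    GoodAt U A T i j a b := by
  by_cases hka : crd A T k a = 0
  · have hN := h.niceAt hT
    have hT' := hT.update p.y₀a p.y₀b p.k₀
    have hN' := h.niceAt hT'
    refine GoodAt.of_pivot_zero hN hT.2 hN' p.hik p.hjk p.k₀ (Or.inl hka) (Or.inl (hab.1 hka))
      (h.common hT' p.y₁a p.y₁b ?_ ?_)
    · rw [pivot_of_zero hN hT.2 hN' p.k₀ p.hik p.i₁]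
      exact pneg_ne_zero (div_ne_zero (mul_ne_zero p.i₀ p.k₁) p.k₀)
    · rw [pivot_same hN hT.2 hN' p.k₀ p.hjk (Or.inl p.j₀)]; exact p.j₁
  · intro hij c1 c2 c3 c4
    have hkb := mt hab.2 hka
    exact h.coline T (h.niceAt hT) hT.2 k i j a b p.hik.symm p.hjk.symm hij hka c1 c3 hkb c2 c4
      (h.common hT p.y₀a p.y₀b p.k₀ p.i₀ p.hik.symm hka hkb c1 c2)
      (h.common hT p.y₁a p.y₁b p.k₁ p.j₁ p.hjk.symm hka hkb c3 c4)

/-- Pivots at `(i, y₀)`, at `(j, y₁)`, or at both preserve the cross ratio, and each may bring row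
`k` into the scope of `goodAt_of_iff`. If none does, the resulting equations force the cross ratio
to be `-1`, and a pivot at `(k, y₀)` exposes a Fano pattern, which puts `-1` in `U`. -/
theorem goodAt_of_twoPath_aux (h : DeletionsGood U A a b) (hT : CleanBasis A a b T)
    (p : TwoPath A a b T i k j y₀ y₁) (hkb : crd A T k b = 0) :
    GoodAt U A T i j a b := by
  intro hij c1 c2 c3 c4
  have hN := h.niceAt hT
  have hTi := p.clean hT
  have hNi := h.niceAt hTi
  have hTj := p.symm.clean hT
  have hNj := h.niceAt hTj
  have bi : crd A (update T i y₀) k b ≠ 0 := by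
    rw [pivot_of_zero hN hT.2 hNi p.i₀ p.hik.symm hkb]
    exact pneg_ne_zero (div_ne_zero (mul_ne_zero p.k₀ c2) p.i₀)
  have bj : crd A (update T j y₁) k b ≠ 0 := by
    rw [pivot_of_zero hN hT.2 hNj p.j₁ p.hjk.symm hkb]
    exact pneg_ne_zero (div_ne_zero (mul_ne_zero p.k₁ c4) p.j₁)
  by_cases ai : crd A (update T i y₀) k a = 0
  swap
  · exact GoodAt.of_pivot_row hN hT.2 hNi p.i₀ p.j₀
      (h.goodAt_of_iff hTi (p.pivot h hT) (by tauto)) hij c1 c2 c3 c4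
  by_cases aj : crd A (update T j y₁) k a = 0
  swap
  · exact (GoodAt.of_pivot_row hN hT.2 hNj p.j₁ p.i₁
      (h.goodAt_of_iff hTj (p.symm.pivot h hT) (by tauto))).swap_rows h.cross hij c1 c2 c3 c4
  have pi := (p.pivot h hT).symm
  have hTij := pi.clean hTi
  have hNij := h.niceAt hTij
  have e1 := crd_update_row (A := A) hT.2 i y₀
  have e2 : ∀ e, crd A (update T i y₀) j e = _ := fun e =>
    pivot_same hN hT.2 hNi p.i₀ p.hij.symm (Or.inl p.j₀)
  have e3 : crd A (update T i y₀) k y₁ = _ :=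
    pivot_same hN hT.2 hNi p.i₀ p.hik.symm (Or.inr p.i₁)
  have aij : crd A (update (update T i y₀) j y₁) k a ≠ 0 := by
    rw [pivot_of_zero hNi hTi.2 hNij pi.i₀ pi.hik.symm ai, e2]
    exact pneg_ne_zero (div_ne_zero (mul_ne_zero pi.k₀ c3) pi.i₀)
  by_cases bij : crd A (update (update T i y₀) j y₁) k b = 0
  swap
  · exact GoodAt.of_pivot_row hN hT.2 hNi p.i₀ p.j₀
      ((GoodAt.of_pivot_row hNi hTi.2 hNij pi.i₀ pi.j₀
        (h.goodAt_of_iff hTij (pi.pivot h hTi) (by tauto))).swap_rows h.cross) hij c1 c2 c3 c4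
  -- The three failed attempts now become equations between entries with respect to `T`.
  rw [pivot_eq_zero_iff hNi hTi.2 hNij pi.i₀ pi.hik.symm, e2, e2, e3,
    pivot_of_zero hN hT.2 hNi p.i₀ p.hik.symm hkb] at bij
  rw [pivot_eq_zero_iff hN hT.2 hNi p.i₀ p.hik.symm] at ai
  rw [pivot_eq_zero_iff hN hT.2 hNj p.j₁ p.hjk.symm] at aj
  have hT' := hT.update p.y₀a p.y₀b p.k₀
  have hN' := h.niceAt hT'
  have f1 : crd A (update T k y₀) i (T k) = _ := pivot_old hN hT.2 hN' p.k₀ p.hik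
  have f2 : crd A (update T k y₀) j (T k) = _ := pivot_old hN hT.2 hN' p.k₀ p.hjk
  have f3 : crd A (update T k y₀) k (T k) = _ := pivot_old_row hT.2 k y₀
  have f4 : crd A (update T k y₀) i b = _ := pivot_same hN hT.2 hN' p.k₀ p.hik (Or.inr hkb)
  have f5 : ∀ e, crd A (update T k y₀) j e = _ :=
    fun e => pivot_same hN hT.2 hN' p.k₀ p.hjk (Or.inl p.j₀)
  have f6 : ∀ e, crd A (update T k y₀) k e = _ := crd_update_row hT.2 k y₀
  have f7 : crd A (update T k y₀) i y₁ = _ := pivot_of_zero hN hT.2 hN' p.k₀ p.hik p.i₁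
  obtain ⟨-, -, -, -, -, -, -, i₀, k₀, j₀, i₁, k₁, j₁⟩ := id p
  have hp : pneg (1 : P) ≠ 0 := pneg_ne_zero one_ne_zero
  have hpp : pneg (1 : P) * pneg 1 = 1 := by rw [mul_pneg, mul_one, pneg_pneg]
  have fano : pneg (1 : P) ∈ U := by
    refine h.fano _ hN' hT'.2 i j k (T k) b a y₁ hij p.hik p.hjk ?_ ?_ ?_ ?_ ?_ ?_ ?_ ?_ ?_ ?_ ?_ ?_
    · rw [f2, p.j₀, zero_div, pneg_zero]
    · rw [f6, hkb, zero_div]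
    · rw [pivot_eq_zero_iff hN hT.2 hN' p.k₀ p.hik, ai]
      field_simp
    · rw [f7]; exact pneg_ne_zero (div_ne_zero (mul_ne_zero i₀ k₁) k₀)
    · rwa [f5]
    · rw [f6]; exact div_ne_zero k₁ k₀
    · rw [f1]; exact pneg_ne_zero (div_ne_zero i₀ k₀)
    · rwa [f4]
    · rwa [f5]
    · rw [f1, f6, f6, f7, crd_self hT.2, ← pneg_one_mul, ← pneg_one_mul (_ * _ / _)]
      field_simp
    · rw [f4, f5, f5, f7, ← pneg_one_mul]
      rw [← pneg_one_mul] at bij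
      generalize pneg (1 : P) = s at *
      field_simp at bij ⊢
      calc _ = s * s * (crd A T k y₀ * crd A T i b * crd A T j y₁) := by rw [hpp, one_mul]
        _ = s * (s * crd A T k y₀ * crd A T i b * crd A T j y₁) := by ac_rfl
        _ = _ := by rw [bij]; ac_rfl
    · rw [f5, f5, f6, f6, aj]
      field_simp
  -- The equations also say that the cross ratio of rows `i`, `j` in columns `a`, `b` is `-1`.
  convert fano using 1
  rw [cr]
  rw [← pneg_one_mul] at bij
  generalize pneg (1 : P) = s at *
  have haa := ai.symm.trans aj
  field_simp at bij haa ⊢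
  have hne : crd A T k y₀ * crd A T j y₁ * (crd A T i y₀ * crd A T k y₁) ≠ 0 :=
    mul_ne_zero (mul_ne_zero k₀ j₁) (mul_ne_zero i₀ k₁)
  refine mul_left_cancel₀ hne ?_
  calc _ = (crd A T k y₀ * crd A T j y₁ * crd A T i a) *
        (crd A T i y₀ * crd A T k y₁ * crd A T j b) := by ac_rfl
    _ = _ := by rw [haa, ← bij]; ac_rfl

theorem goodAt_of_twoPath (h : DeletionsGood U A a b) (hT : CleanBasis A a b T)
    (p : TwoPath A a b T i k j y₀ y₁) : GoodAt U A T i j a b := by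
  by_cases hka : crd A T k a = 0
  · by_cases hkb : crd A T k b = 0
    · exact h.goodAt_of_iff hT p (by tauto)
    · exact (h.symm.goodAt_of_twoPath_aux ⟨fun l => (hT.1 l).symm, hT.2⟩ p.flip
        hka).swap_cols h.cross
  · by_cases hkb : crd A T k b = 0
    · exact h.goodAt_of_twoPath_aux hT p hkb
    · exact h.goodAt_of_iff hT p (by tauto)

/-- Two rows have a common nonzero column other than `a` and `b`. -/
def Linked (A : Matrix X Y P) (a b : X ⊕ Y) (T : X → X ⊕ Y) (i j : X) : Prop :=
  ∃ e, e ≠ a ∧ e ≠ b ∧ crd A T i e ≠ 0 ∧ crd A T j e ≠ 0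

theorem Linked.refl (hT : CleanBasis A a b T) (i : X) : Linked A a b T i i :=
  ⟨T i, (hT.1 i).1, (hT.1 i).2, by rw [crd_self hT.2]; exact one_ne_zero,
    by rw [crd_self hT.2]; exact one_ne_zero⟩

/-- A chain with shortcuts is replaced by a shorter one. In a chain without shortcuts, columns
joining consecutive rows vanish in all rows further away, so a pivot can remove an inner row without
disturbing the end rows. -/
theorem goodAt_of_chain (h : DeletionsGood U A a b) (n : ℕ) : ∀ (T : X → X ⊕ Y) (f : ℕ → X),
    CleanBasis A a b T → (∀ m < n, Linked A a b T (f m) (f (m + 1))) →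
    GoodAt U A T (f 0) (f n) a b := by
  induction n using Nat.strong_induction_on with
  | _ n ih =>
  intro T f hT hf hij
  by_cases hs : ∃ m m', m + 2 ≤ m' ∧ m' ≤ n ∧ Linked A a b T (f m) (f m')
  · obtain ⟨m, m', h1, h2, h3⟩ := hs
    obtain ⟨n', hn', g, g0, gn, hg⟩ := exists_shorter_chain hf h1 h2 h3
    have := ih n' hn' T g hT hg
    rw [g0, gn] at this
    exact this hij
  push Not at hs
  have hzero : ∀ m m' e, m + 2 ≤ m' → m' ≤ n → e ≠ a → e ≠ b → crd A T (f m) e ≠ 0 →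
      crd A T (f m') e = 0 := by
    intro m m' e h1 h2 ha hb h3
    by_contra h4
    exact hs m m' h1 h2 ⟨e, ha, hb, h3, h4⟩
  have hzero' : ∀ m m' e, m + 2 ≤ m' → m' ≤ n → e ≠ a → e ≠ b → crd A T (f m') e ≠ 0 →
      crd A T (f m) e = 0 := by
    intro m m' e h1 h2 ha hb h3
    by_contra h4
    exact hs m m' h1 h2 ⟨e, ha, hb, h4, h3⟩
  have hne : ∀ m m', m + 2 ≤ m' → m' ≤ n → f m ≠ f m' := by
    intro m m' h1 h2 h3
    apply hs m m' h1 h2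
    rw [h3]
    exact Linked.refl hT _
  have : Nonempty (X ⊕ Y) := ⟨Sum.inl (f 0)⟩
  choose! y hya hyb hy hy' using hf
  match n, ih, hij, hs, hzero, hzero', hne, hya, hyb, hy, hy' with
  | 0, _, hij, _, _, _, _, _, _, _, _ => exact absurd rfl hij
  | 1, _, hij, _, _, _, _, hya, hyb, hy, hy' =>
    exact h.common hT (hya 0 one_pos) (hyb 0 one_pos) (hy 0 one_pos) (hy' 0 one_pos) hij
  | 2, _, hij, _, hzero, hzero', hne, hya, hyb, hy, hy' =>
    have z0 := hzero 0 2 (y 0) le_rfl le_rfl (hya 0 two_pos) (hyb 0 two_pos) (hy 0 two_pos)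
    have z1 := hzero' 0 2 (y 1) le_rfl le_rfl (hya 1 one_lt_two) (hyb 1 one_lt_two)
      (hy' 1 one_lt_two)
    refine h.goodAt_of_twoPath (k := f 1) (y₀ := y 0) (y₁ := y 1) hT ⟨?_, hij, ?_, hya 0 two_pos,
      hyb 0 two_pos, hya 1 one_lt_two, hyb 1 one_lt_two, hy 0 two_pos, hy' 0 two_pos, z0, z1,
      hy 1 one_lt_two, hy' 1 one_lt_two⟩ hij
    · intro h'
      rw [h'] at z1
      exact hy 1 one_lt_two z1
    · intro h'
      rw [h'] at z0
      exact hy' 0 two_pos z0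
  -- Pivot at `(f 1, y 1)`. The end rows vanish in column `y 1`, so the cross ratio stays; the pivot
  -- makes `f 2` nonzero in column `y 0`, which links `f 0` directly to `f 2`. All later links
  -- survive, and `f 1` can be skipped.
  | n + 3, ih, hij, _, hzero, hzero', hne, hya, hyb, hy, hy' =>
    have hN := h.niceAt hT
    have p1 : 1 < n + 3 := by omega
    have hk := hy 1 p1
    have hT' := hT.update (hya 1 p1) (hyb 1 p1) hk
    have hN' := h.niceAt hT'
    have z1 := hzero' 0 2 (y 1) le_rfl (by omega) (hya 1 p1) (hyb 1 p1) (hy' 1 p1)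
    have zn := hzero 1 (n + 3) (y 1) (by omega) le_rfl (hya 1 p1) (hyb 1 p1) (hy 1 p1)
    have n0 : f 0 ≠ f 1 := fun h' => by rw [h'] at z1; exact hk z1
    have nn : f (n + 3) ≠ f 1 := (hne 1 (n + 3) (by omega) le_rfl).symm
    have hch := ih (n + 2) (by omega) (update T (f 1) (y 1))
      (fun t => if t = 0 then f 0 else f (t + 1)) hT' ?_
    · simp only [if_true, Nat.add_eq_zero_iff, OfNat.ofNat_ne_zero, and_false, if_false] at hch
      exact GoodAt.of_pivot_zero hN hT.2 hN' n0 nn hk (Or.inr ⟨z1, zn⟩) (Or.inr ⟨z1, zn⟩) hch hij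
    · intro m hm
      rcases Nat.eq_zero_or_pos m with rfl | hm0
      · simp only [if_true, zero_add, one_ne_zero, if_false]
        have p0 : 0 < n + 3 := by omega
        have n2 : f 2 ≠ f 1 := fun h' => by
          apply hne 0 2 le_rfl (by omega)
          exfalso
          have := hzero 0 2 (y 0) le_rfl (by omega) (hya 0 p0) (hyb 0 p0) (hy 0 p0)
          rw [h'] at this
          exact hy' 0 p0 this
        refine ⟨y 0, hya 0 p0, hyb 0 p0, ?_, ?_⟩
        · rw [pivot_same hN hT.2 hN' hk n0 (Or.inl z1)]; exact hy 0 p0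
        · rw [pivot_of_zero hN hT.2 hN' hk n2 (hzero 0 2 (y 0) le_rfl (by omega) (hya 0 p0)
            (hyb 0 p0) (hy 0 p0))]
          exact pneg_ne_zero (div_ne_zero (mul_ne_zero (hy' 1 p1) (hy' 0 p0)) hk)
      · have m0 : m ≠ 0 := hm0.ne'
        simp only [m0, if_false, Nat.add_eq_zero_iff, one_ne_zero, and_false]
        have pm : m + 1 < n + 3 := by omega
        have zm := hzero' 1 (m + 1 + 1) (y (m + 1)) (by omega) (by omega) (hya _ pm) (hyb _ pm)
          (hy' _ pm)
        have q1 : f (m + 1) ≠ f 1 := fun h' => by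
          have := hy _ pm
          rw [h'] at this
          exact this zm
        have q2 : f (m + 1 + 1) ≠ f 1 := fun h' => by
          have := hy' _ pm
          rw [h'] at this
          exact this zm
        refine ⟨y (m + 1), hya _ pm, hyb _ pm, ?_, ?_⟩
        · rw [pivot_same hN hT.2 hN' hk q1 (Or.inr zm)]; exact hy _ pm
        · rw [pivot_same hN hT.2 hN' hk q2 (Or.inr zm)]; exact hy' _ pm

end DeletionsGood

/-! ### Separations do not depend on the basis -/

section Separators

/-- A separation of the elements that is compatible with one basis is compatible with any other. -/
theorem separation_of_basis {T T' : X → X ⊕ Y} (F s : X ⊕ Y → Prop) (hN : NiceAt A T)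
    (h0 : chi A T ≠ 0) (hN' : NiceAt A T') (h0' : chi A T' ≠ 0) (hF' : ∀ k, F (T' k))
    (hs : ∀ k e, F e → crd A T k e ≠ 0 → (s e ↔ s (T k))) {k : X} {e : X ⊕ Y} (he : F e)
    (hke : crd A T' k e ≠ 0) : s e ↔ s (T' k) := by
  classical
  let V := extMatrix A
  let δ : X ⊕ Y → URing P := fun e => if s e then 1 else 0
  have hu := (hN.nice k).isUnit h0
  have hu' := (hN'.nice k).isUnit h0'
  let M := V.submatrix id T
  -- `Q` is the projection onto the span of the basis elements on the side `s`. Each element of `F`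
  -- is an eigenvector with eigenvalue `1` or `0` according to its side; reading this in the basis
  -- `T'` shows that nonzero coordinates stay on one side.
  let Q : Matrix X X (URing P) := M * Matrix.diagonal (fun l => δ (T l)) * M⁻¹
  have hQ : ∀ e, F e → Q.mulVec (fun x => V x e) = δ e • (fun x => V x e) := by
    intro e he
    have h1 : (fun x => V x e) = M.mulVec (fun l => ι (crd A T l e)) := by
      ext x
      rw [Matrix.mulVec, dotProduct]
      change extMatrix A x e = _
      rw [crd_expand (hN.nice k) h0 (fun l => hN l e) x]
      exact Finset.sum_congr rfl fun l _ => mul_comm _ _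
    have h2 : Q * M = M * Matrix.diagonal (fun l => δ (T l)) := by
      rw [Matrix.mul_assoc, Matrix.nonsing_inv_mul _ hu, Matrix.mul_one]
    rw [h1, Matrix.mulVec_mulVec, h2, ← Matrix.mulVec_mulVec, ← Matrix.mulVec_smul]
    congr 1
    ext l
    rw [Matrix.mulVec_diagonal, Pi.smul_apply, smul_eq_mul]
    by_cases hl : crd A T l e = 0
    · simp [hl]
    · simp only [δ, hs l e he hl]
  let M' := V.submatrix id T'
  have h3 : (fun x => V x e) = M'.mulVec (fun l => ι (crd A T' l e)) := by
    ext x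
    rw [Matrix.mulVec, dotProduct]
    change extMatrix A x e = _
    rw [crd_expand (hN'.nice k) h0' (fun l => hN' l e) x]
    exact Finset.sum_congr rfl fun l _ => mul_comm _ _
  have h4 : Q * M' = M' * Matrix.diagonal (fun l => δ (T' l)) := by
    ext x l
    have := congrFun (hQ (T' l) (hF' l)) x
    rw [Matrix.mul_diagonal, Matrix.mul_apply]
    rw [Matrix.mulVec, dotProduct, Pi.smul_apply, smul_eq_mul, mul_comm] at this
    exact this
  have h5 : M'.mulVec (fun l => δ (T' l) * ι (crd A T' l e)) =
      M'.mulVec (fun l => δ e * ι (crd A T' l e)) := by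
    have := hQ e he
    rw [h3, Matrix.mulVec_mulVec, h4, ← Matrix.mulVec_mulVec, ← Matrix.mulVec_smul] at this
    have hd : (Matrix.diagonal (fun l => δ (T' l))).mulVec (fun l => ι (crd A T' l e)) =
        fun l => δ (T' l) * ι (crd A T' l e) := by
      ext l
      rw [Matrix.mulVec_diagonal]
    rw [hd] at this
    exact this
  have h6 := congrArg (fun v => M'⁻¹.mulVec v) h5
  have hM' : M'⁻¹ * M' = 1 := Matrix.nonsing_inv_mul _ hu'
  simp only [Matrix.mulVec_mulVec, hM', Matrix.one_mulVec] at h6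
  have h7 := (isUnit_ι hke).mul_left_inj.1 (congrFun h6 k)
  simp only [δ] at h7
  by_cases c1 : s e <;> by_cases c2 : s (T' k) <;> simp_all

end Separators

/-- Either every separation of the deletion of `a` and `b` has all rows on one side, or `a` and `b`
are in different components. -/
def Gluable (A : Matrix X Y P) (a b : X ⊕ Y) : Prop :=
  (∀ s : X ⊕ Y → Prop, (∀ x y, Sum.inr y ≠ a → Sum.inr y ≠ b → A x y ≠ 0 →
    (s (Sum.inr y) ↔ s (Sum.inl x))) → ∀ x x', s (Sum.inl x) ↔ s (Sum.inl x')) ∨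
  ∃ s : X ⊕ Y → Prop, (∀ x y, A x y ≠ 0 → (s (Sum.inr y) ↔ s (Sum.inl x))) ∧ s a ∧ ¬ s b

/-- Separations transfer between the basis `T` and the original one. Hence either any two rows are
joined by a chain of common columns, or no row is nonzero at both `a` and `b` and there is nothing
to prove. -/
theorem DeletionsGood.goodAt (h : DeletionsGood U A a b) (ha : ∀ x, Sum.inl x ≠ a)
    (hb : ∀ x, Sum.inl x ≠ b) (hc : Gluable A a b) (hT : CleanBasis A a b T) :
    GoodAt U A T i j a b := by
  have h0 : CleanBasis A a b Sum.inl := ⟨fun l => ⟨ha l, hb l⟩, by rw [chi_inl]; exact one_ne_zero⟩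
  have hN := h.niceAt hT
  have hN0 := h.niceAt h0
  rcases hc with hc | ⟨s, hs, hsa, hsb⟩
  · suffices hR : Relation.ReflTransGen (DeletionsGood.Linked A a b T) i j by
      obtain ⟨n, f, rfl, rfl, hf⟩ := exists_chain_of_reflTransGen hR
      exact h.goodAt_of_chain n T f hT hf
    -- The elements met by the rows linked to `i` form one side of a separation for `T`. Gluability
    -- makes this separation constant on the original row elements, and rows `i` and `j` each meet
    -- one of these.
    let s : X ⊕ Y → Prop := fun e =>
      ∃ k, Relation.ReflTransGen (DeletionsGood.Linked A a b T) i k ∧ crd A T k e ≠ 0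
    have hsT : ∀ k, s (T k) ↔ Relation.ReflTransGen (DeletionsGood.Linked A a b T) i k := by
      intro k
      constructor
      · rintro ⟨l, hl, hlk⟩
        rcases eq_or_ne k l with rfl | hkl
        · exact hl
        · exact absurd (crd_of_ne _ _ hkl) hlk
      · exact fun hk => ⟨k, hk, by rw [crd_self hT.2]; exact one_ne_zero⟩
    have hsep : ∀ k e, (e ≠ a ∧ e ≠ b) → crd A T k e ≠ 0 → (s e ↔ s (T k)) := by
      intro k e he hke
      rw [hsT]
      constructor
      · rintro ⟨l, hl, hle⟩
        exact hl.tail ⟨e, he.1, he.2, hle, hke⟩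
      · exact fun hk => ⟨k, hk, hke⟩
    have hconst := hc s fun x y hya hyb hxy =>
      separation_of_basis (fun e => e ≠ a ∧ e ≠ b) s hN hT.2 hN0 h0.2 h0.1 hsep
        ⟨hya, hyb⟩ (by rwa [crd_inl_inr])
    obtain ⟨x, hx⟩ := exists_crd_inl_ne_zero hN hT.2 i
    obtain ⟨x', hx'⟩ := exists_crd_inl_ne_zero hN hT.2 j
    rw [← hsT, ← hsep j _ ⟨ha x', hb x'⟩ hx', hconst x' x, hsep i _ ⟨ha x, hb x⟩ hx, hsT]
  · intro _ c1 c2 _ _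
    exfalso
    have key : ∀ e, crd A T i e ≠ 0 → (s e ↔ s (T i)) := fun e he =>
      separation_of_basis (fun _ => True) s hN0 h0.2 hN hT.2 (fun _ => trivial)
        (fun k e _ hke => by
          rcases e with x | y
          · rcases eq_or_ne x k with rfl | hxk
            · rfl
            · exact absurd (crd_of_ne A Sum.inl hxk) hke
          · rw [crd_inl_inr] at hke
            exact hs k y hke) trivial he
    exact hsb ((key b c2).2 ((key a c1).1 hsa))

theorem DeletionsGood.allGood (h : DeletionsGood U A a b) (ha : ∀ x, Sum.inl x ≠ a)
    (hb : ∀ x, Sum.inl x ≠ b) (hc : Gluable A a b) : AllGood U A :=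
  allGood_of_pairs_good h.cross h.ne ha hb h.nice h.line h.coline h.left h.right
    fun _ hT h0 _ _ => h.goodAt ha hb hc ⟨hT, h0⟩

end Pairs

end PartialField

namespace PartialField

open Function

/-! ### Scaling equivalence -/

section Scaling

variable {P : Type*} [PartialField P] {X Y : Type*}

theorem ScalingEquiv.refl (A : Matrix X Y P) : ScalingEquiv A A :=
  ⟨fun _ => 1, fun _ => 1, fun _ => one_ne_zero, fun _ => one_ne_zero, by simp⟩

theorem ScalingEquiv.symm {A B : Matrix X Y P} (h : ScalingEquiv A B) : ScalingEquiv B A := by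
  obtain ⟨r, c, hr, hc, h⟩ := h
  refine ⟨fun x => (r x)⁻¹, fun y => (c y)⁻¹, fun x => inv_ne_zero (hr x),
    fun y => inv_ne_zero (hc y), fun x y => ?_⟩
  have := hr x
  have := hc y
  rw [h]
  field_simp

theorem ScalingEquiv.trans {A B C : Matrix X Y P} (h : ScalingEquiv A B) (h' : ScalingEquiv B C) :
    ScalingEquiv A C := by
  obtain ⟨r, c, hr, hc, h⟩ := h
  obtain ⟨r', c', hr', hc', h'⟩ := h'
  refine ⟨fun x => r' x * r x, fun y => c y * c' y, fun x => mul_ne_zero (hr' x) (hr x),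
    fun y => mul_ne_zero (hc y) (hc' y), fun x y => ?_⟩
  change _ = (r' x * r x) * A x y * (c y * c' y)
  rw [h', h]; ac_rfl

theorem ScalingEquiv.submatrix {A B : Matrix X Y P} (h : ScalingEquiv A B) {X' Y' : Type*}
    (f : X' → X) (g : Y' → Y) : ScalingEquiv (A.submatrix f g) (B.submatrix f g) := by
  obtain ⟨r, c, hr, hc, h⟩ := h
  exact ⟨r ∘ f, c ∘ g, fun x => hr _, fun y => hc _, fun x y => h _ _⟩

theorem ScalingEquiv.transpose {A B : Matrix X Y P} (h : ScalingEquiv A B) :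
    ScalingEquiv A.transpose B.transpose := by
  obtain ⟨r, c, hr, hc, h⟩ := h
  exact ⟨c, r, hc, hr, fun x y => by rw [Matrix.transpose_apply, h, Matrix.transpose_apply]; ac_rfl⟩

theorem ScalingEquiv.ne_zero_iff {A B : Matrix X Y P} (h : ScalingEquiv A B) {x : X} {y : Y} :
    B x y ≠ 0 ↔ A x y ≠ 0 := by
  obtain ⟨r, c, hr, hc, h⟩ := h
  rw [h]
  simp [hr x, hc y]

theorem ScalingEquiv.cross {A B : Matrix X Y P} (h : ScalingEquiv A B) (i j : X) (e f : Y) :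
    B i e * B j f / (B i f * B j e) = A i e * A j f / (A i f * A j e) := by
  obtain ⟨r, c, hr, hc, h⟩ := h
  simp only [h]
  have := hr i
  have := hr j
  have := hc e
  have := hc f
  have h1 : r i * A i e * c e * (r j * A j f * c f) =
      (r i * r j * c e * c f) * (A i e * A j f) := by ac_rfl
  have h2 : r i * A i f * c f * (r j * A j e * c e) =
      (r i * r j * c e * c f) * (A i f * A j e) := by ac_rfl
  rw [h1, h2, mul_div_mul_left]
  simp_all

theorem ScalingEquiv.isPMatrix {A B : Matrix X Y P} (h : ScalingEquiv A B) (hA : IsPMatrix A) :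
    IsPMatrix B := by
  rw [isPMatrix_iff] at hA ⊢
  obtain ⟨r, c, hr, hc, h⟩ := h
  intro n f g
  obtain ⟨d, hd⟩ := hA n f g
  refine ⟨(∏ i, r (f i)) * ((∏ i, c (g i)) * d), ?_⟩
  have : (B.map ι).submatrix f g = Matrix.of fun i j =>
      ι (r (f i)) * (Matrix.of fun i j => ι (c (g j)) * (A.map ι).submatrix f g i j) i j := by
    ext i j
    simp only [Matrix.submatrix_apply, Matrix.map_apply, h, map_mul, Matrix.of_apply]
    ring
  rw [this, Matrix.det_mul_column, Matrix.det_mul_row, hd, map_mul, map_mul, map_prod, map_prod]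

theorem IsPMatrix.submatrix {A : Matrix X Y P} (h : IsPMatrix A) {X' Y' : Type*} (f : X' ↪ X)
    (g : Y' ↪ Y) : IsPMatrix (A.submatrix f g) := by
  intro n p q
  exact h n (p.trans f) (q.trans g)

theorem IsPMatrix.transpose {A : Matrix X Y P} (h : IsPMatrix A) : IsPMatrix A.transpose := by
  rw [isPMatrix_iff] at h ⊢
  intro n f g
  obtain ⟨d, hd⟩ := h n g f
  refine ⟨d, ?_⟩
  rw [← hd, ← Matrix.det_transpose]
  rfl

end Scaling

/-! ### Pivots under inversion, scaling, homomorphisms and transposition -/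

section Pivots

variable {P : Type*} [PartialField P] {X Y : Type*} {A B C : Matrix X Y P} {x : X} {y : Y}

theorem pneg_mul (p q : P) : pneg p * q = pneg (p * q) := by
  rw [mul_comm, mul_pneg, mul_comm]

theorem isPivot_iff : IsPivot A x y B ↔ A x y ≠ 0 ∧ B x y = (A x y)⁻¹ ∧
    (∀ v, v ≠ y → B x v = (A x y)⁻¹ * A x v) ∧
    (∀ u, u ≠ x → B u y = pneg ((A x y)⁻¹ * A u y)) ∧
    ∀ u v, u ≠ x → v ≠ y → ι (B u v) = ι (A u v) - ι ((A x y)⁻¹ * A u y * A x v) := by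
  simp only [IsPivot, padd_pneg_eq_some_iff, @eq_comm _ (ι (B _ _))]

theorem IsPivot.symm (h : IsPivot A x y B) : IsPivot B x y A := by
  rw [isPivot_iff] at h ⊢
  obtain ⟨h0, h1, h2, h3, h4⟩ := h
  refine ⟨by rw [h1]; exact inv_ne_zero h0, by rw [h1, inv_inv], fun v hv => ?_, fun u hu => ?_,
    fun u v hu hv => ?_⟩
  · rw [h1, h2 v hv, inv_inv, mul_inv_cancel_left₀ h0]
  · rw [h1, h3 u hu, inv_inv, mul_pneg, pneg_pneg, mul_inv_cancel_left₀ h0]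
  · rw [h4 u v hu hv, h1, h2 v hv, h3 u hu, inv_inv, mul_pneg, mul_inv_cancel_left₀ h0,
      ← pneg_one_mul]
    simp only [map_mul, ι_pneg, map_one]
    ring

theorem IsPivot.of_scaling (h : IsPivot A x y B) {A' B' : Matrix X Y P} (hA : ScalingEquiv A A')
    (h' : IsPivot A' x y B') : ScalingEquiv B B' := by
  classical
  obtain ⟨r, c, hr, hc, hA⟩ := hA
  -- The pivot exchanges the labels `x` and `y`, so each of the two takes the inverse of the other's
  -- factor.
  refine ⟨update r x (c y)⁻¹, update c y (r x)⁻¹, ?_, ?_, ?_⟩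
  · exact fun u => avoid_update (p := (· ≠ 0)) hr x (inv_ne_zero (hc y)) u
  · exact fun u => avoid_update (p := (· ≠ 0)) hc y (inv_ne_zero (hr x)) u
  rw [isPivot_iff] at h h'
  obtain ⟨h0, h1, h2, h3, h4⟩ := h
  obtain ⟨h0', h1', h2', h3', h4'⟩ := h'
  have hrx := hr x
  have hcy := hc y
  intro u v
  by_cases hu : u = x
  · subst hu
    rw [update_self]
    by_cases hv : v = y
    · subst hv
      rw [update_self, h1, h1', hA]
      field_simp
    · rw [update_of_ne hv, h2 v hv, h2' v hv, hA, hA]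
      field_simp
  · rw [update_of_ne hu]
    by_cases hv : v = y
    · subst hv
      rw [update_self, h3 u hu, h3' u hu, hA, hA, mul_pneg, pneg_mul]
      congr 1
      field_simp
    · rw [update_of_ne hv]
      apply ι_injective
      rw [map_mul, map_mul, h4 u v hu hv, h4' u v hu hv]
      have e1 : (A' x y)⁻¹ * A' u y * A' x v = r u * ((A x y)⁻¹ * A u y * A x v) * c v := by
        rw [hA, hA, hA]
        field_simp
      rw [e1, hA, map_mul, map_mul, map_mul, map_mul]
      ring

theorem IsPivot.map {Q : Type*} [PartialField Q] {φ : P →*₀ Q} (hφ : IsHom φ)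
    (h : IsPivot A x y B) : IsPivot (A.map φ) x y (B.map φ) := by
  obtain ⟨Φ, hΦ⟩ := exists_ringHom φ hφ
  have hneg : ∀ p : P, φ (pneg p) = pneg (φ p) := fun p => by
    apply ι_injective
    rw [← hΦ, ι_pneg, ι_pneg, map_neg, hΦ]
  rw [isPivot_iff] at h ⊢
  obtain ⟨h0, h1, h2, h3, h4⟩ := h
  refine ⟨by simpa using h0, by simp [h1], fun v hv => by simp [h2 v hv],
    fun u hu => by simp [h3 u hu, hneg], fun u v hu hv => ?_⟩
  have := congrArg Φ (h4 u v hu hv)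
  rw [map_sub, hΦ, hΦ, hΦ] at this
  simpa using this

/-- Pivoting negates the column but not the row of the pivot entry, so transposing costs a factor
`-1` on row `y` and column `x`. -/
theorem IsPivot.transpose (h : IsPivot A x y B) :
    ∃ C, IsPivot A.transpose y x C ∧ ScalingEquiv C B.transpose := by
  classical
  have hp : pneg (1 : P) ≠ 0 := pneg_ne_zero one_ne_zero
  have hpp : pneg (1 : P) * pneg 1 = 1 := by rw [mul_pneg, mul_one, pneg_pneg]
  let r : Y → P := fun v => if v = y then pneg 1 else 1
  let c : X → P := fun u => if u = x then pneg 1 else 1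
  have hr : ∀ v, r v ≠ 0 := fun v => by by_cases hv : v = y <;> simp [r, hv, hp]
  have hc : ∀ u, c u ≠ 0 := fun u => by by_cases hu : u = x <;> simp [c, hu, hp]
  rw [isPivot_iff] at h
  obtain ⟨h0, h1, h2, h3, h4⟩ := h
  refine ⟨fun v u => r v * B u v * c u, ?_, ScalingEquiv.symm ⟨r, c, hr, hc, fun v u => rfl⟩⟩
  refine isPivot_iff.2 ⟨h0, ?_, fun u hu => ?_, fun v hv => ?_, fun v u hv hu => ?_⟩
  · simp only [r, c, if_true, h1, Matrix.transpose_apply]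
    rw [mul_comm, ← mul_assoc, hpp, one_mul]
  · simp only [r, c, if_true, h3 u hu, hu, if_false, mul_one, Matrix.transpose_apply]
    rw [pneg_one_mul, pneg_pneg]
  · simp only [r, c, if_true, h2 v hv, hv, if_false, one_mul, Matrix.transpose_apply]
    rw [mul_comm, pneg_one_mul]
  · simp only [r, c, hv, hu, if_false, one_mul, mul_one, Matrix.transpose_apply, h4 u v hu hv,
      map_mul]
    ring

end Pivots

/-! ### Minors as coordinate matrices -/

section Minors

universe w₁ w₂

variable {P : Type*} [PartialField P]

theorem IsMinor.trans {X : Type w₁} {Y : Type w₂} {A : Matrix X Y P} {X' : Type w₁} {Y' : Type w₂}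
    {B : Matrix X' Y' P} (h : IsMinor A B) {X'' : Type w₁} {Y'' : Type w₂} {C : Matrix X'' Y'' P}
    (h' : IsMinor B C) : IsMinor A C := by
  induction h' with
  | refl => exact h
  | scale _ hs ih => exact ih.scale hs
  | delete f g _ ih => exact ih.delete f g
  | pivot x y _ hp ih => exact ih.pivot x y hp

theorem IsMinor.transpose {X : Type w₁} {Y : Type w₂} {A : Matrix X Y P} {X' : Type w₁}
    {Y' : Type w₂} {B : Matrix X' Y' P} (h : IsMinor A B) :
    IsMinor A.transpose B.transpose := by
  induction h with
  | refl => exact .refl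
  | scale _ hs ih => exact ih.scale hs.transpose
  | delete f g _ ih => exact ih.delete g f
  | pivot x y _ hp ih =>
    obtain ⟨C, hC, hs⟩ := hp.transpose
    exact (ih.pivot y x hC).scale hs

/-- A minor relation never leaves the universes of the row and column types; this moves minors of a
copy of the matrix in `Type` back to the given universes. -/
theorem IsMinor.ulift {X Y : Type} {A : Matrix X Y P} {X' Y' : Type} {B : Matrix X' Y' P}
    (h : IsMinor A B) {X₁ : Type w₁} {Y₁ : Type w₂} {A₁ : Matrix X₁ Y₁ P} (e : X ≃ X₁) (f : Y ≃ Y₁)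
    (hA : A = A₁.submatrix e f) :
    IsMinor A₁ (B.submatrix ULift.down.{w₁} ULift.down.{w₂}) := by
  induction h with
  | refl =>
    subst hA
    exact IsMinor.delete ((Equiv.ulift.trans e).toEmbedding) ((Equiv.ulift.trans f).toEmbedding)
      .refl
  | scale _ hs ih => exact ih.scale (hs.submatrix _ _)
  | delete p q _ ih =>
    exact IsMinor.delete
      ((Equiv.ulift.toEmbedding.trans p).trans Equiv.ulift.symm.toEmbedding)
      ((Equiv.ulift.toEmbedding.trans q).trans Equiv.ulift.symm.toEmbedding) ih
  | pivot x y _ hp ih =>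
    refine ih.pivot ⟨x⟩ ⟨y⟩ ?_
    obtain ⟨h0, h1, h2, h3, h4⟩ := hp
    refine ⟨h0, h1, fun v hv => h2 _ fun h => hv ?_, fun u hu => h3 _ fun h => hu ?_,
      fun u v hu hv => h4 _ _ (fun h => hu ?_) (fun h => hv ?_)⟩ <;>
    exact ULift.ext _ _ h

variable {X Y : Type*} [Fintype X] [DecidableEq X]

/-- Exchanging `T (f x)` for `s y` in the basis is a pivot, by the Grassmann–Plücker relation; the
column at `y` then stands for the element that left the basis. -/
theorem isPivot_crd {A : Matrix X Y P} (hA : ∀ T, Nice A T) {T : X → X ⊕ Y} (h0 : chi A T ≠ 0)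
    {X' Y' : Type*} [DecidableEq Y'] {f : X' → X} (hf : Injective f) (s : Y' → X ⊕ Y) {x : X'}
    {y : Y'} (hxy : crd A T (f x) (s y) ≠ 0) :
    IsPivot (fun u v => crd A T (f u) (s v)) x y
      (fun u v => crd A (update T (f x) (s y)) (f u) (update s y (T (f x)) v)) := by
  have hN : ∀ T, NiceAt A T := fun _ _ _ => hA _
  refine isPivot_iff.2 ⟨hxy, ?_, fun v hv => ?_, fun u hu => ?_, fun u v hu hv => ?_⟩
  · rw [update_self, pivot_old_row h0]
  · rw [update_of_ne hv, crd_update_row h0, div_eq_inv_mul]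
  · rw [update_self, pivot_old (hN _) h0 (hN _) hxy (hf.ne hu), div_eq_inv_mul]
  · rw [update_of_ne hv, pivot_rule (hN _) h0 (hN _) hxy (hf.ne hu)]
    congr 2
    rw [div_eq_inv_mul, mul_assoc]

/-- `D` is, up to scaling, formed by coordinates of `A` with respect to some basis. -/
def IsCrdForm (A : Matrix X Y P) {X' Y' : Type*} (D : Matrix X' Y' P) : Prop :=
  ∃ (T : X → X ⊕ Y) (f : X' → X) (s : Y' → X ⊕ Y), chi A T ≠ 0 ∧ Injective f ∧
    ScalingEquiv (fun u v => crd A T (f u) (s v)) D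

theorem isCrdForm_self (A : Matrix X Y P) : IsCrdForm A A := by
  refine ⟨Sum.inl, id, Sum.inr, by rw [chi_inl]; exact one_ne_zero, injective_id, ?_⟩
  simp only [crd_inl_inr, id]
  exact ScalingEquiv.refl A

/-- Deletions restrict the two index maps and pivots exchange a basis element, so every minor is
read off from one family of brackets of `A`. -/
theorem IsCrdForm.minor {A : Matrix X Y P} (hA : ∀ T, Nice A T) {X' : Type w₁} {Y' : Type w₂}
    {D : Matrix X' Y' P} (hD : IsCrdForm A D) {X'' : Type w₁} {Y'' : Type w₂}
    {C : Matrix X'' Y'' P} (h : IsMinor D C) : IsCrdForm A C := by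
  classical
  induction h with
  | refl => exact hD
  | scale _ hs ih =>
    obtain ⟨T, f, s, h0, hf, h⟩ := ih
    exact ⟨T, f, s, h0, hf, h.trans hs⟩
  | delete p q _ ih =>
    obtain ⟨T, f, s, h0, hf, h⟩ := ih
    exact ⟨T, f ∘ p, s ∘ q, h0, hf.comp p.injective, h.submatrix p q⟩
  | pivot x y _ hp ih =>
    obtain ⟨T, f, s, h0, hf, h⟩ := ih
    have hxy : crd A T (f x) (s y) ≠ 0 := h.ne_zero_iff.1 hp.1
    exact ⟨_, f, _, chi_update_ne_zero h0 hxy, hf, (isPivot_crd hA h0 hf s hxy).of_scaling h hp⟩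

theorem IsPMatrix.exists_pivot {A : Matrix X Y P} (hA : IsPMatrix A) {x : X} {y : Y}
    (hxy : A x y ≠ 0) : ∃ B, IsPivot A x y B := by
  classical
  have h := isPivot_crd hA.nice (T := Sum.inl) (by rw [chi_inl]; exact one_ne_zero) injective_id
    Sum.inr (x := x) (y := y) (by rwa [id, crd_inl_inr])
  simp only [crd_inl_inr, id] at h
  exact ⟨_, h⟩

/-- By multiplicativity of determinants under the change of basis to `T`, a subdeterminant of
coordinates is a quotient of two brackets of `A`. -/
theorem isPMatrix_crd {A : Matrix X Y P} (hA : ∀ T, Nice A T) {T : X → X ⊕ Y} (h0 : chi A T ≠ 0)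
    {X' Y' : Type*} {f : X' → X} (hf : Injective f) (s : Y' → X ⊕ Y) :
    IsPMatrix (fun u v => crd A T (f u) (s v)) := by
  classical
  refine isPMatrix_iff.2 fun n p q => ?_
  let F : Fin n ↪ X := p.trans ⟨f, hf⟩
  let S : X → X ⊕ Y := fun x => if hx : ∃ i, F i = x then s (q hx.choose) else T x
  have hS : ∀ i, S (F i) = s (q i) := by
    intro i
    have hx : ∃ j, F j = F i := ⟨i, rfl⟩
    have : hx.choose = i := F.injective hx.choose_spec
    simp only [S, dif_pos hx, this]
  have hu := (hA T).isUnit h0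
  let M : Matrix X X (URing P) := Matrix.of fun l k => ι (crd A T l (S k))
  have h1 : (extMatrix A).submatrix id S = (extMatrix A).submatrix id T * M := by
    ext x k
    rw [Matrix.mul_apply, Matrix.submatrix_apply, id, crd_expand (hA T) h0 fun _ => hA _]
    exact Finset.sum_congr rfl fun l _ => mul_comm _ _
  have h2 : brk (extMatrix A) S = brk (extMatrix A) T * M.det := by
    rw [brk, brk, h1, Matrix.det_mul]
  rw [det_eq_det_submatrix M F] at h2
  · refine ⟨chi A S / chi A T, ?_⟩
    rw [← hu.mul_right_inj, ← (hA T).ι_chi, ← map_mul, mul_div_cancel₀ _ h0, (hA S).ι_chi, h2,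
      (hA T).ι_chi]
    congr 2
    ext i j
    change ι (crd A T (f (p i)) (s (q j))) = ι (crd A T (F i) (S (F j)))
    rw [hS]; rfl
  · intro k hk l
    have : S k = T k := dif_neg hk
    simp only [M, Matrix.of_apply, this]
    split_ifs with hl
    · rw [hl, crd_self h0, map_one]
    · rw [crd_of_ne _ _ (Ne.symm hl), map_zero]

theorem IsCrdForm.isPMatrix {A : Matrix X Y P} (hA : ∀ T, Nice A T) {X' Y' : Type*}
    {D : Matrix X' Y' P} (hD : IsCrdForm A D) : IsPMatrix D := by
  obtain ⟨T, f, s, h0, hf, h⟩ := hD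
  exact h.isPMatrix (isPMatrix_crd hA h0 hf s)

theorem IsPMatrix.minor {X : Type w₁} [Finite X] {Y : Type w₂} {A : Matrix X Y P}
    (hA : IsPMatrix A) {X' : Type w₁} {Y' : Type w₂} {D : Matrix X' Y' P} (h : IsMinor A D) :
    IsPMatrix D := by
  classical
  have := Fintype.ofFinite X
  exact ((isCrdForm_self A).minor hA.nice h).isPMatrix hA.nice

theorem crd_of_inl {A : Matrix X Y P} {T : X → X ⊕ Y} (hT : Nice A T) (h0 : chi A T ≠ 0)
    {σ : X → X} (hσ : ∀ k, T k = Sum.inl (σ k)) (hσb : Bijective σ) (u : X) (v : Y) :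
    crd A T u (Sum.inr v) = A (σ u) v := by
  rw [crd, div_eq_iff h0]
  apply chi_eq
  rw [brk_update_of_coords (extMatrix A) T u (c := fun l => ι (A (σ l) v)), map_mul, hT.ι_chi]
  intro x
  rw [extMatrix_inr_eq_sum, ← (Equiv.ofBijective σ hσb).sum_comp]
  exact Finset.sum_congr rfl fun l _ => by rw [hσ]; rfl

/-- The induction is on the number of basis elements from `Y`: one of them is exchanged for a unit
vector, and the exchange is undone by a pivot in the minor obtained for the smaller number.
Surjectivity of `s` onto the non-basis elements is carried along so that the column for this pivot
exists. -/
theorem exists_isMinor_crd {X : Type w₁} [Fintype X] [DecidableEq X] {Y : Type w₂}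
    {A : Matrix X Y P} (hA : ∀ T, Nice A T) (n : ℕ) : ∀ T : X → X ⊕ Y,
    (Finset.univ.filter fun k => (T k).isRight = true).card = n → chi A T ≠ 0 →
    ∃ s : Y → X ⊕ Y, (∀ e, (∀ k, T k ≠ e) → ∃ y, s y = e) ∧
      IsMinor A (fun u v => crd A T u (s v)) := by
  classical
  have hN : ∀ T, NiceAt A T := fun _ _ _ => hA _
  have hinj : ∀ {T : X → X ⊕ Y}, chi A T ≠ 0 → Injective T := by
    intro T h0
    by_contra hi
    exact h0 (chi_eq (by rw [brk_eq_zero _ hi, map_zero]))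
  induction n with
  | zero =>
    intro T hT h0
    have hl : ∀ k, ∃ x, T k = Sum.inl x := by
      intro k
      rw [Finset.card_eq_zero, Finset.filter_eq_empty_iff] at hT
      rcases hk : T k with x | y
      · exact ⟨x, rfl⟩
      · exact absurd (by rw [hk]; rfl) (hT (Finset.mem_univ k))
    choose σ hσ using hl
    have hσi : Injective σ := fun k l h => hinj h0 (by rw [hσ, hσ, h])
    have hσb : Bijective σ := Finite.injective_iff_bijective.1 hσi
    refine ⟨Sum.inr, ?_, ?_⟩
    · rintro (x | y) he
      · obtain ⟨k, rfl⟩ := hσb.2 x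
        exact absurd (hσ k) (he k)
      · exact ⟨y, rfl⟩
    · have : (fun u v => crd A T u (Sum.inr v)) = A.submatrix σ id := by
        ext u v
        exact crd_of_inl (hA T) h0 hσ hσb u v
      rw [this]
      exact IsMinor.delete ⟨σ, hσi⟩ (Embedding.refl Y) .refl
  | succ n ih =>
    intro T hT h0
    obtain ⟨k, hk⟩ : (Finset.univ.filter fun k => (T k).isRight = true).Nonempty := by
      rw [← Finset.card_pos, hT]; omega
    obtain ⟨x, hx⟩ := exists_crd_inl_ne_zero (hN T) h0 k
    have h0' := chi_update_ne_zero h0 hx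
    have hc : (Finset.univ.filter fun l =>
        (update T k (Sum.inl x : X ⊕ Y) l).isRight = true).card = n := by
      have : (Finset.univ.filter fun l => (update T k (Sum.inl x : X ⊕ Y) l).isRight = true) =
          (Finset.univ.filter fun l => (T l).isRight = true).erase k := by
        ext l
        rcases eq_or_ne l k with rfl | hl
        · simp
        · simp [hl]
      rw [this, Finset.card_erase_of_mem hk, hT, Nat.add_sub_cancel]
    obtain ⟨s, hs, hm⟩ := ih _ hc h0'
    · have hTk : ∀ l, update T k (Sum.inl x) l ≠ T k := by
        intro l
        rcases eq_or_ne l k with rfl | hl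
        · rw [update_self]
          intro h
          have := (Finset.mem_filter.1 hk).2
          rw [← h] at this
          simp at this
        · rw [update_of_ne hl]; exact (hinj h0).ne hl
      obtain ⟨v, hv⟩ := hs (T k) hTk
      have hkv : crd A (update T k (Sum.inl x)) (id k) (s v) ≠ 0 := by
        rw [hv, id, pivot_old_row h0]; exact inv_ne_zero hx
      have hp := isPivot_crd hA h0' injective_id s hkv
      rw [id, hv, update_idem, update_eq_self, update_self] at hp
      refine ⟨_, fun e he => ?_, hm.pivot k v hp⟩
      by_cases hex : e = Sum.inl x
      · exact ⟨v, by rw [hex, update_self]⟩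
      · obtain ⟨y, hy⟩ := hs e (avoid_update (p := (· ≠ e)) he k (Ne.symm hex))
        refine ⟨y, ?_⟩
        rw [update_of_ne, hy]
        rintro rfl
        exact he k (hv.symm.trans hy)

theorem isMinor_crd {X : Type w₁} [Fintype X] [DecidableEq X] {Y : Type w₂}
    {A : Matrix X Y P} (hA : ∀ T, Nice A T) {T : X → X ⊕ Y} (h0 : chi A T ≠ 0)
    {X' : Type w₁} {Y' : Type w₂} {f : X' → X} (hf : Injective f) {s : Y' → X ⊕ Y}
    (hs : Injective s) (hsT : ∀ v k, T k ≠ s v) :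
    IsMinor A (fun u v => crd A T (f u) (s v)) := by
  obtain ⟨s₀, hs₀, hm⟩ := exists_isMinor_crd hA _ T rfl h0
  choose g hg using fun v => hs₀ (s v) (hsT v)
  have hgi : Injective g := fun v w h => hs (by rw [← hg, ← hg, h])
  have : (fun u v => crd A T (f u) (s v)) =
      (Matrix.of fun u v => crd A T u (s₀ v)).submatrix (⟨f, hf⟩ : X' ↪ X) (⟨g, hgi⟩ : Y' ↪ Y) := by
    ext u v
    simp [hg]
  rw [this]
  exact IsMinor.delete _ _ hm

end Minors

/-! ### Goodness in terms of minors -/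

section AllGood

variable {P : Type*} [PartialField P] {X Y : Type} [Fintype X] [DecidableEq X] {U : Set P}

theorem AllGood.cross_mem {X Y : Type*} [Fintype X] [DecidableEq X] {A : Matrix X Y P}
    (h : AllGood U A) {X' Y' : Type*} {D : Matrix X' Y' P}
    (hD : IsCrdForm A D) {i j : X'} {e f : Y'} (hij : i ≠ j) (h1 : D i e ≠ 0) (h2 : D i f ≠ 0)
    (h3 : D j e ≠ 0) (h4 : D j f ≠ 0) : D i e * D j f / (D i f * D j e) ∈ U := by
  obtain ⟨T, p, s, h0, hp, hs⟩ := hD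
  rw [hs.cross]
  rw [hs.ne_zero_iff] at h1 h2 h3 h4
  exact h.2 T h0 _ _ _ _ (hp.ne hij) h1 h2 h3 h4

/-- This description mentions no basis, which makes invariance under minors and transposition
immediate. -/
theorem allGood_iff (hU : IsCrossSet U) {A : Matrix X Y P} : AllGood U A ↔ IsPMatrix A ∧
    ∀ (X' Y' : Type) (D : Matrix X' Y' P), IsMinor A D → ∀ i j e f, i ≠ j → D i e ≠ 0 →
      D i f ≠ 0 → D j e ≠ 0 → D j f ≠ 0 → D i e * D j f / (D i f * D j e) ∈ U := by
  constructor
  · intro h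
    exact ⟨isPMatrix_of_nice h.1, fun X' Y' D hD i j e f hij h1 h2 h3 h4 =>
      h.cross_mem ((isCrdForm_self A).minor h.1 hD) hij h1 h2 h3 h4⟩
  · rintro ⟨hA, h⟩
    refine ⟨hA.nice, fun T h0 i j e f => ?_⟩
    by_cases hef : e = f
    · subst hef; exact goodAt_same hU _ _ _ _ _
    intro hij h1 h2 h3 h4
    have hT : ∀ e, crd A T i e ≠ 0 → crd A T j e ≠ 0 → ∀ k, T k ≠ e := by
      rintro e c1 c2 k rfl
      rcases eq_or_ne k i with rfl | hki
      · exact c2 (crd_of_ne _ _ hij)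
      · exact c1 (crd_of_ne _ _ hki)
    have hm := isMinor_crd (X' := Fin 2) (Y' := Fin 2) hA.nice h0 (f := ![i, j])
      (s := ![e, f]) ?_ ?_ ?_
    · have := h _ _ _ hm 0 1 0 1 (by decide) h1 h2 h3 h4
      exact this
    · intro u v; fin_cases u <;> fin_cases v <;> simp [hij, hij.symm]
    · intro u v; fin_cases u <;> fin_cases v <;> simp [hef, Ne.symm hef]
    · intro v; fin_cases v
      · exact hT e h1 h3
      · exact hT f h2 h4

theorem AllGood.minor (hU : IsCrossSet U) {A : Matrix X Y P} (h : AllGood U A) {X' Y' : Type}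
    [Fintype X'] [DecidableEq X'] {B : Matrix X' Y' P} (hB : IsMinor A B) : AllGood U B := by
  rw [allGood_iff hU] at h ⊢
  exact ⟨h.1.minor hB, fun X'' Y'' D hD => h.2 _ _ D (hB.trans hD)⟩

theorem AllGood.transpose (hU : IsCrossSet U) {Y : Type} [Fintype Y] [DecidableEq Y]
    {A : Matrix X Y P} (h : AllGood U A) : AllGood U A.transpose := by
  rw [allGood_iff hU] at h ⊢
  refine ⟨h.1.transpose, fun X' Y' D hD i j e f hij h1 h2 h3 h4 => ?_⟩
  by_cases hef : e = f
  · subst hef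
    rw [div_self (mul_ne_zero h1 h3)]
    exact hU.one_mem
  have := h.2 _ _ D.transpose hD.transpose e f i j hef h1 h3 h2 h4
  simpa only [Matrix.transpose_apply, mul_comm, mul_left_comm] using this

end AllGood

end PartialField

namespace PartialField

open Function

/-! ### Signatures of induced cycles -/

section Cycles

variable {P : Type*} [PartialField P]

/-- The nonzero pattern of a chordless cycle through rows and columns `0, …, n + 1`. -/
structure CyclePattern (n : ℕ) (S : ℕ → ℕ → Prop) : Prop where
  diag : ∀ i ≤ n + 1, S i i
  sub : ∀ i ≤ n, S (i + 1) i
  corner : S 0 (n + 1)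
  off : ∀ i ≤ n + 1, ∀ j ≤ n + 1, S i j → i = j ∨ i = j + 1 ∨ (i = 0 ∧ j = n + 1)

/-- The signature of the cycle through rows and columns `0, …, n + 1`. -/
noncomputable def cycleVal (n : ℕ) (M : ℕ → ℕ → P) : P :=
  pneg 1 ^ n * ((∏ i ∈ Finset.range (n + 2), M i i) /
    ((∏ i ∈ Finset.range (n + 1), M (i + 1) i) * M 0 (n + 1)))

theorem cycleVal_scale (n : ℕ) (M : ℕ → ℕ → P) {r c : ℕ → P} (hr : ∀ i, r i ≠ 0)
    (hc : ∀ i, c i ≠ 0) : cycleVal n (fun i j => r i * M i j * c j) = cycleVal n M := by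
  have h : (∏ i ∈ Finset.range (n + 1), r (i + 1)) * r 0 = ∏ i ∈ Finset.range (n + 2), r i := by
    rw [Finset.prod_range_succ' r]
  have h' : (∏ i ∈ Finset.range (n + 1), c i) * c (n + 1) = ∏ i ∈ Finset.range (n + 2), c i :=
    (Finset.prod_range_succ c (n + 1)).symm
  have h1 : (∏ i ∈ Finset.range (n + 2), r i) * ∏ i ∈ Finset.range (n + 2), c i ≠ 0 :=
    mul_ne_zero (Finset.prod_ne_zero_iff.2 fun i _ => hr i)
      (Finset.prod_ne_zero_iff.2 fun i _ => hc i)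
  simp only [cycleVal, Finset.prod_mul_distrib]
  congr 1
  symm
  rw [← mul_div_mul_left _ _ h1, ← h, ← h']
  congr 1 <;> ac_rfl

variable {X Y : Type*} [Fintype X] [DecidableEq X] {A : Matrix X Y P} {U : Set P}

/-- A pivot at the last diagonal entry of the cycle removes its row and column, and the new corner
entry, with its sign, absorbs the three entries lost; the signature is unchanged. The process ends
at a 2 × 2 submatrix, whose signature is a cross ratio. -/
theorem cycleVal_crd_mem (h : AllGood U A) (n : ℕ) : ∀ (T : X → X ⊕ Y) (x : ℕ → X)
    (e : ℕ → X ⊕ Y), chi A T ≠ 0 → (∀ i ≤ n + 1, ∀ j ≤ n + 1, x i = x j → i = j) →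
    CyclePattern n (fun i j => crd A T (x i) (e j) ≠ 0) →
    cycleVal n (fun i j => crd A T (x i) (e j)) ∈ U := by
  have hN : ∀ T, NiceAt A T := fun _ _ _ => h.1 _
  induction n with
  | zero =>
    intro T x e h0 hx hp
    have := h.2 T h0 (x 0) (x 1) (e 0) (e 1)
      (fun h => absurd (hx 0 (by omega) 1 (by omega) h) (by omega))
      (hp.diag 0 (by omega)) hp.corner (hp.sub 0 (by omega)) (hp.diag 1 (by omega))
    simpa [cycleVal, Finset.prod_range_succ, cr, mul_comm] using this
  | succ n ih =>
    intro T x e h0 hx hp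
    have hk := hp.diag (n + 2) (by omega)
    have hne : ∀ i ≤ n + 1, x i ≠ x (n + 2) := fun i hi h =>
      absurd (hx i (by omega) (n + 2) (by omega) h) (by omega)
    have hz : ∀ i ≤ n + 2, ∀ j ≤ n + 2, ¬ (i = j ∨ i = j + 1 ∨ (i = 0 ∧ j = n + 2)) →
        crd A T (x i) (e j) = 0 := by
      intro i hi j hj hij
      by_contra hc
      exact hij (hp.off i hi j hj hc)
    have hsame : ∀ i ≤ n + 1, ∀ j ≤ n + 1, ¬ (i = 0 ∧ j = n + 1) →
        crd A (update T (x (n + 2)) (e (n + 2))) (x i) (e j) = crd A T (x i) (e j) := by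
      intro i hi j hj hij
      refine pivot_same (hN _) h0 (hN _) hk (hne i hi) ?_
      by_cases hi0 : i = 0
      · exact Or.inr (hz _ (by omega) _ (by omega) (by omega))
      · exact Or.inl (hz _ (by omega) _ (by omega) (by omega))
    have hcorner : crd A (update T (x (n + 2)) (e (n + 2))) (x 0) (e (n + 1)) =
        pneg (crd A T (x 0) (e (n + 2)) * (crd A T (x (n + 2)) (e (n + 1)) /
          crd A T (x (n + 2)) (e (n + 2)))) := by
      apply ι_injective
      rw [pivot_rule (hN _) h0 (hN _) hk (hne 0 (by omega)), ι_pneg,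
        hz 0 (by omega) (n + 1) (by omega) (by omega), map_zero, zero_sub,
        mul_div_assoc]
    have hc0 : crd A (update T (x (n + 2)) (e (n + 2))) (x 0) (e (n + 1)) ≠ 0 := by
      rw [hcorner]
      exact pneg_ne_zero (mul_ne_zero hp.corner (div_ne_zero (hp.sub (n + 1) (by omega)) hk))
    have := ih (update T (x (n + 2)) (e (n + 2))) x e (chi_update_ne_zero h0 hk)
      (fun i hi j hj => hx i (by omega) j (by omega)) ⟨?_, ?_, hc0, ?_⟩
    · convert this using 1
      simp only [cycleVal]
      rw [Finset.prod_range_succ (fun i => crd A T (x i) (e i)) (n + 2),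
        Finset.prod_range_succ (fun i => crd A T (x (i + 1)) (e i)) (n + 1), hcorner]
      have e1 : ∏ i ∈ Finset.range (n + 2),
          crd A (update T (x (n + 2)) (e (n + 2))) (x i) (e i) =
          ∏ i ∈ Finset.range (n + 2), crd A T (x i) (e i) :=
        Finset.prod_congr rfl fun i hi => by
          have := Finset.mem_range.1 hi
          exact hsame _ (by omega) _ (by omega) (by omega)
      have e2 : ∏ i ∈ Finset.range (n + 1),
          crd A (update T (x (n + 2)) (e (n + 2))) (x (i + 1)) (e i) =
          ∏ i ∈ Finset.range (n + 1), crd A T (x (i + 1)) (e i) :=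
        Finset.prod_congr rfl fun i hi => by
          have := Finset.mem_range.1 hi
          exact hsame _ (by omega) _ (by omega) (by omega)
      rw [e1, e2]
      have h3 := hp.corner
      have h4 := hp.sub (n + 1) (by omega)
      have h5 : ∏ i ∈ Finset.range (n + 1), crd A T (x (i + 1)) (e i) ≠ 0 :=
        Finset.prod_ne_zero_iff.2 fun i hi => by
          have := Finset.mem_range.1 hi
          exact hp.sub i (by omega)
      have h6 : pneg (1 : P) * pneg 1 = 1 := by rw [mul_pneg, mul_one, pneg_pneg]
      have h7 : pneg (1 : P) ≠ 0 := pneg_ne_zero one_ne_zero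
      rw [← pneg_one_mul (crd A T (x 0) (e (n + 2)) * _), pow_succ]
      field_simp
      rw [pow_two, h6]
      simp
    · intro i hi
      rw [hsame i hi i hi (by omega)]
      exact hp.diag i (by omega)
    · intro i hi
      rw [hsame (i + 1) (by omega) i (by omega) (by omega)]
      exact hp.sub i (by omega)
    · intro i hi j hj hij
      by_cases hc : i = 0 ∧ j = n + 1
      · exact Or.inr (Or.inr hc)
      · change crd A _ _ _ ≠ 0 at hij
        rw [hsame i hi j hj hc] at hij
        rcases hp.off i (by omega) j (by omega) hij with h | h | h <;> omega

theorem AllGood.cycleVal_mem (h : AllGood U A) {X' Y' : Type*} {D : Matrix X' Y' P}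
    (hD : IsCrdForm A D) {n : ℕ} {x : ℕ → X'} {y : ℕ → Y'}
    (hx : ∀ i ≤ n + 1, ∀ j ≤ n + 1, x i = x j → i = j)
    (hp : CyclePattern n (fun i j => D (x i) (y j) ≠ 0)) :
    cycleVal n (fun i j => D (x i) (y j)) ∈ U := by
  obtain ⟨T, f, s, h0, hf, hs⟩ := hD
  simp only [hs.ne_zero_iff] at hp
  obtain ⟨r, c, hr, hc, hs⟩ := hs
  simp only [hs]
  rw [cycleVal_scale n (fun i j => crd A T (f (x i)) (s (y j))) (fun i => hr (x i))
    (fun j => hc (y j))]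
  exact cycleVal_crd_mem h n T (f ∘ x) (s ∘ y) h0
    (fun i hi j hj hij => hx i hi j hj (hf hij)) hp

end Cycles

/-! ### Weights on a bipartite graph that are trivial on induced cycles -/

section Coboundary

variable {P : Type*} [CommGroupWithZero P] {X Y : Type*}

/-- Columns are added one at a time. The new column `y₀` only requires that `θ x y₀ / ρ x` agree for
neighbours `x` of `y₀` in one component of the graph on the earlier columns; a shortest chain
between two such neighbours closes through `y₀` to an induced cycle. -/
theorem exists_coboundary (S : X → Y → Prop) (θ : X → Y → P) (hθ : ∀ x y, θ x y ≠ 0)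
    (hc : ∀ (n : ℕ) (x : ℕ → X) (y : ℕ → Y),
      (∀ i ≤ n + 1, ∀ j ≤ n + 1, x i = x j → i = j) →
      CyclePattern n (fun i j => S (x i) (y j)) →
      ∏ i ∈ Finset.range (n + 2), θ (x i) (y i) =
        (∏ i ∈ Finset.range (n + 1), θ (x (i + 1)) (y i)) * θ (x 0) (y (n + 1)))
    (F : Finset Y) : ∃ (ρ : X → P) (γ : Y → P), (∀ x, ρ x ≠ 0) ∧ (∀ y, γ y ≠ 0) ∧
      ∀ x, ∀ y ∈ F, S x y → θ x y = ρ x * γ y := by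
  classical
  induction F using Finset.induction_on with
  | empty => exact ⟨fun _ => 1, fun _ => 1, fun _ => one_ne_zero, fun _ => one_ne_zero, by simp⟩
  | insert y₀ F hy₀ ih =>
    obtain ⟨ρ, γ, hρ, hγ, h⟩ := ih
    let r : X → X → Prop := fun a b => ∃ y ∈ F, S a y ∧ S b y
    have key : ∀ n : ℕ, ∀ f : ℕ → X, (∀ m < n, r (f m) (f (m + 1))) → S (f 0) y₀ → S (f n) y₀ →
        θ (f 0) y₀ / ρ (f 0) = θ (f n) y₀ / ρ (f n) := by
      intro n
      induction n using Nat.strong_induction_on with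
      | _ n ihn =>
      intro f hf h0 hn
      -- A chain that meets another neighbour of `y₀` is split there, and one with a shortcut is
      -- shortened; what remains gives an induced cycle.
      by_cases hmid : ∃ m, 0 < m ∧ m < n ∧ S (f m) y₀
      · obtain ⟨m, hm0, hmn, hm⟩ := hmid
        have e1 := ihn m hmn f (fun t ht => hf t (by omega)) h0 hm
        have e2 := ihn (n - m) (by omega) (fun t => f (m + t))
          (fun t ht => hf (m + t) (by omega)) hm (by simpa [show m + (n - m) = n by omega] using hn)
        rw [e1]
        simpa [show m + (n - m) = n by omega] using e2
      by_cases hch : ∃ m m', m + 2 ≤ m' ∧ m' ≤ n ∧ r (f m) (f m')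
      · obtain ⟨m, m', h1, h2, h3⟩ := hch
        obtain ⟨n', hn', g, g0, gn, hg⟩ := exists_shorter_chain hf h1 h2 h3
        have := ihn n' hn' g hg (by rwa [g0]) (by rwa [gn])
        rwa [g0, gn] at this
      rcases Nat.eq_zero_or_pos n with rfl | hpos
      · rfl
      obtain ⟨k, rfl⟩ : ∃ k, n = k + 1 := ⟨n - 1, by omega⟩
      have hsym : ∀ {a b}, r a b → r b a := fun ⟨y, hy, h1, h2⟩ => ⟨y, hy, h2, h1⟩
      have hclose : ∀ i ≤ k + 1, ∀ j ≤ k + 1, r (f i) (f j) → i ≤ j + 1 ∧ j ≤ i + 1 := by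
        intro i hi j hj hr
        by_contra hcon
        rcases lt_or_ge i j with hij | hij
        · exact hch ⟨i, j, by omega, hj, hr⟩
        · exact hch ⟨j, i, by omega, hi, hsym hr⟩
      have : Nonempty Y := ⟨y₀⟩
      choose! z hzF hz1 hz2 using fun m (hm : m < k + 1) => hf m hm
      let y : ℕ → Y := fun i => if i < k + 1 then z i else y₀
      have hy : ∀ i < k + 1, y i = z i := fun i hi => if_pos hi
      have hyk : y (k + 1) = y₀ := if_neg (lt_irrefl _)
      by_cases hends : f 0 = f (k + 1)
      · rw [hends]
      have hinj : ∀ i ≤ k + 1, ∀ j ≤ k + 1, f i = f j → i = j := by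
        have aux : ∀ i j, i < j → j ≤ k + 1 → f i ≠ f j := by
          intro i j hij hj hfe
          rcases Nat.lt_or_ge j (k + 1) with hj' | hj'
          · have h3 := hf j hj'
            rw [← hfe] at h3
            exact hch ⟨i, j + 1, by omega, by omega, h3⟩
          · obtain rfl : j = k + 1 := by omega
            rcases Nat.eq_zero_or_pos i with rfl | hi0
            · exact hends hfe
            · exact hmid ⟨i, hi0, hij, by rwa [hfe]⟩
        intro i hi j hj hfe
        rcases lt_trichotomy i j with h | h | h
        · exact absurd hfe (aux i j h hj)
        · exact h
        · exact absurd hfe.symm (aux j i h hi)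
      have hcyc := hc k f y hinj ⟨fun i hi => ?_, fun i hi => ?_, ?_, fun i hi j hj hij => ?_⟩
      · rw [Finset.prod_range_succ, hyk] at hcyc
        have e1 : ∏ i ∈ Finset.range (k + 1), θ (f i) (y i) =
            (∏ i ∈ Finset.range (k + 1), ρ (f i)) * ∏ i ∈ Finset.range (k + 1), γ (z i) := by
          rw [← Finset.prod_mul_distrib]
          refine Finset.prod_congr rfl fun i hi => ?_
          have hi := Finset.mem_range.1 hi
          rw [hy i hi, h _ _ (hzF i hi) (hz1 i hi)]
        have e2 : ∏ i ∈ Finset.range (k + 1), θ (f (i + 1)) (y i) =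
            (∏ i ∈ Finset.range (k + 1), ρ (f (i + 1))) * ∏ i ∈ Finset.range (k + 1), γ (z i) := by
          rw [← Finset.prod_mul_distrib]
          refine Finset.prod_congr rfl fun i hi => ?_
          have hi := Finset.mem_range.1 hi
          rw [hy i hi, h _ _ (hzF i hi) (hz2 i hi)]
        have e3 : (∏ i ∈ Finset.range (k + 1), ρ (f (i + 1))) * ρ (f 0) =
            (∏ i ∈ Finset.range (k + 1), ρ (f i)) * ρ (f (k + 1)) := by
          rw [← Finset.prod_range_succ (fun i => ρ (f i)),
            ← Finset.prod_range_succ' (fun i => ρ (f i))]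
        have n1 : (∏ i ∈ Finset.range (k + 1), ρ (f i)) ≠ 0 :=
          Finset.prod_ne_zero_iff.2 fun i _ => hρ _
        have n2 : (∏ i ∈ Finset.range (k + 1), γ (z i)) ≠ 0 :=
          Finset.prod_ne_zero_iff.2 fun i _ => hγ _
        rw [e1, e2] at hcyc
        rw [div_eq_div_iff (hρ _) (hρ _)]
        have n3 := mul_ne_zero n1 n2
        apply mul_left_cancel₀ n3
        calc _ = (∏ i ∈ Finset.range (k + 1), ρ (f i)) * ρ (f (k + 1)) *
              (∏ i ∈ Finset.range (k + 1), γ (z i)) * θ (f 0) y₀ := by ac_rfl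
          _ = _ := by
            rw [← e3]
            calc _ = ((∏ i ∈ Finset.range (k + 1), ρ (f (i + 1))) *
                  (∏ i ∈ Finset.range (k + 1), γ (z i)) * θ (f 0) y₀) * ρ (f 0) := by ac_rfl
              _ = _ := by rw [← hcyc]; ac_rfl
      · rcases Nat.lt_or_ge i (k + 1) with hi' | hi'
        · rw [hy i hi']; exact hz1 i hi'
        · obtain rfl : i = k + 1 := by omega
          rw [hyk]; exact hn
      · rw [hy i (by omega)]; exact hz2 i (by omega)
      · rw [hyk]; exact h0
      · rcases Nat.lt_or_ge j (k + 1) with hj' | hj'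
        · rw [hy j hj'] at hij
          have h1 := hclose i hi j hj ⟨_, hzF j hj', hij, hz1 j hj'⟩
          have h2 := hclose i hi (j + 1) (by omega) ⟨_, hzF j hj', hij, hz2 j hj'⟩
          omega
        · obtain rfl : j = k + 1 := by omega
          rw [hyk] at hij
          by_contra hcon
          exact hmid ⟨i, by omega, by omega, hij⟩
    have hsymm : Std.Symm r := ⟨fun a b ⟨y, hy, h1, h2⟩ => ⟨y, hy, h2, h1⟩⟩
    -- `δ` is the common value of `θ x' y₀ / ρ x'` over the neighbours `x'` of `y₀` in the component
    -- of `x`; the value `1` is used on components not adjacent to `y₀`.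
    let δ : X → P := fun x => if hx : ∃ x', Relation.ReflTransGen r x x' ∧ S x' y₀ then
      θ hx.choose y₀ / ρ hx.choose else 1
    have hδ0 : ∀ x, δ x ≠ 0 := by
      intro x
      by_cases hx : ∃ x', Relation.ReflTransGen r x x' ∧ S x' y₀
      · simp only [δ, dif_pos hx]; exact div_ne_zero (hθ _ _) (hρ _)
      · simp only [δ, dif_neg hx]; exact one_ne_zero
    have key' : ∀ a b, Relation.ReflTransGen r a b → S a y₀ → S b y₀ →
        θ a y₀ / ρ a = θ b y₀ / ρ b := by
      intro a b hab ha hb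
      obtain ⟨n, f, rfl, rfl, hf⟩ := exists_chain_of_reflTransGen hab
      exact key n f hf ha hb
    have hδ : ∀ x x', Relation.ReflTransGen r x x' → S x' y₀ → δ x = θ x' y₀ / ρ x' := by
      intro x x' hxx hS
      have hx : ∃ x', Relation.ReflTransGen r x x' ∧ S x' y₀ := ⟨x', hxx, hS⟩
      simp only [δ, dif_pos hx]
      exact key' _ _ ((Relation.ReflTransGen.stdSymm.symm _ _ hx.choose_spec.1).trans hxx)
        hx.choose_spec.2 hS
    have hδr : ∀ x x', r x x' → δ x = δ x' := by
      intro x x' hr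
      by_cases hx : ∃ x₁, Relation.ReflTransGen r x' x₁ ∧ S x₁ y₀
      · obtain ⟨x₁, h1, h2⟩ := hx
        rw [hδ x' x₁ h1 h2, hδ x x₁ (h1.head hr) h2]
      · have hx' : ¬ ∃ x₁, Relation.ReflTransGen r x x₁ ∧ S x₁ y₀ := fun ⟨x₁, h1, h2⟩ =>
          hx ⟨x₁, h1.head (hsymm.symm _ _ hr), h2⟩
        simp only [δ, dif_neg hx, dif_neg hx']
    -- For an earlier column, all rows meeting it lie in one component, so `δ` may be evaluated at
    -- any of them. Columns without edges receive the default `1`.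
    refine ⟨fun x => ρ x * δ x, fun y => if y = y₀ then 1 else
      if hy : ∃ x, S x y then γ y / δ hy.choose else 1, fun x => mul_ne_zero (hρ x) (hδ0 x), ?_, ?_⟩
    · intro y
      dsimp only
      split_ifs
      · exact one_ne_zero
      · exact div_ne_zero (hγ _) (hδ0 _)
      · exact one_ne_zero
    · intro x y hy hS
      have := hρ x
      rcases Finset.mem_insert.1 hy with rfl | hyF
      · simp only [if_true, mul_one]
        rw [hδ x x .refl hS, mul_div_cancel₀ _ this]
      · have hne : y ≠ y₀ := fun h => hy₀ (h ▸ hyF)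
        have hex : ∃ x, S x y := ⟨x, hS⟩
        simp only [if_neg hne, dif_pos hex]
        rw [← hδr x hex.choose ⟨y, hyF, hS, hex.choose_spec⟩, h x y hyF hS]
        have := hδ0 x
        field_simp

end Coboundary

end PartialField

namespace PartialField

open Function

/-! ### The set of lifted elements and uniqueness of good lifts -/

section Lifting

variable {Q P : Type*} [PartialField Q] [PartialField P]

theorem isFundamental_one : IsFundamental (1 : P) := ⟨0, padd_pneg 1⟩

theorem isFundamental_zero : IsFundamental (0 : P) := isFundamental_iff.2 ⟨1, by simp⟩

/-- The zero map satisfies `IsHom`; it is excluded here because `1` has a preimage. -/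
theorem IsLiftingFunction.map_one {φ : Q → P} (hφ : IsHom φ) {up : {p : P // IsFundamental p} → Q}
    (hup : IsLiftingFunction φ up) : φ 1 = 1 := by
  have h := hφ.1 1 (up ⟨1, isFundamental_one⟩)
  rw [one_mul, hup.1, mul_one] at h
  exact h.symm

/-- The elements of the form `up p`. -/
def lifted (φ : Q → P) (up : {p : P // IsFundamental p} → Q) : Set Q :=
  {q | ∃ h : IsFundamental (φ q), up ⟨φ q, h⟩ = q}

variable {φ : Q →*₀ P} {up : {p : P // IsFundamental p} → Q}

/-- Both elements are the lift of their common image. Uniqueness of good lifts rests on this. -/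
theorem eq_of_mem_lifted {p q : Q} (hp : p ∈ lifted φ up) (hq : q ∈ lifted φ up)
    (h : φ p = φ q) : p = q := by
  obtain ⟨_, hp⟩ := hp
  obtain ⟨_, hq⟩ := hq
  rw [← hp, ← hq]
  congr 1
  exact Subtype.ext h

theorem up_mem_lifted (hup : IsLiftingFunction φ up) (p : {p : P // IsFundamental p}) :
    up p ∈ lifted φ up := by
  have h := hup.1 p
  refine ⟨by rw [h]; exact p.2, ?_⟩
  congr 1
  exact Subtype.ext h

theorem IsHom.map_pneg (hφ : IsHom φ) (p : Q) : φ (pneg p) = pneg (φ p) := by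
  obtain ⟨Φ, hΦ⟩ := exists_ringHom φ hφ
  apply ι_injective
  rw [← hΦ, ι_pneg, ι_pneg, map_neg, hΦ]

theorem isCrossSet_lifted (hup : IsLiftingFunction φ up) : IsCrossSet (lifted φ up) := by
  have h0 : up ⟨0, isFundamental_zero⟩ = 0 := by
    have := hup.1 ⟨0, isFundamental_zero⟩
    exact (map_eq_zero φ).1 this
  refine ⟨?_, ?_, ?_⟩
  · have := hup.2.1 ⟨1, isFundamental_one⟩ ⟨0, isFundamental_zero⟩ (padd_zero 1)
    rw [h0, padd_zero] at this
    rw [← Option.some.inj this]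
    exact up_mem_lifted hup _
  · rintro q ⟨h, hq⟩ hq0
    have hp0 : φ q ≠ 0 := by simpa using hq0
    have hf : IsFundamental (φ q)⁻¹ := by
      obtain ⟨r, hr⟩ := isFundamental_iff.1 h
      refine isFundamental_iff.2 ⟨pneg ((φ q)⁻¹ * r), ?_⟩
      rw [ι_pneg, map_mul, ← hr, mul_sub, ← map_mul, inv_mul_cancel₀ hp0, map_one]
      ring
    have := hup.2.2 ⟨φ q, h⟩ ⟨_, hf⟩ (mul_inv_cancel₀ hp0)
    rw [hq] at this
    rw [← eq_inv_of_mul_eq_one_right this]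
    exact up_mem_lifted hup _
  · rintro q ⟨h, hq⟩
    obtain ⟨r, hr⟩ := isFundamental_iff.1 h
    have hf : IsFundamental r := isFundamental_iff.2 ⟨φ q, by rw [← hr]; ring⟩
    have := hup.2.1 ⟨φ q, h⟩ ⟨r, hf⟩ (padd_eq_some_iff.2 (by
      change ι (φ q) + ι r = ι 1
      rw [← hr, map_one]; ring))
    rw [hq, padd_eq_some_iff, map_one] at this
    exact ⟨_, up_mem_lifted hup _, by rw [← this]; ring⟩

theorem map_cycleVal (hφ : IsHom φ) (n : ℕ) (M : ℕ → ℕ → Q) :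
    φ (cycleVal n M) = cycleVal n fun i j => φ (M i j) := by
  simp only [cycleVal, map_mul, map_div₀, map_prod, map_pow, hφ.map_pneg, map_one]

/-- Corresponding induced cycles of `A` and `B` have lifted signatures with the same image, hence
equal signatures. So the entrywise quotient of `B` by `A` is trivial on induced cycles and splits
into row and column factors. -/
theorem scalingEquiv_of_map (hφ : IsHom φ) {X Y : Type*} [Fintype X] [DecidableEq X] [Finite Y]
    {A B : Matrix X Y Q} (hA : AllGood (lifted φ up) A) (hB : AllGood (lifted φ up) B)
    (h : ScalingEquiv (A.map φ) (B.map φ)) : ScalingEquiv A B := by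
  classical
  have := Fintype.ofFinite Y
  have hz : ∀ x y, B x y ≠ 0 ↔ A x y ≠ 0 := fun x y => by
    have := h.ne_zero_iff (x := x) (y := y)
    simpa using this
  have key := exists_coboundary (fun x y => A x y ≠ 0)
    (fun x y => if A x y = 0 then 1 else B x y / A x y) (fun x y => ?_) ?_ Finset.univ
  · obtain ⟨ρ, γ, hρ, hγ, hc⟩ := key
    refine ⟨ρ, γ, hρ, hγ, fun x y => ?_⟩
    by_cases hxy : A x y = 0
    · have := not_not.1 ((not_congr (hz x y)).2 (not_not.2 hxy))
      rw [this, hxy, mul_zero, zero_mul]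
    · have := hc x y (Finset.mem_univ y) hxy
      rw [if_neg hxy, div_eq_iff hxy] at this
      rw [this]; ac_rfl
  · by_cases hxy : A x y = 0
    · rw [if_pos hxy]; exact one_ne_zero
    · rw [if_neg hxy]; exact div_ne_zero ((hz x y).2 hxy) hxy
  · intro n x y hx hp
    have hA' := hA.cycleVal_mem (isCrdForm_self A) hx hp
    have hB' := hB.cycleVal_mem (isCrdForm_self B) hx (by simpa only [hz] using hp)
    have heq : cycleVal n (fun i j => A (x i) (y j)) = cycleVal n (fun i j => B (x i) (y j)) := by
      refine eq_of_mem_lifted hA' hB' ?_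
      rw [map_cycleVal hφ, map_cycleVal hφ]
      obtain ⟨r, c, hr, hc, h⟩ := h
      simp only [Matrix.map_apply] at h
      simp only [h]
      exact (cycleVal_scale n (fun i j => φ (A (x i) (y j))) (fun i => hr (x i))
        (fun j => hc (y j))).symm
    have e1 : ∀ i ∈ Finset.range (n + 2), A (x i) (y i) ≠ 0 := fun i hi =>
      hp.diag i (by have := Finset.mem_range.1 hi; omega)
    have e2 : ∀ i ∈ Finset.range (n + 1), A (x (i + 1)) (y i) ≠ 0 := fun i hi =>
      hp.sub i (by have := Finset.mem_range.1 hi; omega)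
    have e3 := hp.corner
    have e1' := fun i hi => (hz _ _).2 (e1 i hi)
    have e2' := fun i hi => (hz _ _).2 (e2 i hi)
    have e3' := (hz _ _).2 e3
    rw [Finset.prod_congr rfl fun i hi => if_neg (e1 i hi),
      Finset.prod_congr rfl fun i hi => if_neg (e2 i hi), if_neg e3, Finset.prod_div_distrib,
      Finset.prod_div_distrib]
    have n0 : pneg (1 : Q) ^ n ≠ 0 := pow_ne_zero _ (pneg_ne_zero one_ne_zero)
    have n1 := Finset.prod_ne_zero_iff.2 e1
    have n2 := Finset.prod_ne_zero_iff.2 e2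
    have n2' := Finset.prod_ne_zero_iff.2 e2'
    have heq' := mul_left_cancel₀ n0 heq
    rw [div_eq_div_iff (mul_ne_zero n2 e3) (mul_ne_zero n2' e3')] at heq'
    rw [div_mul_div_comm, div_eq_div_iff n1 (mul_ne_zero n2 e3)]
    exact heq'.symm.trans (mul_comm _ _)

end Lifting

/-! ### From minors to the line, coline and Fano laws -/

section Laws

variable {Q P : Type*} [PartialField Q] [PartialField P] {φ : Q →*₀ P} {U : Set Q}

theorem chi_map (hφ : IsHom φ) {X Y : Type*} [Fintype X] [DecidableEq X] {A : Matrix X Y Q}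
    {T : X → X ⊕ Y} (hT : Nice A T) : chi (A.map φ) T = φ (chi A T) := by
  obtain ⟨Φ, hΦ⟩ := exists_ringHom φ hφ
  apply chi_eq
  rw [← hΦ, hT.ι_chi, brk, brk, RingHom.map_det]
  congr 1
  ext x k
  simp only [Matrix.submatrix_apply, RingHom.mapMatrix_apply, Matrix.map_apply, extMatrix]
  rcases T k with x' | y
  · simp only [Matrix.fromCols_apply_inl, Matrix.one_apply, id]
    split_ifs <;> simp
  · simp [hΦ]

theorem crd_map (hφ : IsHom φ) {X Y : Type*} [Fintype X] [DecidableEq X] {A : Matrix X Y Q}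
    {T : X → X ⊕ Y} (hT : NiceAt A T) (k : X) (e : X ⊕ Y) :
    crd (A.map φ) T k e = φ (crd A T k e) := by
  rw [crd, crd, chi_map hφ (hT k e), chi_map hφ (hT.nice k), map_div₀]

/-- The condition on lifts that the absence of bad minors provides. -/
structure MinorLaws (φ : Q → P) (U : Set Q) {X Y : Type} (A : Matrix X Y P) : Prop where
  line : ∀ p q : Q, p ∈ U → q ∈ U → p ≠ 0 → q ≠ 0 → IsMinor A (lineMatrix (φ p) (φ q)) → q / p ∈ U
  coline : ∀ p q : Q, p ∈ U → q ∈ U → p ≠ 0 → q ≠ 0 →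
    IsMinor A (lineMatrix (φ p) (φ q)).transpose → q / p ∈ U
  fano : IsMinor A (fanoMatrix P) → pneg 1 ∈ U
  cofano : IsMinor A (fanoMatrix P).transpose → pneg 1 ∈ U

theorem MinorLaws.minor {X Y : Type} {A : Matrix X Y P} (h : MinorLaws φ U A) {X' Y' : Type}
    {B : Matrix X' Y' P} (hB : IsMinor A B) : MinorLaws φ U B :=
  ⟨fun p q hp hq h1 h2 hm => h.line p q hp hq h1 h2 (hB.trans hm),
    fun p q hp hq h1 h2 hm => h.coline p q hp hq h1 h2 (hB.trans hm),
    fun hm => h.fano (hB.trans hm), fun hm => h.cofano (hB.trans hm)⟩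

theorem MinorLaws.transpose {X Y : Type} {A : Matrix X Y P} (h : MinorLaws φ U A) :
    MinorLaws φ U A.transpose :=
  ⟨fun p q hp hq h1 h2 hm => h.coline p q hp hq h1 h2 hm.transpose,
    fun p q hp hq h1 h2 hm => h.line p q hp hq h1 h2 hm.transpose,
    fun hm => h.cofano hm.transpose, fun hm => h.fano hm.transpose⟩

variable {X Y : Type} [Fintype X] [DecidableEq X] {A : Matrix X Y Q}

theorem basis_ne_of_crd {P : Type*} [PartialField P] {A : Matrix X Y P} {T : X → X ⊕ Y} {i j : X}
    (hij : i ≠ j) {e : X ⊕ Y} (h1 : crd A T i e ≠ 0) (h2 : crd A T j e ≠ 0) (k : X) : T k ≠ e := by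
  rintro rfl
  rcases eq_or_ne k i with rfl | hki
  · exact h2 (crd_of_ne _ _ hij)
  · exact h1 (crd_of_ne _ _ hki)

/-- Scaling the full 2 × 3 submatrix to a first row and first column of ones leaves the cross ratios
`p` of `e, f` and `q` of `e, g`; the cross ratio of `f, g` is `q / p`. -/
theorem lineLaw_of_minorLaws (hφ : IsHom φ) (hU : IsCrossSet U) (hA : IsPMatrix (A.map φ))
    (h : MinorLaws φ U (A.map φ)) : LineLaw U A := by
  intro T hT h0 i j e f g hij ie if' ig je jf jg h1 h2
  by_cases hef : e = f
  · subst hef; exact h2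
  by_cases heg : e = g
  · subst heg; rw [← cr_inv_cols]; exact hU.inv_mem _ h1 (cr_ne_zero ie if' je jf)
  by_cases hfg : f = g
  · subst hfg; rw [cr, div_self (mul_ne_zero if' jf)]; exact hU.one_mem
  have h0' : chi (A.map φ) T ≠ 0 := by rw [chi_map hφ (hT.nice i)]; simpa using h0
  have hm := isMinor_crd (X' := Fin 2) (Y' := Fin 3) hA.nice h0' (f := ![i, j]) (s := ![e, f, g])
    ?_ ?_ ?_
  · have hl := h.line _ _ h1 h2 (cr_ne_zero ie if' je jf) (cr_ne_zero ie ig je jg) (hm.scale ?_)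
    · convert hl using 1
      simp only [cr]
      field_simp
    · refine ⟨![1, φ (crd A T i e / crd A T j e)], ![(φ (crd A T i e))⁻¹, (φ (crd A T i f))⁻¹,
        (φ (crd A T i g))⁻¹], ?_, ?_, ?_⟩
      · intro u; fin_cases u <;> simp [ie, je]
      · intro v; fin_cases v <;> simp [ie, if', ig]
      · intro u v
        have ie' : φ (crd A T i e) ≠ 0 := by simpa using ie
        have if'' : φ (crd A T i f) ≠ 0 := by simpa using if'
        have ig' : φ (crd A T i g) ≠ 0 := by simpa using ig
        have je' : φ (crd A T j e) ≠ 0 := by simpa using je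
        fin_cases u <;> fin_cases v <;> simp [lineMatrix, crd_map hφ hT, cr] <;> field_simp
  · intro u v; fin_cases u <;> fin_cases v <;> simp [hij, hij.symm]
  · intro u v
    fin_cases u <;> fin_cases v <;> simp [hef, heg, hfg, Ne.symm hef, Ne.symm heg, Ne.symm hfg]
  · intro v
    fin_cases v
    · exact basis_ne_of_crd hij ie je
    · exact basis_ne_of_crd hij if' jf
    · exact basis_ne_of_crd hij ig jg

theorem colineLaw_of_minorLaws (hφ : IsHom φ) (hU : IsCrossSet U) (hA : IsPMatrix (A.map φ))
    (h : MinorLaws φ U (A.map φ)) : ColineLaw U A := by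
  intro T hT h0 i j k e f hij hik hjk ie je ke if' jf kf h1 h2
  by_cases hef : e = f
  · subst hef; rw [cr, div_self (mul_ne_zero je ke)]; exact hU.one_mem
  have h0' : chi (A.map φ) T ≠ 0 := by rw [chi_map hφ (hT.nice i)]; simpa using h0
  have hm := isMinor_crd (X' := Fin 3) (Y' := Fin 2) hA.nice h0' (f := ![i, j, k]) (s := ![e, f])
    ?_ ?_ ?_
  · have hl := h.coline _ _ h1 h2 (cr_ne_zero ie if' je jf) (cr_ne_zero ie if' ke kf) (hm.scale ?_)
    · convert hl using 1
      simp only [cr]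
      field_simp
    · refine ⟨![(φ (crd A T i e))⁻¹, (φ (crd A T j e))⁻¹, (φ (crd A T k e))⁻¹],
        ![1, φ (crd A T i e / crd A T i f)], ?_, ?_, ?_⟩
      · intro u; fin_cases u <;> simp [ie, je, ke]
      · intro v; fin_cases v <;> simp [ie, if']
      · intro u v
        have ie' : φ (crd A T i e) ≠ 0 := by simpa using ie
        have if'' : φ (crd A T i f) ≠ 0 := by simpa using if'
        have je' : φ (crd A T j e) ≠ 0 := by simpa using je
        have ke' : φ (crd A T k e) ≠ 0 := by simpa using ke
        fin_cases u <;> fin_cases v <;> simp [lineMatrix, crd_map hφ hT, cr] <;> field_simp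
  · intro u v
    fin_cases u <;> fin_cases v <;> simp [hij, hij.symm, hik, hik.symm, hjk, hjk.symm]
  · intro u v
    fin_cases u <;> fin_cases v <;> simp [hef, Ne.symm hef]
  · intro v
    fin_cases v
    · exact basis_ne_of_crd hij ie je
    · exact basis_ne_of_crd hij if' jf

/-- The three equations between ratios say that scaling column `y` to ones also makes each of `w`,
`b`, `a` constant off its zero. With the rows in the order `j, k, i` this is the Fano matrix. -/
theorem fanoLaw_of_minorLaws (hφ : IsHom φ) (hA : IsPMatrix (A.map φ))
    (h : MinorLaws φ U (A.map φ)) : FanoLaw U A := by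
  intro T hT h0 i j k w b a y hij hik hjk jw kb ia iy jy ky iw ib ja hw hb ha
  have h0' : chi (A.map φ) T ≠ 0 := by rw [chi_map hφ (hT.nice i)]; simpa using h0
  have kw : crd A T k w ≠ 0 := fun hz => by
    rw [hz, zero_div] at hw; exact div_ne_zero iw iy hw
  have jb : crd A T j b ≠ 0 := fun hz => by
    rw [hz, zero_div] at hb; exact div_ne_zero ib iy hb
  have ka : crd A T k a ≠ 0 := fun hz => by
    rw [hz, zero_div] at ha; exact div_ne_zero ja jy ha
  have hm := isMinor_crd (X' := Fin 3) (Y' := Fin 4) hA.nice h0' (f := ![j, k, i])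
    (s := ![w, b, a, y]) ?_ ?_ ?_
  · refine h.fano (hm.scale ?_)
    have iy' : φ (crd A T i y) ≠ 0 := by simpa using iy
    have jy' : φ (crd A T j y) ≠ 0 := by simpa using jy
    have ky' : φ (crd A T k y) ≠ 0 := by simpa using ky
    have iw' : φ (crd A T i w) ≠ 0 := by simpa using iw
    have ib' : φ (crd A T i b) ≠ 0 := by simpa using ib
    have ja' : φ (crd A T j a) ≠ 0 := by simpa using ja
    have kw' : φ (crd A T k w) ≠ 0 := by simpa using kw
    have jb' : φ (crd A T j b) ≠ 0 := by simpa using jb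
    have ka' : φ (crd A T k a) ≠ 0 := by simpa using ka
    have hw' := congrArg φ hw
    have hb' := congrArg φ hb
    have ha' := congrArg φ ha
    simp only [map_div₀] at hw' hb' ha'
    refine ⟨![(φ (crd A T j y))⁻¹, (φ (crd A T k y))⁻¹, (φ (crd A T i y))⁻¹],
      ![(φ (crd A T i w) / φ (crd A T i y))⁻¹, (φ (crd A T i b) / φ (crd A T i y))⁻¹,
        (φ (crd A T j a) / φ (crd A T j y))⁻¹, 1], ?_, ?_, ?_⟩
    · intro u; fin_cases u <;> simp [iy, jy, ky]
    · intro v; fin_cases v <;> simp [iy, jy, iw, ib, ja]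
    · rw [hw', hb', ha']
      have e1 : φ (crd A T i w) = φ (crd A T k w) / φ (crd A T k y) * φ (crd A T i y) := by
        rw [← hw', div_mul_cancel₀ _ iy']
      have e2 : φ (crd A T i b) = φ (crd A T j b) / φ (crd A T j y) * φ (crd A T i y) := by
        rw [← hb', div_mul_cancel₀ _ iy']
      have e3 : φ (crd A T j a) = φ (crd A T k a) / φ (crd A T k y) * φ (crd A T j y) := by
        rw [← ha', div_mul_cancel₀ _ jy']
      intro u v
      fin_cases u <;> fin_cases v <;>
        simp [fanoMatrix, crd_map hφ hT, jw, kb, ia, e1, e2, e3] <;> field_simp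
  · intro u v
    fin_cases u <;> fin_cases v <;> simp [hij, hij.symm, hik, hik.symm, hjk, hjk.symm]
  · have n1 : w ≠ b := by rintro rfl; exact jb jw
    have n2 : w ≠ a := by rintro rfl; exact ja jw
    have n3 : w ≠ y := by rintro rfl; exact jy jw
    have n4 : b ≠ a := by rintro rfl; exact ka kb
    have n5 : b ≠ y := by rintro rfl; exact ky kb
    have n6 : a ≠ y := by rintro rfl; exact iy ia
    intro u v
    fin_cases u <;> fin_cases v <;>
      simp [n1, n2, n3, n4, n5, n6, n1.symm, n2.symm, n3.symm, n4.symm, n5.symm, n6.symm]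
  · intro v
    fin_cases v
    · exact basis_ne_of_crd hik iw kw
    · exact basis_ne_of_crd hij ib jb
    · exact basis_ne_of_crd hjk ja ka
    · exact basis_ne_of_crd hij iy jy

end Laws

end PartialField

namespace PartialField

open Function

/-! ### Induced cycles as walks and as cyclic patterns -/

section Walks

variable {P : Type*} [PartialField P] {X Y : Type*}

theorem prod_darts {V : Type*} {G : SimpleGraph V} {M : Type*} [CommMonoid M] (f : V → V → M)
    {u v : V} (C : G.Walk u v) : (C.darts.map fun d => f d.fst d.snd).prod =
      ∏ i ∈ Finset.range C.length, f (C.getVert i) (C.getVert (i + 1)) := by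
  induction C with
  | nil => simp
  | cons h p ih =>
    rw [SimpleGraph.Walk.darts_cons, List.map_cons, List.prod_cons, SimpleGraph.Walk.length_cons,
      Finset.prod_range_succ', ih, mul_comm]
    simp

theorem prod_range_two_mul {M : Type*} [CommMonoid M] (g : ℕ → M) (m : ℕ) :
    ∏ i ∈ Finset.range (2 * m), g i =
      (∏ i ∈ Finset.range m, g (2 * i)) * ∏ i ∈ Finset.range m, g (2 * i + 1) := by
  induction m with
  | zero => simp
  | succ m ih =>
    rw [show 2 * (m + 1) = 2 * m + 1 + 1 by ring, Finset.prod_range_succ, Finset.prod_range_succ,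
      ih, Finset.prod_range_succ, Finset.prod_range_succ]
    ac_rfl

variable {A : Matrix X Y P}

theorem isLeft_of_adj {v w : X ⊕ Y} (h : (bipGraph A).Adj v w) : w.isLeft = !v.isLeft := by
  rcases v with x | y <;> rcases w with x' | y' <;> first | rfl | exact h.elim

/-- The walk alternates between rows at even and columns at odd positions, and chordlessness leaves
only the entries of the cyclic pattern. The signature formula is stated for any matrix, since it is
needed for `A` and for its lift along the same walk. -/
theorem exists_pattern_of_row {x₀ : X} (C : (bipGraph A).Walk (Sum.inl x₀) (Sum.inl x₀))
    (hC : IsInducedCycle C) : ∃ (n : ℕ) (x : ℕ → X) (y : ℕ → Y),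
      (∀ i ≤ n + 1, ∀ j ≤ n + 1, x i = x j → i = j) ∧
      CyclePattern n (fun i j => A (x i) (y j) ≠ 0) ∧
      ∀ {Q : Type*} [PartialField Q] (B : Matrix X Y Q),
        cycleSig B C = cycleVal n fun i j => B (x i) (y j) := by
  obtain ⟨hc, hch⟩ := hC
  have hpar : ∀ i ≤ C.length, (C.getVert i).isLeft = decide (i % 2 = 0) := by
    intro i
    induction i with
    | zero => simp
    | succ i ih =>
      intro hi
      rw [isLeft_of_adj (C.adj_getVert_succ (by omega)), ih (by omega)]
      rcases Nat.mod_two_eq_zero_or_one i with h | h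
      · have h' : (i + 1) % 2 = 1 := by omega
        simp [h, h']
      · have h' : (i + 1) % 2 = 0 := by omega
        simp [h, h']
  have hL : C.length % 2 = 0 := by
    have := hpar C.length le_rfl
    rw [C.getVert_length] at this
    simpa using this
  have h3 := hc.three_le_length
  obtain ⟨n, hn⟩ : ∃ n, C.length = 2 * (n + 2) := ⟨C.length / 2 - 2, by omega⟩
  have hx : ∀ i, ∃ x, i ≤ n + 2 → C.getVert (2 * i) = Sum.inl x := by
    intro i
    by_cases hi : i ≤ n + 2
    · have := hpar (2 * i) (by omega)
      obtain ⟨x, hx⟩ := Sum.isLeft_iff.1 (by rw [this]; simp)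
      exact ⟨x, fun _ => hx⟩
    · exact ⟨x₀, fun h => absurd h hi⟩
  have hy : ∀ i, ∃ y, i ≤ n + 1 → C.getVert (2 * i + 1) = Sum.inr y := by
    have hy' : ∀ i ≤ n + 1, ∃ y, C.getVert (2 * i + 1) = Sum.inr y := by
      intro i hi
      have := hpar (2 * i + 1) (by omega)
      exact Sum.isRight_iff.1 (by rw [← Sum.not_isLeft, this]; simp [Nat.add_mod])
    obtain ⟨y₀, _⟩ := hy' 0 (by omega)
    intro i
    by_cases hi : i ≤ n + 1
    · obtain ⟨y, hy⟩ := hy' i hi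
      exact ⟨y, fun _ => hy⟩
    · exact ⟨y₀, fun h => absurd h hi⟩
  choose x hx using hx
  choose y hy using hy
  have hlast : x (n + 2) = x 0 := by
    have h1 := hx (n + 2) le_rfl
    have h2 := hx 0 (by omega)
    rw [← hn, C.getVert_length] at h1
    rw [Nat.mul_zero, C.getVert_zero] at h2
    exact Sum.inl_injective (h1.symm.trans h2)
  have hinj := hc.getVert_injOn'
  have hadj1 : ∀ i ≤ n + 1, A (x i) (y i) ≠ 0 := by
    intro i hi
    have := C.adj_getVert_succ (i := 2 * i) (by omega)
    rw [hx i (by omega), hy i hi] at this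
    exact this
  have hadj2 : ∀ i ≤ n + 1, A (x (i + 1)) (y i) ≠ 0 := by
    intro i hi
    have := C.adj_getVert_succ (i := 2 * i + 1) (by omega)
    rw [hy i hi, show 2 * i + 1 + 1 = 2 * (i + 1) by ring, hx (i + 1) (by omega)] at this
    exact this
  refine ⟨n, x, y, fun i hi j hj hij => ?_, ⟨hadj1, fun i hi => hadj2 i (by omega), ?_,
    fun i hi j hj hij => ?_⟩, ?_⟩
  · have h1 := hx i (by omega)
    have h2 := hx j (by omega)
    rw [hij, ← h2] at h1
    have := hinj (by simp only [Set.mem_ofPred_eq]; omega)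
      (by simp only [Set.mem_ofPred_eq]; omega) h1
    omega
  · rw [← hlast]; exact hadj2 (n + 1) le_rfl
  · have h1 := hch (Sum.inl (x i)) (by rw [← hx i (by omega)]; exact C.getVert_mem_support _)
      (Sum.inr (y j)) (by rw [← hy j hj]; exact C.getVert_mem_support _) hij
    rw [← SimpleGraph.Walk.adj_toSubgraph_iff_mem_edges,
      SimpleGraph.Walk.toSubgraph_adj_iff] at h1
    obtain ⟨k, hk, hkL⟩ := h1
    rw [← hx i (by omega), ← hy j hj, Sym2.eq_iff] at hk
    rcases hk with ⟨ha, hb⟩ | ⟨ha, hb⟩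
    · have e1 := hinj (by simp only [Set.mem_ofPred_eq]; omega)
        (by simp only [Set.mem_ofPred_eq]; omega) ha
      subst e1
      have e2 := hinj (by simp only [Set.mem_ofPred_eq]; omega)
        (by simp only [Set.mem_ofPred_eq]; omega) hb
      omega
    · have e1 := hinj (by simp only [Set.mem_ofPred_eq]; omega)
        (by simp only [Set.mem_ofPred_eq]; omega) ha
      subst e1
      by_cases hlt : j = n + 1
      · subst hlt
        rw [show 2 * (n + 1) + 1 + 1 = C.length by omega, C.getVert_length] at hb
        have hb' : C.getVert 0 = C.getVert (2 * i) := C.getVert_zero.trans hb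
        have e2 := hinj (by simp only [Set.mem_ofPred_eq]; omega)
          (by simp only [Set.mem_ofPred_eq]; omega) hb'
        omega
      · have e2 := hinj (by simp only [Set.mem_ofPred_eq]; omega)
          (by simp only [Set.mem_ofPred_eq]; omega) hb
        omega
  · intro Q _ B
    rw [cycleSig, cycleVal, prod_darts, hn, prod_range_two_mul, Nat.mul_div_cancel_left _ two_pos]
    have h6 : pneg (1 : Q) * pneg 1 = 1 := by rw [mul_pneg, mul_one, pneg_pneg]
    -- Half the length is `n + 2`, and two of the factors `-1` cancel.
    rw [pow_add, pow_two, h6, mul_one, div_eq_mul_inv]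
    congr 2
    · refine Finset.prod_congr rfl fun i hi => ?_
      have := Finset.mem_range.1 hi
      rw [hx i (by omega), hy i (by omega)]; rfl
    · rw [Finset.prod_range_succ, mul_inv, ← Finset.prod_inv_distrib]
      have hs : ∀ i ≤ n + 1, sig B (C.getVert (2 * i + 1)) (C.getVert (2 * i + 1 + 1)) =
          (B (x (i + 1)) (y i))⁻¹ := by
        intro i hi
        rw [hy i hi, show 2 * i + 1 + 1 = 2 * (i + 1) by ring, hx (i + 1) (by omega)]; rfl
      rw [hs _ le_rfl, hlast]
      congr 1
      exact Finset.prod_congr rfl fun i hi => hs i (by have := Finset.mem_range.1 hi; omega)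

theorem exists_pattern {v : X ⊕ Y} (C : (bipGraph A).Walk v v) (hC : IsInducedCycle C) :
    ∃ (n : ℕ) (x : ℕ → X) (y : ℕ → Y),
      (∀ i ≤ n + 1, ∀ j ≤ n + 1, x i = x j → i = j) ∧
      CyclePattern n (fun i j => A (x i) (y j) ≠ 0) ∧
      ∀ {Q : Type*} [PartialField Q] (B : Matrix X Y Q),
        cycleSig B C = cycleVal n fun i j => B (x i) (y j) := by
  classical
  rcases v with x₀ | y₀
  · exact exists_pattern_of_row C hC
  · have h3 := hC.1.three_le_length
    have hadj := C.adj_getVert_succ (i := 0) (by omega)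
    rw [C.getVert_zero] at hadj
    obtain ⟨x₀, hx₀⟩ : ∃ x₀, C.getVert 1 = Sum.inl x₀ :=
      Sum.isLeft_iff.1 (by rw [isLeft_of_adj hadj]; rfl)
    have hmem : Sum.inl x₀ ∈ C.support := by rw [← hx₀]; exact C.getVert_mem_support _
    obtain ⟨n, x, y, h1, h2, h3⟩ := exists_pattern_of_row (C.rotate _ hmem)
      ⟨(SimpleGraph.Walk.isCycle_rotate hmem).2 hC.1, fun a ha b hb hab => by
        rw [SimpleGraph.Walk.mem_support_rotate_iff] at ha hb
        exact (C.rotate_edges _ hmem).mem_iff.2 (hC.2 a ha b hb hab)⟩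
    refine ⟨n, x, y, h1, h2, fun {Q} _ B => ?_⟩
    rw [← h3 B, cycleSig, cycleSig, SimpleGraph.Walk.length_rotate,
      ((C.rotate_darts _ hmem).perm.map _).prod_eq]

end Walks

end PartialField

namespace PartialField

open Function

/-! ### Local lifts -/

section LocalLifts

variable {Q P : Type*} [PartialField Q] [PartialField P] {φ : Q →*₀ P}
  {up : {p : P // IsFundamental p} → Q} {X Y : Type*}

theorem IsLocalLift.cycleSig_mem (hup : IsLiftingFunction φ up) {A : Matrix X Y P}
    {B : Matrix X Y Q} (h : IsLocalLift φ up A B) {v : X ⊕ Y} (C : (bipGraph A).Walk v v)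
    (hC : IsInducedCycle C) : cycleSig B C ∈ lifted φ up ∧ φ (cycleSig B C) = cycleSig A C := by
  obtain ⟨hf, he⟩ := h.2.2 v C hC
  rw [← he]
  exact ⟨up_mem_lifted hup _, hup.1 _⟩

theorem isInducedCycle_four {A : Matrix X Y P} {i j : X} {e f : Y} (hij : i ≠ j) (hef : e ≠ f)
    (h1 : (bipGraph A).Adj (Sum.inl i) (Sum.inr e)) (h2 : (bipGraph A).Adj (Sum.inr e) (Sum.inl j))
    (h3 : (bipGraph A).Adj (Sum.inl j) (Sum.inr f))
    (h4 : (bipGraph A).Adj (Sum.inr f) (Sum.inl i)) :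
    IsInducedCycle (.cons h1 (.cons h2 (.cons h3 (.cons h4 .nil)))) := by
  refine ⟨?_, ?_⟩
  · simp [SimpleGraph.Walk.cons_isCycle_iff, hij.symm, hef, hij]
  · intro a ha b hb hab
    have key : ∀ x y, A x y ≠ 0 → (x = i ∨ x = j) → (y = e ∨ y = f) →
        s((Sum.inl x : X ⊕ Y), Sum.inr y) ∈
        (SimpleGraph.Walk.cons h1 (.cons h2 (.cons h3 (.cons h4 .nil)))).edges := by
      rintro x y - (rfl | rfl) (rfl | rfl) <;> simp [Sym2.eq_swap]
    rcases a with x | y <;> rcases b with x' | y'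
    · exact hab.elim
    · exact key x y' hab (by simpa [or_assoc, or_comm] using ha) (by simpa using hb)
    · rw [Sym2.eq_swap]
      exact key x' y hab (by simpa [or_assoc, or_comm] using hb) (by simpa using ha)
    · exact hab.elim

theorem IsLocalLift.cross_mem (hup : IsLiftingFunction φ up) {A : Matrix X Y P}
    {B : Matrix X Y Q} (h : IsLocalLift φ up A B) {i j : X} {e f : Y} (hij : i ≠ j) (hef : e ≠ f)
    (h1 : A i e ≠ 0) (h2 : A j e ≠ 0) (h3 : A j f ≠ 0) (h4 : A i f ≠ 0) :
    B i e * B j f / (B i f * B j e) ∈ lifted φ up ∧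
      φ (B i e * B j f / (B i f * B j e)) = A i e * A j f / (A i f * A j e) := by
  have h1' : (bipGraph A).Adj (Sum.inl i) (Sum.inr e) := h1
  have h2' : (bipGraph A).Adj (Sum.inr e) (Sum.inl j) := h2
  have h3' : (bipGraph A).Adj (Sum.inl j) (Sum.inr f) := h3
  have h4' : (bipGraph A).Adj (Sum.inr f) (Sum.inl i) := h4
  have hm := h.cycleSig_mem hup _ (isInducedCycle_four hij hef h1' h2' h3' h4')
  have key : ∀ {R : Type _} [PartialField R] (M : Matrix X Y R),
      cycleSig M (.cons h1' (.cons h2' (.cons h3' (.cons h4' .nil)))) =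
      M i e * M j f / (M i f * M j e) := by
    intro R _ M
    have h6 : pneg (1 : R) * pneg 1 = 1 := by rw [mul_pneg, mul_one, pneg_pneg]
    simp only [cycleSig, SimpleGraph.Walk.length_cons, SimpleGraph.Walk.length_nil,
      SimpleGraph.Walk.darts_cons, SimpleGraph.Walk.darts_nil, List.map_cons, List.map_nil,
      List.prod_cons, List.prod_nil, sig]
    norm_num [pow_two, h6]
    rw [div_eq_mul_inv, mul_inv]
    ac_rfl
  rw [key B] at hm
  refine ⟨hm.1, ?_⟩
  have := h.1.cross i j e f
  rw [this]
  simp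

/-- The off-diagonal entries form an induced hexagon. Its signature in the lift is `(-1)³` times the
quotient of the two sides of `hB`, that is `-1`. -/
theorem IsLocalLift.neg_one_mem (hup : IsLiftingFunction φ up) {A : Matrix X Y P}
    {B : Matrix X Y Q} (h : IsLocalLift φ up A B) {x : Fin 3 → X} {y : Fin 3 → Y}
    (hx : Injective x) (hy : Injective y) (hA : ∀ i j, A (x i) (y j) = if i = j then 0 else 1)
    (hB : B (x 0) (y 1) * B (x 2) (y 0) * B (x 1) (y 2) =
      B (x 2) (y 1) * B (x 1) (y 0) * B (x 0) (y 2)) : pneg 1 ∈ lifted φ up := by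
  have adj : ∀ i j, i ≠ j → (bipGraph A).Adj (Sum.inl (x i)) (Sum.inr (y j)) := by
    intro i j hij
    change A (x i) (y j) ≠ 0
    rw [hA, if_neg hij]; exact one_ne_zero
  have h1 := adj 0 1 (by decide)
  have h2 := (adj 2 1 (by decide)).symm
  have h3 := adj 2 0 (by decide)
  have h4 := (adj 1 0 (by decide)).symm
  have h5 := adj 1 2 (by decide)
  have h6 := (adj 0 2 (by decide)).symm
  let C := SimpleGraph.Walk.cons h1 (.cons h2 (.cons h3 (.cons h4 (.cons h5 (.cons h6 .nil)))))
  have hC : IsInducedCycle C := by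
    refine ⟨?_, ?_⟩
    · simp [C, SimpleGraph.Walk.cons_isCycle_iff, hx.eq_iff, hy.eq_iff]
    · intro a ha b hb hab
      have key : ∀ u v, A u v ≠ 0 → (∃ i, u = x i) → (∃ j, v = y j) →
          s((Sum.inl u : X ⊕ Y), Sum.inr v) ∈ C.edges := by
        rintro _ _ huv ⟨i, rfl⟩ ⟨j, rfl⟩
        have hij : i ≠ j := by rintro rfl; exact huv (by rw [hA, if_pos rfl])
        fin_cases i <;> fin_cases j <;> simp [C, hx.eq_iff, hy.eq_iff] at hij ⊢
      have hr : ∀ u, Sum.inl u ∈ C.support → ∃ i, u = x i := by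
        intro u hu
        simp only [C, SimpleGraph.Walk.support_cons, SimpleGraph.Walk.support_nil, List.mem_cons,
          Sum.inl.injEq, reduceCtorEq, false_or, List.not_mem_nil, or_false] at hu
        rcases hu with hu | hu | hu | hu <;> exact ⟨_, hu⟩
      have hc : ∀ v, Sum.inr v ∈ C.support → ∃ i, v = y i := by
        intro u hu
        simp only [C, SimpleGraph.Walk.support_cons, SimpleGraph.Walk.support_nil, List.mem_cons,
          Sum.inr.injEq, reduceCtorEq, false_or, List.not_mem_nil, or_false] at hu
        rcases hu with hu | hu | hu <;> exact ⟨_, hu⟩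
      rcases a with u | v <;> rcases b with u' | v'
      · exact hab.elim
      · exact key u v' hab (hr _ ha) (hc _ hb)
      · rw [Sym2.eq_swap]; exact key u' v hab (hr _ hb) (hc _ ha)
      · exact hab.elim
  have hm := (h.cycleSig_mem hup C hC).1
  have hne : ∀ i j, i ≠ j → B (x i) (y j) ≠ 0 := by
    intro i j hij
    have := h.1.ne_zero_iff.1 (adj i j hij)
    simpa using this
  have key : cycleSig B C = pneg 1 := by
    have h7 : pneg (1 : Q) * pneg 1 = 1 := by rw [mul_pneg, mul_one, pneg_pneg]
    have n1 := hne 2 1 (by decide)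
    have n2 := hne 1 0 (by decide)
    have n3 := hne 0 2 (by decide)
    simp only [C, cycleSig, SimpleGraph.Walk.length_cons, SimpleGraph.Walk.length_nil,
      SimpleGraph.Walk.darts_cons, SimpleGraph.Walk.darts_nil, List.map_cons, List.map_nil,
      List.prod_cons, List.prod_nil, sig]
    norm_num [pow_succ, h7]
    refine (congrArg (pneg 1 * ·) ?_).trans (mul_one _)
    calc _ = (B (x 0) (y 1) * B (x 2) (y 0) * B (x 1) (y 2)) *
          ((B (x 2) (y 1))⁻¹ * (B (x 1) (y 0))⁻¹ * (B (x 0) (y 2))⁻¹) := by ac_rfl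
      _ = 1 := by rw [hB]; field_simp
  rwa [key] at hm

theorem sig_map (B : Matrix X Y Q) (v w : X ⊕ Y) : sig (B.map φ) v w = φ (sig B v w) := by
  rcases v with x | y <;> rcases w with x' | y' <;> simp [sig]

theorem cycleSig_map (hφ : IsHom φ) (B : Matrix X Y Q) {G : SimpleGraph (X ⊕ Y)} {v : X ⊕ Y}
    (C : G.Walk v v) : cycleSig (B.map φ) C = φ (cycleSig B C) := by
  simp only [cycleSig, map_mul, map_pow, hφ.map_pneg, map_one, map_list_prod, List.map_map, sig_map,
    Function.comp_def]

/-- Induced cycles of the image are cyclic patterns of `B`, whose signatures are lifted elements,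
and a lifted element is the lift of its own image. -/
theorem AllGood.isLocalLift (hφ : IsHom φ) [Fintype X] [DecidableEq X] {B₀ : Matrix X Y Q}
    (h : AllGood (lifted φ up) B₀) {X' Y' : Type*} {B : Matrix X' Y' Q} (hB : IsCrdForm B₀ B) :
    IsLocalLift φ up (B.map φ) B := by
  refine ⟨ScalingEquiv.refl _, hB.isPMatrix h.1, fun v C hC => ?_⟩
  obtain ⟨n, x, y, hx, hp, hsig⟩ := exists_pattern C hC
  have hp' : CyclePattern n (fun i j => B (x i) (y j) ≠ 0) := by simpa using hp
  obtain ⟨hf, he⟩ := h.cycleVal_mem hB hx hp'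
  rw [← hsig B, ← cycleSig_map hφ] at hf
  refine ⟨hf, ?_⟩
  rw [hsig B, ← he]
  congr 1
  exact Subtype.ext ((cycleSig_map hφ B C).trans (congrArg φ (hsig B)))

theorem cycleSig_scaling {A A' : Matrix X Y P} (h : ScalingEquiv A A') {v : X ⊕ Y}
    (C : (bipGraph A).Walk v v) (hC : IsInducedCycle C) : cycleSig A' C = cycleSig A C := by
  obtain ⟨n, x, y, hx, hp, hsig⟩ := exists_pattern C hC
  obtain ⟨r, c, hr, hc, h⟩ := h
  rw [hsig A, hsig A']
  simp only [h]
  exact cycleVal_scale n (fun i j => A (x i) (y j)) (fun i => hr (x i)) (fun i => hc (y i))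

theorem IsLocalLift.submatrix {B : Matrix X Y Q}
    (h : IsLocalLift φ up (B.map φ) B) {X' Y' : Type*} (f : X' ↪ X) (g : Y' ↪ Y)
    {D : Matrix X' Y' P} (hD : ScalingEquiv ((B.map φ).submatrix f g) D) :
    IsLocalLift φ up D (B.submatrix f g) := by
  refine ⟨hD, h.2.1.submatrix f g, fun v C hC => ?_⟩
  have hadj : ∀ a b, (bipGraph D).Adj a b ↔
      (bipGraph (B.map φ)).Adj (Sum.map f g a) (Sum.map f g b) := by
    rintro (x | y) (x' | y')
    · exact Iff.rfl
    · exact hD.ne_zero_iff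
    · exact hD.ne_zero_iff
    · exact Iff.rfl
  let m : bipGraph D →g bipGraph (B.map φ) := ⟨Sum.map f g, fun h => (hadj _ _).1 h⟩
  have hm : Injective m := f.injective.sumMap g.injective
  have hC' : IsInducedCycle (C.map m) := by
    refine ⟨(SimpleGraph.Walk.isCycle_map_iff_of_injective hm).2 hC.1, ?_⟩
    intro a ha b hb hab
    rw [SimpleGraph.Walk.support_map, List.mem_map] at ha hb
    obtain ⟨a, ha, rfl⟩ := ha
    obtain ⟨b, hb, rfl⟩ := hb
    rw [SimpleGraph.Walk.edges_map, List.mem_map]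
    exact ⟨s(a, b), hC.2 a ha b hb ((hadj a b).2 hab), rfl⟩
  have key : ∀ {R : Type _} [PartialField R] (M : Matrix X Y R),
      cycleSig M (C.map m) = cycleSig (M.submatrix f g) C := by
    intro R _ M
    simp only [cycleSig, SimpleGraph.Walk.length_map, SimpleGraph.Walk.darts_map, List.map_map]
    congr 3
    funext d
    rcases hd : d with ⟨⟨x | y, x' | y'⟩, h⟩ <;> rfl
  have key' : cycleSig (B.map φ) (C.map m) = cycleSig D C := by
    rw [← cycleSig_scaling hD.symm C hC]
    simp only [cycleSig, SimpleGraph.Walk.length_map, SimpleGraph.Walk.darts_map, List.map_map]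
    congr 3
    funext d
    rcases hd : d with ⟨⟨x | y, x' | y'⟩, h⟩ <;> rfl
  obtain ⟨hf, he⟩ := h.2.2 _ _ hC'
  rw [key B] at he
  refine ⟨by rw [← key']; exact hf, ?_⟩
  rw [← he]
  congr 1
  exact Subtype.ext key'.symm

end LocalLifts

end PartialField

namespace PartialField

open Function

/-! ### Liftable obstructions give the minor laws -/

section Obstructions

universe w₁ w₂

variable {Q P : Type*} [PartialField Q] [PartialField P] {φ : Q →*₀ P}
  {up : {p : P // IsFundamental p} → Q}

theorem IsLocalLift.ne_zero {X Y : Type*} {A : Matrix X Y P} {B : Matrix X Y Q}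
    (h : IsLocalLift φ up A B) {x : X} {y : Y} (hA : A x y ≠ 0) : B x y ≠ 0 := by
  have := h.1.ne_zero_iff.1 hA
  simpa using this

theorem IsLocalLift.cross_eq_one (hup : IsLiftingFunction φ up) {X Y : Type*} {A : Matrix X Y P}
    {B : Matrix X Y Q} (h : IsLocalLift φ up A B) {i j : X} {e f : Y} (hij : i ≠ j) (hef : e ≠ f)
    (h1 : A i e = 1) (h2 : A j e = 1) (h3 : A j f = 1) (h4 : A i f = 1) :
    B i e * B j f = B i f * B j e := by
  have hne : ∀ {x y}, A x y = 1 → A x y ≠ 0 := fun h => by rw [h]; exact one_ne_zero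
  obtain ⟨hm, he⟩ := h.cross_mem hup hij hef (hne h1) (hne h2) (hne h3) (hne h4)
  have hB : ∀ {x y}, A x y = 1 → B x y ≠ 0 := fun h' => h.ne_zero (hne h')
  have := eq_of_mem_lifted hm (isCrossSet_lifted hup).one_mem (by rw [he, h1, h2, h3, h4]; simp)
  rwa [div_eq_one_iff_eq (mul_ne_zero (hB h4) (hB h2))] at this

/-- If `φ p = 1`, `φ q = 1` or `φ p = φ q`, the matrix is not an obstruction, but then `q / p` is
`q`, `p⁻¹` or `1`, hence lifted. Otherwise any lifted `c`, `d` with the right images must be `p` and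
`q`. -/
theorem lifted_div_mem_of_line (hup : IsLiftingFunction φ up) {p q : Q} (hp : p ∈ lifted φ up)
    (hq : q ∈ lifted φ up) (hp0 : p ≠ 0) (hq0 : q ≠ 0)
    (h : φ p ≠ 1 → φ q ≠ 1 → φ p ≠ φ q → ∃ c d, (c ∈ lifted φ up ∧ φ c = φ p) ∧
      (d ∈ lifted φ up ∧ φ d = φ q) ∧ d / c ∈ lifted φ up) :
    q / p ∈ lifted φ up := by
  have hU := isCrossSet_lifted hup
  by_cases hp1 : φ p = 1
  · rw [eq_of_mem_lifted hp hU.one_mem (by rw [hp1, map_one]), div_one]; exact hq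
  by_cases hq1 : φ q = 1
  · rw [eq_of_mem_lifted hq hU.one_mem (by rw [hq1, map_one]), one_div]
    exact hU.inv_mem _ hp hp0
  by_cases hpq : φ p = φ q
  · rw [eq_of_mem_lifted hp hq hpq, div_self hq0]; exact hU.one_mem
  obtain ⟨c, d, ⟨hc, hcp⟩, ⟨hd, hdq⟩, hm⟩ := h hp1 hq1 hpq
  rwa [eq_of_mem_lifted hc hp hcp, eq_of_mem_lifted hd hq hdq] at hm

/-- In a local lift of a line minor the three cross ratios are lifted, and their multiplicative
relation is the law. In a local lift of the Fano matrix the hexagon has signature `-1`. -/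
theorem minorLaws_of_liftable_obstructions (hup : IsLiftingFunction φ up) {X₁ : Type w₁}
    {Y₁ : Type w₂} {A : Matrix X₁ Y₁ P}
    (h : ∀ (X' : Type w₁) (Y' : Type w₂) (B : Matrix X' Y' P), IsMinor A B →
      IsObstructionShape B ∨ IsObstructionShape B.transpose → ∃ C, IsLocalLift φ up B C)
    {X Y : Type} (e : X ≃ X₁) (f : Y ≃ Y₁) : MinorLaws φ (lifted φ up) (A.submatrix e f) := by
  refine ⟨fun p q hp hq hp0 hq0 hm => ?_, fun p q hp hq hp0 hq0 hm => ?_, fun hm => ?_,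
    fun hm => ?_⟩
  · refine lifted_div_mem_of_line hup hp hq hp0 hq0 fun hp1 hq1 hpq => ?_
    have hp0' : φ p ≠ 0 := by simpa using hp0
    have hq0' : φ q ≠ 0 := by simpa using hq0
    obtain ⟨C, hC⟩ := h _ _ _ (hm.ulift e f rfl) (Or.inl (Or.inr ⟨φ p, φ q, hp.1, hq.1, hp0', hp1,
      hq0', hq1, hpq, Equiv.ulift.symm, Equiv.ulift.symm, rfl⟩))
    have o : (1 : P) ≠ 0 := one_ne_zero
    have e1 := hC.cross_mem hup (i := ⟨0⟩) (j := ⟨1⟩) (e := ⟨0⟩) (f := ⟨1⟩) (by simp) (by simp)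
      o o hp0' o
    have e2 := hC.cross_mem hup (i := ⟨0⟩) (j := ⟨1⟩) (e := ⟨0⟩) (f := ⟨2⟩) (by simp) (by simp)
      o o hq0' o
    have e3 := hC.cross_mem hup (i := ⟨0⟩) (j := ⟨1⟩) (e := ⟨1⟩) (f := ⟨2⟩) (by simp) (by simp)
      o hp0' hq0' o
    refine ⟨_, _, ⟨e1.1, e1.2.trans ?_⟩, ⟨e2.1, e2.2.trans ?_⟩, ?_⟩
    · simp [lineMatrix]
    · simp [lineMatrix]
    · convert e3.1 using 1
      have n0 := hC.ne_zero (x := ⟨0⟩) (y := ⟨0⟩) o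
      have n1 := hC.ne_zero (x := ⟨0⟩) (y := ⟨1⟩) o
      have n2 := hC.ne_zero (x := ⟨0⟩) (y := ⟨2⟩) o
      have n3 := hC.ne_zero (x := ⟨1⟩) (y := ⟨0⟩) o
      have n4 := hC.ne_zero (x := ⟨1⟩) (y := ⟨1⟩) hp0'
      field_simp
  · refine lifted_div_mem_of_line hup hp hq hp0 hq0 fun hp1 hq1 hpq => ?_
    have hp0' : φ p ≠ 0 := by simpa using hp0
    have hq0' : φ q ≠ 0 := by simpa using hq0
    obtain ⟨C, hC⟩ := h _ _ _ (hm.ulift e f rfl) (Or.inr (Or.inr ⟨φ p, φ q, hp.1, hq.1, hp0', hp1,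
      hq0', hq1, hpq, Equiv.ulift.symm, Equiv.ulift.symm, rfl⟩))
    have o : (1 : P) ≠ 0 := one_ne_zero
    have e1 := hC.cross_mem hup (i := ⟨0⟩) (j := ⟨1⟩) (e := ⟨0⟩) (f := ⟨1⟩) (by simp) (by simp)
      o o hp0' o
    have e2 := hC.cross_mem hup (i := ⟨0⟩) (j := ⟨2⟩) (e := ⟨0⟩) (f := ⟨1⟩) (by simp) (by simp)
      o o hq0' o
    have e3 := hC.cross_mem hup (i := ⟨1⟩) (j := ⟨2⟩) (e := ⟨0⟩) (f := ⟨1⟩) (by simp) (by simp)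
      o o hq0' hp0'
    refine ⟨_, _, ⟨e1.1, e1.2.trans ?_⟩, ⟨e2.1, e2.2.trans ?_⟩, ?_⟩
    · simp [lineMatrix]
    · simp [lineMatrix]
    · convert e3.1 using 1
      have n0 := hC.ne_zero (x := ⟨0⟩) (y := ⟨0⟩) o
      have n1 := hC.ne_zero (x := ⟨0⟩) (y := ⟨1⟩) o
      have n2 := hC.ne_zero (x := ⟨1⟩) (y := ⟨0⟩) o
      have n3 := hC.ne_zero (x := ⟨2⟩) (y := ⟨0⟩) o
      have n4 := hC.ne_zero (x := ⟨1⟩) (y := ⟨1⟩) hp0'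
      field_simp
  · obtain ⟨C, hC⟩ := h _ _ _ (hm.ulift e f rfl) (Or.inl (Or.inl
      ⟨Equiv.ulift.symm, Equiv.ulift.symm, rfl⟩))
    refine hC.neg_one_mem hup (x := fun i => ⟨i⟩) (y := fun j => ⟨j.castSucc⟩)
      (fun i j hij => by simpa using hij) (fun i j hij => by simpa using hij) ?_ ?_
    · intro i j
      fin_cases i <;> fin_cases j <;> rfl
    -- Any two rows have a 2 × 2 block of ones that uses the last column, and its lift has cross
    -- ratio `1`. Multiplying the three resulting equations and cancelling the last column gives the
    -- hexagon relation.
    · have hne : ∀ i j, fanoMatrix P i j ≠ 0 → C ⟨i⟩ ⟨j⟩ ≠ 0 := fun i j hij =>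
        hC.ne_zero hij
      have e1 := hC.cross_eq_one hup (i := ⟨0⟩) (j := ⟨1⟩) (e := ⟨2⟩) (f := ⟨3⟩) (by simp) (by simp)
        rfl rfl rfl rfl
      have e2 := hC.cross_eq_one hup (i := ⟨0⟩) (j := ⟨2⟩) (e := ⟨1⟩) (f := ⟨3⟩) (by simp) (by simp)
        rfl rfl rfl rfl
      have e3 := hC.cross_eq_one hup (i := ⟨1⟩) (j := ⟨2⟩) (e := ⟨0⟩) (f := ⟨3⟩) (by simp) (by simp)
        rfl rfl rfl rfl
      have n0 := hne 0 3 (by simp [fanoMatrix])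
      have n1 := hne 1 3 (by simp [fanoMatrix])
      have n2 := hne 2 3 (by simp [fanoMatrix])
      apply mul_right_cancel₀ (mul_ne_zero (mul_ne_zero n0 n1) n2)
      calc _ = (C ⟨0⟩ ⟨1⟩ * C ⟨2⟩ ⟨3⟩) * (C ⟨1⟩ ⟨3⟩ * C ⟨2⟩ ⟨0⟩) * (C ⟨0⟩ ⟨3⟩ * C ⟨1⟩ ⟨2⟩) := by
            change C ⟨0⟩ ⟨1⟩ * C ⟨2⟩ ⟨0⟩ * C ⟨1⟩ ⟨2⟩ * _ = _
            ac_rfl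
        _ = _ := by
            rw [e2, ← e3, ← e1]
            change _ = C ⟨2⟩ ⟨1⟩ * C ⟨1⟩ ⟨0⟩ * C ⟨0⟩ ⟨2⟩ * _
            ac_rfl
  · obtain ⟨C, hC⟩ := h _ _ _ (hm.ulift e f rfl) (Or.inr (Or.inl
      ⟨Equiv.ulift.symm, Equiv.ulift.symm, rfl⟩))
    refine hC.neg_one_mem hup (x := fun i => ⟨i.castSucc⟩) (y := fun j => ⟨j⟩)
      (fun i j hij => by simpa using hij) (fun i j hij => by simpa using hij) ?_ ?_
    · intro i j
      fin_cases i <;> fin_cases j <;> rfl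
    · have hne : ∀ i j, fanoMatrix P j i ≠ 0 → C ⟨i⟩ ⟨j⟩ ≠ 0 := fun i j hij =>
        hC.ne_zero hij
      have e1 := hC.cross_eq_one hup (i := ⟨0⟩) (j := ⟨3⟩) (e := ⟨1⟩) (f := ⟨2⟩) (by simp) (by simp)
        rfl rfl rfl rfl
      have e2 := hC.cross_eq_one hup (i := ⟨2⟩) (j := ⟨3⟩) (e := ⟨0⟩) (f := ⟨1⟩) (by simp) (by simp)
        rfl rfl rfl rfl
      have e3 := hC.cross_eq_one hup (i := ⟨1⟩) (j := ⟨3⟩) (e := ⟨0⟩) (f := ⟨2⟩) (by simp) (by simp)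
        rfl rfl rfl rfl
      have n0 := hne 3 0 (by simp [fanoMatrix])
      have n1 := hne 3 1 (by simp [fanoMatrix])
      have n2 := hne 3 2 (by simp [fanoMatrix])
      apply mul_right_cancel₀ (mul_ne_zero (mul_ne_zero n0 n1) n2)
      calc _ = (C ⟨0⟩ ⟨1⟩ * C ⟨3⟩ ⟨2⟩) * (C ⟨2⟩ ⟨0⟩ * C ⟨3⟩ ⟨1⟩) * (C ⟨1⟩ ⟨2⟩ * C ⟨3⟩ ⟨0⟩) := by
            change C ⟨0⟩ ⟨1⟩ * C ⟨2⟩ ⟨0⟩ * C ⟨1⟩ ⟨2⟩ * _ = _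
            ac_rfl
        _ = _ := by
            rw [e1, e2, ← e3]
            change _ = C ⟨2⟩ ⟨1⟩ * C ⟨1⟩ ⟨0⟩ * C ⟨0⟩ ⟨2⟩ * _
            ac_rfl

end Obstructions

/-! ### Global lifts, minors and good matrices -/

section GlobalLifts

universe w₁ w₂

variable {Q P : Type*} [PartialField Q] [PartialField P] {φ : Q →*₀ P}
  {up : {p : P // IsFundamental p} → Q}

theorem IsPivot.submatrix {X Y : Type*} {A B : Matrix X Y P} {X' Y' : Type*} (f : X' ↪ X)
    (g : Y' ↪ Y) {x : X'} {y : Y'} (h : IsPivot A (f x) (g y) B) :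
    IsPivot (A.submatrix f g) x y (B.submatrix f g) := by
  obtain ⟨h0, h1, h2, h3, h4⟩ := h
  exact ⟨h0, h1, fun v hv => h2 _ (g.injective.ne hv), fun u hu => h3 _ (f.injective.ne hu),
    fun u v hu hv => h4 _ _ (f.injective.ne hu) (g.injective.ne hv)⟩

/-- Each minor of `A` is, up to scaling, a submatrix of the image of some `D` strongly equivalent to
the lift: scalings and deletions keep `D`, and a pivot is performed on `D` at the same position.
Local lifts restrict to submatrices. -/
theorem IsGlobalLift.exists_isLocalLift (hφ : IsHom φ) {X : Type w₁} {Y : Type w₂} [Finite X]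
    {A : Matrix X Y P} {C : Matrix X Y Q} (h : IsGlobalLift φ up A C) {X' : Type w₁}
    {Y' : Type w₂} {B : Matrix X' Y' P} (hB : IsMinor A B) : ∃ D, IsLocalLift φ up B D := by
  classical
  have := Fintype.ofFinite X
  have key : ∃ (D : Matrix X Y Q) (f : X' ↪ X) (g : Y' ↪ Y), StrongEquiv D C ∧
      ScalingEquiv ((D.map φ).submatrix f g) B := by
    induction hB with
    | refl => exact ⟨C, .refl _, .refl _, ⟨.refl, .refl⟩, h.1⟩
    | scale _ hs ih =>
      obtain ⟨D, f, g, hD, h'⟩ := ih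
      exact ⟨D, f, g, hD, h'.trans hs⟩
    | delete p q _ ih =>
      obtain ⟨D, f, g, hD, h'⟩ := ih
      exact ⟨D, p.trans f, q.trans g, hD, h'.submatrix p q⟩
    | pivot x y _ hp ih =>
      obtain ⟨D, f, g, hD, h'⟩ := ih
      have hxy : D (f x) (g y) ≠ 0 := by
        have := h'.ne_zero_iff.1 hp.1
        simpa using this
      obtain ⟨E, hE⟩ := (h.2 D hD).2.1.exists_pivot hxy
      exact ⟨E, f, g, ⟨(IsMinor.pivot _ _ .refl hE.symm).trans hD.1, hD.2.pivot _ _ hE⟩,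
        ((hE.map hφ).submatrix f g).of_scaling h' hp⟩
  obtain ⟨D, f, g, hD, h'⟩ := key
  exact ⟨_, (h.2 D hD).submatrix f g h'⟩

/-- A matrix strongly equivalent to a good one is a coordinate form of it, and coordinate forms are
local lifts of their images. -/
theorem AllGood.isGlobalLift (hφ : IsHom φ) {X₀ Y₀ : Type} [Fintype X₀] [DecidableEq X₀]
    {C : Matrix X₀ Y₀ Q} (hC : AllGood (lifted φ up) C) {X : Type w₁} {Y : Type w₂}
    (e : X ≃ X₀) (f : Y ≃ Y₀) {A : Matrix X Y P}
    (h : ScalingEquiv (C.map φ) (A.submatrix e.symm f.symm)) :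
    IsGlobalLift φ up A (C.submatrix e f) := by
  refine ⟨?_, fun D hD => ?_⟩
  · have := h.submatrix e f
    rw [Matrix.submatrix_submatrix, Equiv.symm_comp_self, Equiv.symm_comp_self,
      Matrix.submatrix_id_id] at this
    exact this
  · refine hC.isLocalLift hφ (IsCrdForm.minor hC.1 (D := C.submatrix e f) ?_ hD.2)
    refine ⟨Sum.inl, e, Sum.inr ∘ f, by rw [chi_inl]; exact one_ne_zero, e.injective, ?_⟩
    simp only [crd_inl_inr, comp_apply]
    exact ScalingEquiv.refl _

end GlobalLifts

end PartialField

namespace PartialField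

open Function

/-! ### Brackets and deletion of columns -/

section ColumnDeletion

theorem exists_eq_map_val {X Y : Type*} {b : Y} {e : X ⊕ Y} (he : e ≠ Sum.inr b) :
    ∃ e' : X ⊕ {y // y ≠ b}, e = Sum.map id Subtype.val e' := by
  rcases e with x | y
  · exact ⟨Sum.inl x, rfl⟩
  · exact ⟨Sum.inr ⟨y, fun h => he (by rw [h])⟩, rfl⟩

variable {P : Type*} [PartialField P] {X Y Y' : Type*} [Fintype X] [DecidableEq X]
  {A : Matrix X Y P} {U : Set P}

theorem brk_submatrix (A : Matrix X Y P) (g : Y' → Y) (T : X → X ⊕ Y') :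
    brk (extMatrix (A.submatrix id g)) T = brk (extMatrix A) (Sum.map id g ∘ T) := by
  rw [brk, brk]
  congr 1
  ext x k
  rw [Matrix.submatrix_apply, Matrix.submatrix_apply, comp_apply]
  rcases T k with x' | y' <;> rfl

theorem chi_submatrix (A : Matrix X Y P) (g : Y' → Y) (T : X → X ⊕ Y') :
    chi (A.submatrix id g) T = chi A (Sum.map id g ∘ T) := by
  by_cases h : Nice A (Sum.map id g ∘ T)
  · have h' : Nice (A.submatrix id g) T := by rwa [Nice, brk_submatrix]
    apply ι_injective
    rw [h'.ι_chi, h.ι_chi, brk_submatrix]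
  · have h' : ¬ Nice (A.submatrix id g) T := by rwa [Nice, brk_submatrix]
    rw [chi, chi, dif_neg h, dif_neg h']

theorem crd_submatrix (A : Matrix X Y P) (g : Y' → Y) (T : X → X ⊕ Y') (k : X) (e : X ⊕ Y') :
    crd (A.submatrix id g) T k e = crd A (Sum.map id g ∘ T) k (Sum.map id g e) := by
  rw [crd, crd, chi_submatrix, chi_submatrix, comp_update]

theorem AllGood.nice_of_delete {b : Y}
    (h : AllGood U (A.submatrix id (Subtype.val : {y // y ≠ b} → Y))) {T : X → X ⊕ Y}
    (hT : ∀ l, T l ≠ Sum.inr b) : Nice A T := by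
  choose T' hT' using fun l => exists_eq_map_val (hT l)
  obtain ⟨p, hp⟩ := h.1 T'
  rw [brk_submatrix] at hp
  exact ⟨p, by rw [← hp]; congr 1; exact funext hT'⟩

theorem AllGood.goodAt_of_delete {b : Y}
    (h : AllGood U (A.submatrix id (Subtype.val : {y // y ≠ b} → Y))) (T : X → X ⊕ Y)
    (h0 : chi A T ≠ 0) (hT : ∀ l, T l ≠ Sum.inr b) (i j : X) (e f : X ⊕ Y) (he : e ≠ Sum.inr b)
    (hf : f ≠ Sum.inr b) : GoodAt U A T i j e f := by
  choose T' hT' using fun l => exists_eq_map_val (hT l)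
  obtain rfl : T = Sum.map id Subtype.val ∘ T' := funext hT'
  obtain ⟨e, rfl⟩ := exists_eq_map_val he
  obtain ⟨f, rfl⟩ := exists_eq_map_val hf
  have := h.2 T' (by rwa [chi_submatrix]) i j e f
  simpa only [GoodAt, cr, crd_submatrix] using this

end ColumnDeletion

/-! ### Gluing the lifts of two deletions -/

section HasLift

variable {Q P : Type*} [PartialField Q] [PartialField P] {φ : Q →*₀ P} {U : Set Q}
  {up : {p : P // IsFundamental p} → Q}

/-- Up to scaling, `A` is the image of a matrix all of whose cross ratios are in `U`. -/
def HasLift (φ : Q →*₀ P) (U : Set Q) {X Y : Type} [Fintype X] [DecidableEq X]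
    (A : Matrix X Y P) : Prop :=
  ∃ C : Matrix X Y Q, ScalingEquiv (C.map φ) A ∧ AllGood U C

variable {X Y : Type} [Fintype X] [DecidableEq X] {A B : Matrix X Y P}

theorem HasLift.transpose (hU : IsCrossSet U) [Fintype Y] [DecidableEq Y] (h : HasLift φ U A) :
    HasLift φ U A.transpose := by
  obtain ⟨C, hC, hg⟩ := h
  exact ⟨C.transpose, hC.transpose, hg.transpose hU⟩

theorem HasLift.pivot (hφ : IsHom φ) (hU : IsCrossSet U) (h : HasLift φ U A) {x : X} {y : Y}
    (hAB : IsPivot A x y B) : HasLift φ U B := by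
  obtain ⟨C, hC, hg⟩ := h
  have hxy : C x y ≠ 0 := by
    have := hC.ne_zero_iff.1 hAB.1
    simpa using this
  obtain ⟨D, hD⟩ := (isPMatrix_of_nice hg.1).exists_pivot hxy
  exact ⟨D, (hD.map hφ).of_scaling hC hAB, hg.minor hU (.pivot _ _ .refl hD)⟩

/-- The rows of `A` stay connected when the columns `a` and `b` are deleted, or these columns are in
different components. -/
def ColumnGluable (A : Matrix X Y P) (a b : Y) : Prop :=
  (∀ s : X ⊕ Y → Prop, (∀ x y, y ≠ a → y ≠ b → A x y ≠ 0 → (s (Sum.inr y) ↔ s (Sum.inl x))) →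
    ∀ x x', s (Sum.inl x) ↔ s (Sum.inl x')) ∨
  ∃ s : X ⊕ Y → Prop, (∀ x y, A x y ≠ 0 → (s (Sum.inr y) ↔ s (Sum.inl x))) ∧
    s (Sum.inr a) ∧ ¬ s (Sum.inr b)

/-- Scalings off `b` and off `a` combine. -/
theorem ColumnGluable.scalingEquiv {X Y : Type} [DecidableEq Y] {A B : Matrix X Y P}
    {a b : Y} (hab : a ≠ b)
    (h : ColumnGluable A a b)
    {r₁ r₂ : X → P} {c₁ c₂ : Y → P} (hr₁ : ∀ x, r₁ x ≠ 0) (hr₂ : ∀ x, r₂ x ≠ 0)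
    (hc₁ : ∀ y, c₁ y ≠ 0) (hc₂ : ∀ y, c₂ y ≠ 0) (h0 : ∀ x y, B x y ≠ 0 → A x y ≠ 0)
    (h₁ : ∀ x y, y ≠ b → A x y = r₁ x * B x y * c₁ y)
    (h₂ : ∀ x y, y ≠ a → A x y = r₂ x * B x y * c₂ y) : ScalingEquiv B A := by
  classical
  rcases h with h | ⟨s, hs, ha, hb⟩
  -- Along each edge off `a` and `b` the ratio `r₁ x / r₂ x` equals `c₂ y / c₁ y`. This ratio is
  -- therefore constant on the rows, and the two scalings differ by one factor `t`.
  · obtain ⟨t, ht0, ht⟩ : ∃ t, t ≠ 0 ∧ ∀ x, r₁ x = t * r₂ x := by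
      rcases isEmpty_or_nonempty X with hX | ⟨⟨x₀⟩⟩
      · exact ⟨1, one_ne_zero, fun x => (hX.false x).elim⟩
      · refine ⟨r₁ x₀ / r₂ x₀, div_ne_zero (hr₁ _) (hr₂ _), fun x => ?_⟩
        have := h (Sum.elim (fun x => r₁ x / r₂ x = r₁ x₀ / r₂ x₀)
          fun y => c₂ y / c₁ y = r₁ x₀ / r₂ x₀) (fun x y hya hyb hxy => ?_) x₀ x
        · rw [← (show r₁ x / r₂ x = _ from this.1 rfl), div_mul_cancel₀ _ (hr₂ x)]
        · have e : r₁ x / r₂ x = c₂ y / c₁ y := by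
            have hB : B x y ≠ 0 := fun hB => hxy (by rw [h₁ x y hyb, hB, mul_zero, zero_mul])
            rw [div_eq_div_iff (hr₂ x) (hc₁ y)]
            apply mul_left_cancel₀ hB
            calc _ = r₁ x * B x y * c₁ y := by ac_rfl
              _ = r₂ x * B x y * c₂ y := by rw [← h₁ x y hyb, h₂ x y hya]
              _ = _ := by ac_rfl
          change _ = _ ↔ _ = _
          rw [e]
    refine ⟨r₁, fun y => if y = b then t⁻¹ * c₂ y else c₁ y, hr₁, fun y => ?_, fun x y => ?_⟩
    · dsimp only
      split_ifs
      · exact mul_ne_zero (inv_ne_zero ht0) (hc₂ y)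
      · exact hc₁ y
    · dsimp only
      split_ifs with hy
      · subst hy
        rw [h₂ x y hab.symm, ht]
        field_simp
      · exact h₁ x y hy
  · refine ⟨fun x => if s (Sum.inl x) then r₁ x else r₂ x,
      fun y => if s (Sum.inr y) then c₁ y else c₂ y, fun x => ?_, fun y => ?_, fun x y => ?_⟩
    · dsimp only
      split_ifs; exacts [hr₁ x, hr₂ x]
    · dsimp only
      split_ifs; exacts [hc₁ y, hc₂ y]
    · dsimp only
      by_cases hB : B x y = 0
      · rw [hB, mul_zero, zero_mul]
        by_cases hy : y = b
        · rw [h₂ x y (by rw [hy]; exact hab.symm), hB, mul_zero, zero_mul]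
        · rw [h₁ x y hy, hB, mul_zero, zero_mul]
      · have hxy := hs x y (h0 x y hB)
        by_cases hx : s (Sum.inl x)
        · have hy := hxy.2 hx
          rw [if_pos hx, if_pos hy]
          exact h₁ x y fun h => hb (h ▸ hy)
        · have hy := fun h => hx (hxy.1 h)
          rw [if_neg hx, if_neg hy]
          exact h₂ x y fun h => hy (h ▸ ha)

/-- By uniqueness the two lifts agree up to scaling on the common columns, so they can be glued.
Gluability is used twice: to see that the glued matrix maps to `A` up to scaling, and to see that it
is good. -/
theorem hasLift_of_deletions (hφ : IsHom φ) (hup : IsLiftingFunction φ up) [Finite Y]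
    (hA : IsPMatrix A) (hl : MinorLaws φ (lifted φ up) A) {a b : Y} (hab : a ≠ b)
    (h₁ : HasLift φ (lifted φ up) (A.submatrix id (Subtype.val : {y // y ≠ b} → Y)))
    (h₂ : HasLift φ (lifted φ up) (A.submatrix id (Subtype.val : {y // y ≠ a} → Y)))
    (hg : ColumnGluable A a b) : HasLift φ (lifted φ up) A := by
  classical
  have hU := isCrossSet_lifted hup
  obtain ⟨C₁, hC₁, hg₁⟩ := h₁
  obtain ⟨C₂, hC₂, hg₂⟩ := h₂
  let Z := {y // y ≠ a ∧ y ≠ b}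
  let g₁ : Z ↪ {y // y ≠ b} := ⟨fun z => ⟨z.1, z.2.2⟩, fun z w h => Subtype.ext (by simpa using h)⟩
  let g₂ : Z ↪ {y // y ≠ a} := ⟨fun z => ⟨z.1, z.2.1⟩, fun z w h => Subtype.ext (by simpa using h)⟩
  have hs : ScalingEquiv (C₁.submatrix id g₁) (C₂.submatrix id g₂) := by
    refine scalingEquiv_of_map hφ (hg₁.minor hU (.delete (Embedding.refl X) g₁ .refl))
      (hg₂.minor hU (.delete (Embedding.refl X) g₂ .refl)) ?_
    exact (hC₁.submatrix id g₁).trans (hC₂.submatrix id g₂).symm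
  obtain ⟨ρ, γ, hρ, hγ, hs⟩ := hs
  -- `C₁` is kept, and the missing column `b` is taken from `C₂`, divided by the row factors `ρ`
  -- that carry `C₁` to `C₂` on the common columns.
  let C : Matrix X Y Q := fun x y => if h : y = b then (ρ x)⁻¹ * C₂ x ⟨b, hab.symm⟩ else C₁ x ⟨y, h⟩
  have hCb : ∀ x, C x b = (ρ x)⁻¹ * C₂ x ⟨b, hab.symm⟩ := fun x => dif_pos rfl
  have hCn : ∀ x y (h : y ≠ b), C x y = C₁ x ⟨y, h⟩ := fun x y h => dif_neg h
  have hd₁ : C.submatrix id (Subtype.val : {y // y ≠ b} → Y) = C₁ := by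
    ext x y
    exact hCn x y.1 y.2
  let γ' : Y → Q := fun y => if h : y ≠ a ∧ y ≠ b then γ ⟨y, h⟩ else 1
  have hγ' : ∀ y, γ' y ≠ 0 := by
    intro y
    by_cases h : y ≠ a ∧ y ≠ b
    · simp only [γ', dif_pos h]; exact hγ _
    · simp only [γ', dif_neg h]; exact one_ne_zero
  have hd₂' : ∀ x y (h : y ≠ a), C₂ x ⟨y, h⟩ = ρ x * C x y * γ' y := by
    intro x y hya
    by_cases hyb : y = b
    · subst hyb
      have : γ' y = 1 := dif_neg (by simp)
      rw [this, mul_one, hCb, mul_inv_cancel_left₀ (hρ x)]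
    · have : γ' y = γ ⟨y, hya, hyb⟩ := dif_pos ⟨hya, hyb⟩
      rw [this, hCn x y hyb]
      exact hs x ⟨y, hya, hyb⟩
  have hd₂ : ScalingEquiv C₂ (C.submatrix id (Subtype.val : {y // y ≠ a} → Y)) :=
    ScalingEquiv.symm ⟨ρ, fun y => γ' y.1, hρ, fun y => hγ' _, fun x y => hd₂' x y.1 y.2⟩
  have hg₁' : AllGood (lifted φ up) (C.submatrix id (Subtype.val : {y // y ≠ b} → Y)) := by
    rwa [hd₁]
  have hg₂' : AllGood (lifted φ up) (C.submatrix id (Subtype.val : {y // y ≠ a} → Y)) :=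
    hg₂.minor hU (.scale .refl hd₂)
  have hz : ∀ x y, C x y ≠ 0 ↔ A x y ≠ 0 := by
    intro x y
    by_cases hyb : y = b
    · subst hyb
      have h1 := hC₂.ne_zero_iff (x := x) (y := ⟨y, hab.symm⟩)
      rw [hCb]
      have h2 : C₂ x ⟨y, hab.symm⟩ ≠ 0 ↔ A x y ≠ 0 := by simpa using h1.symm
      rw [← h2]
      simp [hρ x]
    · have h1 := hC₁.ne_zero_iff (x := x) (y := ⟨y, hyb⟩)
      rw [hCn x y hyb]
      simpa using h1.symm
  have hCA : ScalingEquiv (C.map φ) A := by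
    obtain ⟨r₁, c₁, hr₁, hc₁, e₁⟩ := hC₁
    obtain ⟨r₂, c₂, hr₂, hc₂, e₂⟩ := hC₂
    refine hg.scalingEquiv hab (r₁ := r₁) (r₂ := fun x => r₂ x * φ (ρ x))
      (c₁ := fun y => if h : y = b then 1 else c₁ ⟨y, h⟩)
      (c₂ := fun y => φ (γ' y) * if h : y = a then 1 else c₂ ⟨y, h⟩) hr₁ ?_ ?_ ?_ ?_ ?_ ?_
    · exact fun x => mul_ne_zero (hr₂ x) (by simpa using hρ x)
    · intro y
      split_ifs; exacts [one_ne_zero, hc₁ _]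
    · intro y
      refine mul_ne_zero (by simpa using hγ' y) ?_
      split_ifs; exacts [one_ne_zero, hc₂ _]
    · intro x y h
      rw [← hz]
      simpa using h
    · intro x y hy
      rw [dif_neg hy, Matrix.map_apply, hCn x y hy]
      exact e₁ x ⟨y, hy⟩
    · intro x y hy
      rw [dif_neg hy, Matrix.map_apply]
      have := e₂ x ⟨y, hy⟩
      rw [Matrix.map_apply, hd₂' x y hy, map_mul, map_mul] at this
      exact this.trans (by ac_rfl)
  refine ⟨C, hCA, ?_⟩
  have hP : IsPMatrix (C.map φ) := hCA.symm.isPMatrix hA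
  have hM : MinorLaws φ (lifted φ up) (C.map φ) := hl.minor (.scale .refl hCA.symm)
  refine DeletionsGood.allGood (a := Sum.inr a) (b := Sum.inr b) ⟨by simpa using hab, hU, ?_,
    lineLaw_of_minorLaws hφ hU hP hM, colineLaw_of_minorLaws hφ hU hP hM,
    fanoLaw_of_minorLaws hφ hP hM, hg₂'.goodAt_of_delete, hg₁'.goodAt_of_delete⟩ (by simp)
    (by simp) ?_
  · rintro T (hT | hT)
    · exact hg₂'.nice_of_delete hT
    · exact hg₁'.nice_of_delete hT
  · rcases hg with hg | ⟨s, hs, ha, hb⟩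
    · exact Or.inl fun s hs => hg s fun x y hya hyb hxy =>
        hs x y (by simpa using hya) (by simpa using hyb) ((hz x y).2 hxy)
    · exact Or.inr ⟨s, fun x y hxy => hs x y ((hz x y).1 hxy), ha, hb⟩

end HasLift

end PartialField

namespace PartialField

open Function

/-! ### Matrices with one row or with two rows and two columns -/

section Small

variable {Q P : Type*} [PartialField Q] [PartialField P] {φ : Q →*₀ P}
  {up : {p : P // IsFundamental p} → Q}

open Classical in
/-- The `0, 1`-matrix with the same nonzero entries. -/
noncomputable def supportMatrix (Q : Type*) [PartialField Q] {X Y : Type*} (A : Matrix X Y P) :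
    Matrix X Y Q :=
  Matrix.of fun x y => if A x y = 0 then 0 else 1

theorem supportMatrix_ne_zero {X Y : Type*} {A : Matrix X Y P} {x : X} {y : Y} :
    supportMatrix Q A x y ≠ 0 ↔ A x y ≠ 0 := by
  simp [supportMatrix]

/-- With at most two rows and no full 2 × 2 submatrix the graph has no cycle, so the entries
themselves form a trivial weight. -/
theorem scalingEquiv_supportMatrix {X Y : Type*} [Finite Y] {A : Matrix X Y P}
    (hX : ∀ i j k : X, i = j ∨ i = k ∨ j = k)
    (h : ∀ i j e f, i ≠ j → e ≠ f → A i e ≠ 0 → A i f ≠ 0 → A j e ≠ 0 → A j f ≠ 0 → False) :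
    ScalingEquiv ((supportMatrix Q A).map φ) A := by
  classical
  have := Fintype.ofFinite Y
  have key := exists_coboundary (fun x y => A x y ≠ 0)
    (fun x y => if A x y = 0 then 1 else A x y) (fun x y => ?_) ?_ Finset.univ
  · obtain ⟨ρ, γ, hρ, hγ, hc⟩ := key
    refine ⟨ρ, γ, hρ, hγ, fun x y => ?_⟩
    by_cases hxy : A x y = 0
    · simp [supportMatrix, hxy]
    · have := hc x y (Finset.mem_univ y) hxy
      rw [if_neg hxy] at this
      simp [supportMatrix, this]
  · by_cases hxy : A x y = 0
    · rw [if_pos hxy]; exact one_ne_zero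
    · rw [if_neg hxy]; exact hxy
  · intro n x y hx hp
    rcases Nat.eq_zero_or_pos n with rfl | hn
    · by_cases hy : y 0 = y 1
      · simp [Finset.prod_range_succ, hy, mul_comm]
      · exact (h (x 0) (x 1) (y 0) (y 1)
          (fun h => absurd (hx 0 (by omega) 1 (by omega) h) (by omega)) hy
          (hp.diag 0 (by omega)) hp.corner (hp.sub 0 (by omega)) (hp.diag 1 (by omega))).elim
    · rcases hX (x 0) (x 1) (x 2) with h | h | h
      · exact absurd (hx 0 (by omega) 1 (by omega) h) (by omega)
      · exact absurd (hx 0 (by omega) 2 (by omega) h) (by omega)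
      · exact absurd (hx 1 (by omega) 2 (by omega) h) (by omega)

theorem allGood_of_subsingleton {X Y : Type*} [Fintype X] [DecidableEq X] [Subsingleton X]
    (U : Set P) (A : Matrix X Y P) : AllGood U A := by
  refine ⟨fun T => ?_, fun T h0 i j e f hij => absurd (Subsingleton.elim i j) hij⟩
  rcases isEmpty_or_nonempty X with hX | ⟨⟨x⟩⟩
  · exact ⟨1, by rw [brk, Matrix.det_isEmpty, map_one]⟩
  · rw [Nice, brk, Matrix.det_eq_elem_of_subsingleton _ x, Matrix.submatrix_apply]
    rcases T x with x' | y
    · exact ⟨1, by rw [Subsingleton.elim x' x]; simp [extMatrix]⟩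
    · exact ⟨A x y, rfl⟩

variable {X Y : Type} [Fintype X] [DecidableEq X] {A : Matrix X Y P}

theorem hasLift_of_subsingleton [Finite Y] [Subsingleton X] (U : Set Q) (A : Matrix X Y P) :
    HasLift φ U A :=
  ⟨_, scalingEquiv_supportMatrix (fun _ _ _ => Or.inl (Subsingleton.elim _ _))
    fun _ _ _ _ hij => absurd (Subsingleton.elim _ _) hij, allGood_of_subsingleton U _⟩

/-- Deleting one column leaves a single column, which is good. A basis avoiding both columns is a
permutation of the unit vectors, so the only new cross ratios are those of the entries of `C`. -/
theorem allGood_of_two_columns {U : Set Q} (hU : IsCrossSet U) {C : Matrix X Y Q}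
    (hL : LineLaw U C) (hL' : ColineLaw U C) {a b : Y} (hab : a ≠ b) (hY : ∀ y, y = a ∨ y = b)
    (h : ∀ i j, i ≠ j → C i a ≠ 0 → C i b ≠ 0 → C j a ≠ 0 → C j b ≠ 0 →
      C i a * C j b / (C i b * C j a) ∈ U) : AllGood U C := by
  classical
  have key : ∀ {c d : Y}, (∀ y, y = c ∨ y = d) →
      AllGood U (C.submatrix id (Subtype.val : {y // y ≠ d} → Y)) := by
    intro c d hcd
    have : Subsingleton {y // y ≠ d} := ⟨fun y z => Subtype.ext
      (((hcd y.1).resolve_right y.2).trans ((hcd z.1).resolve_right z.2).symm)⟩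
    have hf : Finite {y // y ≠ d} := Finite.of_subsingleton
    have := Fintype.ofFinite {y // y ≠ d}
    exact (allGood_of_subsingleton U
      (C.submatrix id (Subtype.val : {y // y ≠ d} → Y)).transpose).transpose hU
  have hb := key hY
  have ha := key fun y => (hY y).symm
  refine allGood_of_pairs_good (a := Sum.inr a) (b := Sum.inr b) hU (by simpa using hab) (by simp)
    (by simp) ?_ hL hL' ha.goodAt_of_delete hb.goodAt_of_delete ?_
  · rintro T (hT | hT)
    · exact ha.nice_of_delete hT
    · exact hb.nice_of_delete hT
  · intro T hT h0 i j hij h1 h2 h3 h4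
    have hl : ∀ k, ∃ x, T k = Sum.inl x := by
      intro k
      rcases hk : T k with x | y
      · exact ⟨x, rfl⟩
      · rcases hY y with rfl | rfl
        · exact absurd hk (hT k).1
        · exact absurd hk (hT k).2
    choose σ hσ using hl
    have hN := hb.nice_of_delete fun l => (hT l).2
    have hi : Injective T := by
      by_contra hi
      exact h0 (chi_eq (by rw [brk_eq_zero _ hi, map_zero]))
    have hσi : Injective σ := fun k l hkl => hi (by rw [hσ, hσ, hkl])
    have hc := crd_of_inl hN h0 hσ (Finite.injective_iff_bijective.1 hσi)
    rw [hc] at h1 h2 h3 h4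
    rw [cr, hc, hc, hc, hc]
    exact h _ _ (hσi.ne hij) h1 h2 h3 h4

/-- One minus the cross ratio is the negated determinant of the 2 × 2 submatrix divided by a product
of entries, and the determinant is defined. -/
theorem isFundamental_cross {X Y : Type*} {A : Matrix X Y P} (hA : IsPMatrix A) {i j : X}
    (hij : i ≠ j) {a b : Y} (hab : a ≠ b) (h1 : A i b ≠ 0) (h2 : A j a ≠ 0) :
    IsFundamental (A i a * A j b / (A i b * A j a)) := by
  obtain ⟨d, hd⟩ := isPMatrix_iff.1 hA 2
    ⟨![i, j], by intro u v; fin_cases u <;> fin_cases v <;> simp [hij, hij.symm]⟩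
    ⟨![a, b], by intro u v; fin_cases u <;> fin_cases v <;> simp [hab, hab.symm]⟩
  rw [Matrix.det_fin_two] at hd
  change ι (A i a) * ι (A j b) - ι (A i b) * ι (A j a) = ι d at hd
  have h0 := mul_ne_zero h1 h2
  refine isFundamental_iff.2 ⟨pneg d / (A i b * A j a), ?_⟩
  rw [← (isUnit_ι h0).mul_left_inj, sub_mul, one_mul, ← map_mul, ← map_mul, div_mul_cancel₀ _ h0,
    div_mul_cancel₀ _ h0, ι_pneg, ← hd, map_mul, map_mul]
  ring

theorem hasLift_of_two (hφ : IsHom φ) (hup : IsLiftingFunction φ up) (hA : IsPMatrix A)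
    (hl : MinorLaws φ (lifted φ up) A) {i j : X} (hij : i ≠ j) (hX : ∀ x, x = i ∨ x = j) {a b : Y}
    (hab : a ≠ b) (hY : ∀ y, y = a ∨ y = b) : HasLift φ (lifted φ up) A := by
  classical
  have hU := isCrossSet_lifted hup
  have hf : Finite Y := Set.finite_univ_iff.1 <| (Set.toFinite {a, b}).subset fun y _ => hY y
  obtain ⟨C, hC, hcr⟩ : ∃ C : Matrix X Y Q, ScalingEquiv (C.map φ) A ∧
      ∀ i j, i ≠ j → C i a ≠ 0 → C i b ≠ 0 → C j a ≠ 0 → C j b ≠ 0 →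
        C i a * C j b / (C i b * C j a) ∈ lifted φ up := by
    by_cases h4 : A i a ≠ 0 ∧ A i b ≠ 0 ∧ A j a ≠ 0 ∧ A j b ≠ 0
    · obtain ⟨h1, h2, h3, h4⟩ := h4
      obtain ⟨q, hm, hφq⟩ : ∃ q ∈ lifted φ up, φ q = A i a * A j b / (A i b * A j a) :=
        ⟨_, up_mem_lifted hup ⟨_, isFundamental_cross hA hij hab h2 h3⟩, hup.1 _⟩
      have hq0 : q ≠ 0 := by
        rintro rfl
        rw [map_zero] at hφq
        exact div_ne_zero (mul_ne_zero h1 h4) (mul_ne_zero h2 h3) hφq.symm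
      -- The only nontrivial entry is the lift `q` of the cross ratio; the factors `A x b` and `A j
      -- a / A j b` restore `A` from the image.
      refine ⟨Matrix.of fun x y => if x = i ∧ y = a then q else 1,
        ⟨fun x => A x b, fun y => if y = a then A j a / A j b else 1, ?_, ?_, ?_⟩, ?_⟩
      · intro x; rcases hX x with rfl | rfl <;> assumption
      · intro y
        dsimp only
        split_ifs
        · exact div_ne_zero h3 h4
        · exact one_ne_zero
      · intro x y
        rcases hX x with rfl | rfl <;> rcases hY y with rfl | rfl <;>
          simp [hab.symm, hij.symm, hφq] <;> field_simp
      · intro i' j' hij' _ _ _ _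
        have hi' := hX i'
        have hj' := hX j'
        rcases hi' with rfl | rfl
        · obtain rfl := hj'.resolve_left hij'.symm
          simpa [hij'.symm, hab.symm] using hm
        · obtain rfl := hj'.resolve_right hij'.symm
          simpa [hij', hab.symm] using hU.inv_mem _ hm hq0
    · have hz : ∀ i' j', i' ≠ j' → A i' a ≠ 0 → A i' b ≠ 0 → A j' a ≠ 0 → A j' b ≠ 0 → False := by
        intro i' j' hij' e1 e2 e3 e4
        rcases hX i' with rfl | rfl
        · obtain rfl := (hX j').resolve_left hij'.symm
          exact h4 ⟨e1, e2, e3, e4⟩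
        · obtain rfl := (hX j').resolve_right hij'.symm
          exact h4 ⟨e3, e4, e1, e2⟩
      refine ⟨supportMatrix Q A, scalingEquiv_supportMatrix ?_ ?_, ?_⟩
      · intro x y z
        rcases hX x with rfl | rfl <;> rcases hX y with rfl | rfl <;> rcases hX z with rfl | rfl <;>
          simp
      · intro i' j' e f hij' hef e1 e2 e3 e4
        rcases hY e with rfl | rfl
        · obtain rfl := (hY f).resolve_left hef.symm
          exact hz i' j' hij' e1 e2 e3 e4
        · obtain rfl := (hY f).resolve_right hef.symm
          exact hz i' j' hij' e2 e1 e4 e3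
      · intro i' j' hij' e1 e2 e3 e4
        rw [supportMatrix_ne_zero] at e1 e2 e3 e4
        exact (hz i' j' hij' e1 e2 e3 e4).elim
  have hP : IsPMatrix (C.map φ) := hC.symm.isPMatrix hA
  have hM : MinorLaws φ (lifted φ up) (C.map φ) := hl.minor (.scale .refl hC.symm)
  exact ⟨C, hC, allGood_of_two_columns hU (lineLaw_of_minorLaws hφ hU hP hM)
    (colineLaw_of_minorLaws hφ hU hP hM) hab hY hcr⟩

end Small

end PartialField

namespace PartialField

open Function

/-! ### Finding two vertices to delete -/

section Graphs

variable {V : Type*} {G : SimpleGraph V} {K : Finset V}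

/-- There is no nontrivial separation of the subgraph induced on `K`. -/
def ConnectedOn (G : SimpleGraph V) (K : Finset V) : Prop :=
  ∀ s : V → Prop, (∀ u ∈ K, ∀ v ∈ K, G.Adj u v → (s u ↔ s v)) → ∀ u ∈ K, ∀ v ∈ K, s u ↔ s v

theorem ConnectedOn.insert [DecidableEq V] (h : ConnectedOn G K) {u v : V} (hu : u ∈ K)
    (huv : G.Adj u v) : ConnectedOn G (insert v K) := by
  intro s hs
  have h1 := h s fun a ha b hb => hs a (Finset.mem_insert_of_mem ha) b (Finset.mem_insert_of_mem hb)
  have h2 := hs u (Finset.mem_insert_of_mem hu) v (Finset.mem_insert_self v K) huv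
  have h3 : ∀ a ∈ Insert.insert v K, s a ↔ s u := by
    intro a ha
    rcases Finset.mem_insert.1 ha with rfl | ha
    · exact h2.symm
    · exact h1 a ha u hu
  intro a ha b hb
  rw [h3 a ha, h3 b hb]

variable [Fintype V]

theorem ConnectedOn.exists_adj (h : ConnectedOn G Finset.univ) {S : Finset V} {a b : V}
    (ha : a ∈ S) (hb : b ∉ S) : ∃ u ∈ S, ∃ v, v ∉ S ∧ G.Adj u v := by
  by_contra! hcon
  refine hb ((h (· ∈ S) (fun u _ v _ huv => ⟨fun hu => ?_, fun hv => ?_⟩) a (Finset.mem_univ a) b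
    (Finset.mem_univ b)).1 ha)
  · by_contra hv
    exact hcon u hu v hv huv
  · by_contra hu
    exact hcon v hv u hu huv.symm

theorem ConnectedOn.exists_adj_of_card (h : ConnectedOn G Finset.univ) {S : Finset V} {a : V}
    (ha : a ∈ S) (hS : S.card < Fintype.card V) : ∃ u ∈ S, ∃ v, v ∉ S ∧ G.Adj u v := by
  obtain ⟨b, hb⟩ : ∃ b, b ∉ S := by
    by_contra! hcon
    rw [Finset.eq_univ_of_forall hcon, Finset.card_univ] at hS
    exact lt_irrefl _ hS
  exact h.exists_adj ha hb

/-- A connected set with three further vertices attached to it. -/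
structure Core (G : SimpleGraph V) (K : Finset V) (l : Fin 3 → V) : Prop where
  conn : ConnectedOn G K
  inj : Injective l
  notMem : ∀ i, l i ∉ K
  adj : ∀ i, ∃ u ∈ K, G.Adj u (l i)

theorem Core.extend [DecidableEq V] (hG : ConnectedOn G Finset.univ) {l : Fin 3 → V}
    (h : Core G K l) {w : V} (hw : w ∉ K) (hwl : ∀ i, w ≠ l i) :
    ∃ K' l', Core G K' l' ∧ K'.card = K.card + 1 := by
  obtain ⟨c, hc, -⟩ := h.adj 0
  obtain ⟨u, hu, v, hv, huv⟩ := hG.exists_adj (S := K ∪ Finset.univ.image l) (a := c) (b := w)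
    (Finset.mem_union_left _ hc) (by simp [hw, eq_comm, hwl])
  simp only [Finset.mem_union, Finset.mem_image, Finset.mem_univ, true_and, not_or, not_exists]
    at hu hv
  -- A new vertex adjacent to the core joins it. One adjacent to an attached vertex takes that
  -- vertex's place, and the latter joins the core.
  rcases hu with hu | ⟨i, rfl⟩
  · refine ⟨insert v K, l, ⟨h.conn.insert hu huv, h.inj, fun i => ?_, fun i => ?_⟩,
      Finset.card_insert_of_notMem hv.1⟩
    · simp [hv.2 i, h.notMem i]
    · obtain ⟨u, hu, hui⟩ := h.adj i
      exact ⟨u, Finset.mem_insert_of_mem hu, hui⟩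
  · obtain ⟨u, hu, hui⟩ := h.adj i
    refine ⟨insert (l i) K, update l i v, ⟨h.conn.insert hu hui, ?_, fun j => ?_, fun j => ?_⟩,
      Finset.card_insert_of_notMem (h.notMem i)⟩
    · intro j k hjk
      rcases eq_or_ne j i with rfl | hj <;> rcases eq_or_ne k j with rfl | hk
      · rfl
      · rw [update_self, update_of_ne hk] at hjk
        exact absurd hjk.symm (hv.2 k)
      · rfl
      · rcases eq_or_ne k i with rfl | hk'
        · rw [update_self, update_of_ne hj] at hjk
          exact absurd hjk (hv.2 j)
        · rw [update_of_ne hj, update_of_ne hk'] at hjk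
          exact h.inj hjk
    · rcases eq_or_ne j i with rfl | hj
      · rw [update_self, Finset.mem_insert, not_or]
        exact ⟨fun h => hv.2 j h.symm, hv.1⟩
      · rw [update_of_ne hj, Finset.mem_insert, not_or]
        exact ⟨h.inj.ne hj, h.notMem j⟩
    · rcases eq_or_ne j i with rfl | hj
      · rw [update_self]
        exact ⟨_, Finset.mem_insert_self _ _, huv⟩
      · rw [update_of_ne hj]
        obtain ⟨u, hu, huj⟩ := h.adj j
        exact ⟨u, Finset.mem_insert_of_mem hu, huj⟩

theorem Core.exists_spanning [DecidableEq V] (hG : ConnectedOn G Finset.univ) (m : ℕ) :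
    ∀ {K : Finset V} {l : Fin 3 → V}, Core G K l → Fintype.card V - K.card ≤ m →
    ∃ K l, Core G K l ∧ ∀ v, v ∈ K ∨ ∃ i, v = l i := by
  induction m with
  | zero =>
    intro K l h hm
    refine ⟨K, l, h, fun v => Or.inl ?_⟩
    rw [Finset.eq_univ_of_card K (le_antisymm (Finset.card_le_univ K) (by omega))]
    exact Finset.mem_univ v
  | succ m ih =>
    intro K l h hm
    by_cases hall : ∀ v, v ∈ K ∨ ∃ i, v = l i
    · exact ⟨K, l, h, hall⟩
    · push Not at hall
      obtain ⟨w, hw, hwl⟩ := hall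
      obtain ⟨K', l', h', hcard⟩ := h.extend hG hw hwl
      exact ih h' (by omega)

/-- A claw grows to a connected core with three attached vertices that together span the graph. Two
of the three lie on the same side, and without them the core and the third vertex remain connected.
-/
theorem exists_leaves [DecidableEq V] (hG : ConnectedOn G Finset.univ) {c : V} {l : Fin 3 → V}
    (hl : Injective l) (hc : ∀ i, G.Adj c (l i)) (side : V → Bool) :
    ∃ a b, a ≠ b ∧ side a = side b ∧ ∀ s : V → Prop,
      (∀ u v, u ≠ a → u ≠ b → v ≠ a → v ≠ b → G.Adj u v → (s u ↔ s v)) →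
      ∀ u v, u ≠ a → u ≠ b → v ≠ a → v ≠ b → (s u ↔ s v) := by
  have h0 : Core G {c} l := by
    refine ⟨?_, hl, fun i => ?_, fun i => ⟨c, Finset.mem_singleton_self c, hc i⟩⟩
    · intro s _ u hu v hv
      rw [Finset.mem_singleton.1 hu, Finset.mem_singleton.1 hv]
    · rw [Finset.mem_singleton]; exact (hc i).ne'
  obtain ⟨K, l, h, hall⟩ := Core.exists_spanning hG _ h0 le_rfl
  have key : ∀ i j k : Fin 3, i ≠ j → (∀ m, m = i ∨ m = j ∨ m = k) → k ≠ i → k ≠ j →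
      side (l i) = side (l j) → ∃ a b, a ≠ b ∧ side a = side b ∧ ∀ s : V → Prop,
      (∀ u v, u ≠ a → u ≠ b → v ≠ a → v ≠ b → G.Adj u v → (s u ↔ s v)) →
      ∀ u v, u ≠ a → u ≠ b → v ≠ a → v ≠ b → (s u ↔ s v) := by
    intro i j k hij hijk hki hkj hside
    refine ⟨l i, l j, h.inj.ne hij, hside, fun s hs => ?_⟩
    obtain ⟨w, hw, hwk⟩ := h.adj k
    have hout : ∀ u ∈ insert (l k) K, u ≠ l i ∧ u ≠ l j := by
      intro u hu
      rcases Finset.mem_insert.1 hu with rfl | hu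
      · exact ⟨h.inj.ne hki, h.inj.ne hkj⟩
      · exact ⟨fun e => h.notMem i (e ▸ hu), fun e => h.notMem j (e ▸ hu)⟩
    have hin : ∀ u, u ≠ l i → u ≠ l j → u ∈ insert (l k) K := by
      intro u hui huj
      rcases hall u with hu | ⟨m, rfl⟩
      · exact Finset.mem_insert_of_mem hu
      · rcases hijk m with rfl | rfl | rfl
        · exact absurd rfl hui
        · exact absurd rfl huj
        · exact Finset.mem_insert_self _ _
    have := h.conn.insert hw hwk s fun u hu v hv =>
      hs u v (hout u hu).1 (hout u hu).2 (hout v hv).1 (hout v hv).2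
    exact fun u v hui huj hvi hvj => this u (hin u hui huj) v (hin v hvi hvj)
  by_cases h01 : side (l 0) = side (l 1)
  · exact key 0 1 2 (by decide) (by decide) (by decide) (by decide) h01
  by_cases h02 : side (l 0) = side (l 2)
  · exact key 0 2 1 (by decide) (by decide) (by decide) (by decide) h02
  · refine key 1 2 0 (by decide) (by decide) (by decide) (by decide) ?_
    rw [Bool.eq_not.2 (Ne.symm h01), Bool.eq_not.2 (Ne.symm h02)]

/-- If no vertex has three neighbours, a path is grown one vertex at a time: a vertex outside can
only attach at an end, and the excluded chords would also create a vertex with three neighbours. -/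
theorem exists_claw_or_path [DecidableEq V] (hG : ConnectedOn G Finset.univ)
    (hV : 5 ≤ Fintype.card V) :
    (∃ (c : V) (l : Fin 3 → V), Injective l ∧ ∀ i, G.Adj c (l i)) ∨
    ∃ p₀ p₁ p₂ p₃ p₄, G.Adj p₀ p₁ ∧ G.Adj p₁ p₂ ∧ G.Adj p₂ p₃ ∧ G.Adj p₃ p₄ ∧ p₀ ≠ p₂ ∧ p₀ ≠ p₄ ∧
      p₂ ≠ p₄ ∧ p₁ ≠ p₃ ∧ ¬ G.Adj p₀ p₃ ∧ ¬ G.Adj p₁ p₄ := by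
  refine or_iff_not_imp_left.2 fun hclaw => ?_
  have deg : ∀ c x y z, G.Adj c x → G.Adj c y → G.Adj c z → x ≠ y → x ≠ z → y ≠ z → False := by
    intro c x y z hx hy hz hxy hxz hyz
    refine hclaw ⟨c, ![x, y, z], ?_, ?_⟩
    · intro i j
      fin_cases i <;> fin_cases j <;> simp [hxy, hxz, hyz, hxy.symm, hxz.symm, hyz.symm]
    · intro i
      fin_cases i <;> assumption
  obtain ⟨v₀⟩ : Nonempty V := Fintype.card_pos_iff.1 (by omega)
  obtain ⟨p, c, q, hpc, hcq, hpq⟩ : ∃ p c q, G.Adj p c ∧ G.Adj c q ∧ p ≠ q := by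
    obtain ⟨u, hu, v, hv, huv⟩ := hG.exists_adj_of_card (S := {v₀}) (a := v₀) (by simp)
      (by rw [Finset.card_singleton]; omega)
    obtain ⟨w, hw, z, hz, hwz⟩ := hG.exists_adj_of_card (S := {u, v}) (a := u) (by simp)
      (lt_of_le_of_lt Finset.card_le_two (by omega))
    simp only [Finset.mem_insert, Finset.mem_singleton, not_or] at hw hz
    rcases hw with rfl | rfl
    · exact ⟨v, w, z, huv.symm, hwz, Ne.symm hz.2⟩
    · exact ⟨u, w, z, huv, hwz, Ne.symm hz.1⟩
  obtain ⟨p₀, p₁, p₂, p₃, h01, h12, h23, h02, h03, h13⟩ : ∃ p₀ p₁ p₂ p₃, G.Adj p₀ p₁ ∧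
      G.Adj p₁ p₂ ∧ G.Adj p₂ p₃ ∧ p₀ ≠ p₂ ∧ p₀ ≠ p₃ ∧ p₁ ≠ p₃ := by
    obtain ⟨u, hu, v, hv, huv⟩ := hG.exists_adj_of_card (S := {p, c, q}) (a := p) (by simp)
      (lt_of_le_of_lt Finset.card_le_three (by omega))
    simp only [Finset.mem_insert, Finset.mem_singleton, not_or] at hu hv
    obtain ⟨v1, v2, v3⟩ := hv
    rcases hu with rfl | rfl | rfl
    · exact ⟨v, u, c, q, huv.symm, hpc, hcq, v2, v3, hpq⟩
    · exact (deg u p q v hpc.symm hcq huv hpq (Ne.symm v1) (Ne.symm v3)).elim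
    · exact ⟨p, c, u, v, hpc, hcq, huv, hpq, Ne.symm v1, Ne.symm v2⟩
  obtain ⟨u, hu, v, hv, huv⟩ := hG.exists_adj_of_card (S := {p₀, p₁, p₂, p₃}) (a := p₀) (by simp)
    (lt_of_le_of_lt Finset.card_le_four (by omega))
  simp only [Finset.mem_insert, Finset.mem_singleton, not_or] at hu hv
  obtain ⟨n0, n1, n2, n3⟩ := hv
  rcases hu with rfl | rfl | rfl | rfl
  · refine ⟨v, u, p₁, p₂, p₃, huv.symm, h01, h12, h23, n1, n3, h13, h02, fun h => ?_, fun h => ?_⟩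
    · exact deg p₂ v p₁ p₃ h.symm h12.symm h23 n1 n3 h13
    · exact deg u v p₁ p₃ huv h01 h n1 n3 h13
  · exact (deg u p₀ p₂ v h01.symm h12 huv h02 (Ne.symm n0) (Ne.symm n2)).elim
  · exact (deg u p₁ p₃ v h12.symm h23 huv h13 (Ne.symm n1) (Ne.symm n3)).elim
  · refine ⟨p₀, p₁, p₂, u, v, h01, h12, h23, huv, h02, Ne.symm n0, Ne.symm n2, h13, fun h => ?_,
      fun h => ?_⟩
    · exact deg u p₀ p₂ v h.symm h23.symm huv h02 (Ne.symm n0) (Ne.symm n2)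
    · exact deg p₁ p₀ p₂ v h01.symm h12 h h02 (Ne.symm n0) (Ne.symm n2)

end Graphs

/-! ### The induction on the number of rows and columns -/

section Induction

variable {Q P : Type*} [PartialField Q] [PartialField P] {φ : Q →*₀ P}
  {up : {p : P // IsFundamental p} → Q}

/-- Matrices with fewer than `n` rows and columns have lifts. -/
def LiftsBelow (φ : Q →*₀ P) (U : Set Q) (n : ℕ) : Prop :=
  ∀ (X Y : Type) [Fintype X] [DecidableEq X] [Fintype Y] [DecidableEq Y],
    Fintype.card X + Fintype.card Y < n → ∀ A : Matrix X Y P, IsPMatrix A → MinorLaws φ U A →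
      HasLift φ U A

variable {X Y : Type} [Fintype X] [DecidableEq X] [Fintype Y] [DecidableEq Y] {A : Matrix X Y P}

theorem hasLift_of_columnGluable (hφ : IsHom φ) (hup : IsLiftingFunction φ up) {n : ℕ}
    (ih : LiftsBelow φ (lifted φ up) n) (hn : Fintype.card X + Fintype.card Y = n)
    (hA : IsPMatrix A) (hl : MinorLaws φ (lifted φ up) A) {a b : Y} (hab : a ≠ b)
    (hg : ColumnGluable A a b) : HasLift φ (lifted φ up) A := by
  have key : ∀ c : Y, HasLift φ (lifted φ up)
      (A.submatrix id (Subtype.val : {y // y ≠ c} → Y)) := by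
    intro c
    have hm : IsMinor A (A.submatrix id (Subtype.val : {y // y ≠ c} → Y)) :=
      .delete (Embedding.refl X) (Embedding.subtype _) .refl
    refine ih X {y // y ≠ c} ?_ _ (hA.minor hm) (hl.minor hm)
    have : Fintype.card {y // y ≠ c} < Fintype.card Y :=
      Fintype.card_subtype_lt (x := c) (by simp)
    omega
  exact hasLift_of_deletions hφ hup hA hl hab (key b) (key a) hg

theorem hasLift_of_rowGluable (hφ : IsHom φ) (hup : IsLiftingFunction φ up) {n : ℕ}
    (ih : LiftsBelow φ (lifted φ up) n) (hn : Fintype.card X + Fintype.card Y = n)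
    (hA : IsPMatrix A) (hl : MinorLaws φ (lifted φ up) A) {a b : X} (hab : a ≠ b)
    (hg : ColumnGluable A.transpose a b) : HasLift φ (lifted φ up) A :=
  (hasLift_of_columnGluable hφ hup ih (by omega) hA.transpose hl.transpose hab hg).transpose
    (isCrossSet_lifted hup)

theorem hasLift_of_separation (hφ : IsHom φ) (hup : IsLiftingFunction φ up) {n : ℕ}
    (ih : LiftsBelow φ (lifted φ up) n) (hn : Fintype.card X + Fintype.card Y = n)
    (hA : IsPMatrix A) (hl : MinorLaws φ (lifted φ up) A) [Nontrivial Y] {s : X ⊕ Y → Prop}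
    (hs : ∀ x y, A x y ≠ 0 → (s (Sum.inr y) ↔ s (Sum.inl x))) {u v : X ⊕ Y} (hu : s u)
    (hv : ¬ s v) : HasLift φ (lifted φ up) A := by
  by_cases hc : ∃ a b : Y, s (Sum.inr a) ∧ ¬ s (Sum.inr b)
  · obtain ⟨a, b, ha, hb⟩ := hc
    exact hasLift_of_columnGluable hφ hup ih hn hA hl (a := a) (b := b) (fun h => hb (h ▸ ha))
      (Or.inr ⟨s, hs, ha, hb⟩)
  by_cases hr : ∃ a b : X, s (Sum.inl a) ∧ ¬ s (Sum.inl b)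
  · obtain ⟨a, b, ha, hb⟩ := hr
    exact hasLift_of_rowGluable hφ hup ih hn hA hl (a := a) (b := b) (fun h => hb (h ▸ ha))
      (Or.inr ⟨s ∘ Sum.swap, fun x y hxy => (hs y x hxy).symm, ha, hb⟩)
  -- Now all columns are on one side and all rows on the other, so `A` is zero and a single column
  -- is a union of components.
  push Not at hc hr
  obtain ⟨a, b, hab⟩ := exists_pair_ne Y
  refine hasLift_of_columnGluable hφ hup ih hn hA hl hab
    (Or.inr ⟨(· = Sum.inr a), fun x y hxy => ?_, rfl, by simpa using hab.symm⟩)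
  have h := hs x y hxy
  exfalso
  rcases u with u | u <;> rcases v with v | v
  · exact hv (hr u v hu)
  · exact hv (hc y v (h.2 (hr u x hu)))
  · exact hv (hr x v (h.1 (hc u y hu)))
  · exact hv (hc u v hu)

theorem hasLift_of_not_connectedOn (hφ : IsHom φ) (hup : IsLiftingFunction φ up) {n : ℕ}
    (ih : LiftsBelow φ (lifted φ up) n) (hn : Fintype.card X + Fintype.card Y = n)
    (hA : IsPMatrix A) (hl : MinorLaws φ (lifted φ up) A) [Nontrivial Y]
    (hG : ¬ ConnectedOn (bipGraph A) Finset.univ) : HasLift φ (lifted φ up) A := by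
  simp only [ConnectedOn, not_forall] at hG
  obtain ⟨s, hs, u, -, v, -, huv⟩ := hG
  have hs' : ∀ x y, A x y ≠ 0 → (s (Sum.inr y) ↔ s (Sum.inl x)) := fun x y hxy =>
    (hs (Sum.inl x) (Finset.mem_univ _) (Sum.inr y) (Finset.mem_univ _) hxy).symm
  by_cases hu : s u
  · exact hasLift_of_separation hφ hup ih hn hA hl hs' hu fun hv => huv ⟨fun _ => hv, fun _ => hu⟩
  · exact hasLift_of_separation hφ hup ih hn hA hl hs' (u := v) (v := u)
      (by by_contra hv; exact huv ⟨fun h => absurd h hu, fun h => absurd h hv⟩) hu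

/-- The sides of the bipartite graph are rows and columns, so the two deletable vertices are two
rows or two columns. The former case is treated by transposition. -/
theorem hasLift_of_claw (hφ : IsHom φ) (hup : IsLiftingFunction φ up) {n : ℕ}
    (ih : LiftsBelow φ (lifted φ up) n) (hn : Fintype.card X + Fintype.card Y = n)
    (hA : IsPMatrix A) (hl : MinorLaws φ (lifted φ up) A) [Nontrivial Y] {c : X ⊕ Y}
    {l : Fin 3 → X ⊕ Y} (hli : Injective l) (hc : ∀ i, (bipGraph A).Adj c (l i)) :
    HasLift φ (lifted φ up) A := by
  by_cases hG : ConnectedOn (bipGraph A) Finset.univ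
  · obtain ⟨a, b, hab, hside, h⟩ := exists_leaves hG hli hc Sum.isLeft
    rcases a with a | a <;> rcases b with b | b
    · refine hasLift_of_rowGluable hφ hup ih hn hA hl (a := a) (b := b)
        (fun h => hab (by rw [h]))
        (Or.inl fun s hs x x' => h (s ∘ Sum.swap) ?_ (Sum.inr x) (Sum.inr x') (by simp) (by simp)
          (by simp) (by simp))
      rintro (u | u) (v | v) h1 h2 h3 h4 huv
      · exact huv.elim
      · exact hs v u (by simpa using h1) (by simpa using h2) huv
      · exact (hs u v (by simpa using h3) (by simpa using h4) huv).symm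
      · exact huv.elim
    · simp at hside
    · simp at hside
    · refine hasLift_of_columnGluable hφ hup ih hn hA hl (a := a) (b := b)
        (fun h => hab (by rw [h]))
        (Or.inl fun s hs x x' => h s ?_ (Sum.inl x) (Sum.inl x') (by simp) (by simp)
          (by simp) (by simp))
      rintro (u | u) (v | v) h1 h2 h3 h4 huv
      · exact huv.elim
      · exact (hs u v (by simpa using h3) (by simpa using h4) huv).symm
      · exact hs v u (by simpa using h1) (by simpa using h2) huv
      · exact huv.elim
  · exact hasLift_of_not_connectedOn hφ hup ih hn hA hl hG

/-- A pivot at the inner entry `(x₁, y₂)` makes row `x₃` nonzero in `y₀`, `y₂` and `y₄`, which is a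
claw. Having a lift is invariant under pivots. -/
theorem hasLift_of_path (hφ : IsHom φ) (hup : IsLiftingFunction φ up) {n : ℕ}
    (ih : LiftsBelow φ (lifted φ up) n) (hn : Fintype.card X + Fintype.card Y = n)
    (hA : IsPMatrix A) (hl : MinorLaws φ (lifted φ up) A) {y₀ y₂ y₄ : Y} {x₁ x₃ : X}
    (h01 : A x₁ y₀ ≠ 0) (h12 : A x₁ y₂ ≠ 0) (h23 : A x₃ y₂ ≠ 0) (h34 : A x₃ y₄ ≠ 0)
    (n02 : y₀ ≠ y₂) (n04 : y₀ ≠ y₄) (n24 : y₂ ≠ y₄) (n13 : x₁ ≠ x₃) (h03 : A x₃ y₀ = 0)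
    (h14 : A x₁ y₄ = 0) : HasLift φ (lifted φ up) A := by
  obtain ⟨B, hB⟩ := hA.exists_pivot h12
  have hm : IsMinor A B := .pivot _ _ .refl hB
  obtain ⟨-, -, -, e1, e2⟩ := isPivot_iff.1 hB
  have b0 : B x₃ y₀ ≠ 0 := by
    have : B x₃ y₀ = pneg ((A x₁ y₂)⁻¹ * A x₃ y₂ * A x₁ y₀) := ι_injective (by
      rw [e2 _ _ n13.symm n02, h03, map_zero, zero_sub, ι_pneg])
    rw [this]
    exact pneg_ne_zero (mul_ne_zero (mul_ne_zero (inv_ne_zero h12) h23) h01)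
  have b2 : B x₃ y₂ ≠ 0 := by
    rw [e1 _ n13.symm]
    exact pneg_ne_zero (mul_ne_zero (inv_ne_zero h12) h23)
  have b4 : B x₃ y₄ ≠ 0 := by
    have : B x₃ y₄ = A x₃ y₄ := ι_injective (by
      rw [e2 _ _ n13.symm n24.symm, h14, mul_zero, map_zero, sub_zero])
    rwa [this]
  have : Nontrivial Y := ⟨y₀, y₂, n02⟩
  refine (hasLift_of_claw hφ hup ih hn (hA.minor hm) (hl.minor hm) (c := Sum.inl x₃)
    (l := ![Sum.inr y₀, Sum.inr y₂, Sum.inr y₄]) ?_ ?_).pivot hφ (isCrossSet_lifted hup) hB.symm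
  · intro i j
    fin_cases i <;> fin_cases j <;> simp [n02, n04, n24, n02.symm, n04.symm, n24.symm]
  · intro i
    fin_cases i
    · exact b0
    · exact b2
    · exact b4

theorem hasLift_of_five_le (hφ : IsHom φ) (hup : IsLiftingFunction φ up) {n : ℕ}
    (ih : LiftsBelow φ (lifted φ up) n) (hn : Fintype.card X + Fintype.card Y = n) (h5 : 5 ≤ n)
    (hA : IsPMatrix A) (hl : MinorLaws φ (lifted φ up) A) [Nontrivial Y] :
    HasLift φ (lifted φ up) A := by
  by_cases hG : ConnectedOn (bipGraph A) Finset.univ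
  · rcases exists_claw_or_path hG (by rw [Fintype.card_sum]; omega) with ⟨c, l, hli, hc⟩ |
      ⟨p₀, p₁, p₂, p₃, p₄, h01, h12, h23, h34, n02, n04, n24, n13, h03, h14⟩
    · exact hasLift_of_claw hφ hup ih hn hA hl hli hc
    · rcases p₁ with x₁ | y₁
      · rcases p₀ with x₀ | y₀; · exact h01.elim
        rcases p₂ with x₂ | y₂; · exact h12.elim
        rcases p₃ with x₃ | y₃; swap; · exact h23.elim
        rcases p₄ with x₄ | y₄; · exact h34.elim
        exact hasLift_of_path hφ hup ih hn hA hl h01 h12 h23 h34 (fun h => n02 (by rw [h]))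
          (fun h => n04 (by rw [h])) (fun h => n24 (by rw [h])) (fun h => n13 (by rw [h]))
          (not_not.1 h03) (not_not.1 h14)
      · rcases p₀ with x₀ | y₀; swap; · exact h01.elim
        rcases p₂ with x₂ | y₂; swap; · exact h12.elim
        rcases p₃ with x₃ | y₃; · exact h23.elim
        rcases p₄ with x₄ | y₄; swap; · exact h34.elim
        exact (hasLift_of_path (A := A.transpose) hφ hup ih (by omega) hA.transpose hl.transpose
          h01 h12 h23 h34 (fun h => n02 (by rw [h])) (fun h => n04 (by rw [h]))
          (fun h => n24 (by rw [h])) (fun h => n13 (by rw [h])) (not_not.1 h03)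
          (not_not.1 h14)).transpose (isCrossSet_lifted hup)
  · exact hasLift_of_not_connectedOn hφ hup ih hn hA hl hG

theorem liftsBelow (hφ : IsHom φ) (hup : IsLiftingFunction φ up) (n : ℕ) :
    LiftsBelow φ (lifted φ up) n := by
  induction n with
  | zero => intro X Y _ _ _ _ h; omega
  | succ n ih =>
    intro X Y _ _ _ _ hn A hA hl
    rcases Nat.lt_succ_iff_lt_or_eq.1 hn with hn | hn
    · exact ih X Y hn A hA hl
    rcases subsingleton_or_nontrivial X with hX | hX
    · exact hasLift_of_subsingleton _ A
    rcases subsingleton_or_nontrivial Y with hY | hY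
    · exact (hasLift_of_subsingleton _ A.transpose).transpose (isCrossSet_lifted hup)
    -- With at least two rows and two columns, fewer than five in total means exactly two of each.
    rcases Nat.lt_or_ge n 5 with h5 | h5
    · have c1 := Fintype.one_lt_card (α := X)
      have c2 := Fintype.one_lt_card (α := Y)
      have key : ∀ {Z : Type} [Fintype Z], Fintype.card Z = 2 → ∀ {i j : Z}, i ≠ j →
          ∀ x, x = i ∨ x = j := by
        intro Z _ hZ i j hij x
        by_contra! hx
        have := Fintype.two_lt_card_iff.2 ⟨i, j, x, hij, hx.1.symm, hx.2.symm⟩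
        omega
      obtain ⟨i, j, hij⟩ := exists_pair_ne X
      obtain ⟨a, b, hab⟩ := exists_pair_ne Y
      exact hasLift_of_two hφ hup hA hl hij (key (by omega) hij) hab (key (by omega) hab)
    · exact hasLift_of_five_le hφ hup ih hn h5 hA hl

end Induction

end PartialField

theorem mainTheorem1 {Phat : Type v} {P : Type w}
    [PartialField Phat] [PartialField P]
    (φ : Phat → P) (hφ : PartialField.IsHom φ)
    (up : {p : P // PartialField.IsFundamental p} → Phat)
    (hup : PartialField.IsLiftingFunction φ up)
    {X : Type u₁} {Y : Type u₂} [Finite X] [Finite Y]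
    (A : Matrix X Y P) (hA : PartialField.IsPMatrix A) :
    Xor
      (∃ Ahat : Matrix X Y Phat, PartialField.IsGlobalLift φ up A Ahat)
      (∃ (X' : Type u₁) (Y' : Type u₂) (B : Matrix X' Y' P),
        PartialField.IsMinor A B ∧
        (¬ ∃ Bhat : Matrix X' Y' Phat, PartialField.IsLocalLift φ up B Bhat) ∧
        (PartialField.IsObstructionShape B ∨
          PartialField.IsObstructionShape B.transpose)) := by
  classical
  have := Fintype.ofFinite X
  have := Fintype.ofFinite Y
  by_cases hB : ∃ (X' : Type u₁) (Y' : Type u₂) (B : Matrix X' Y' P),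
      PartialField.IsMinor A B ∧
      (¬ ∃ Bhat : Matrix X' Y' Phat, PartialField.IsLocalLift φ up B Bhat) ∧
      (PartialField.IsObstructionShape B ∨ PartialField.IsObstructionShape B.transpose)
  · refine Or.inr ⟨hB, ?_⟩
    -- A global lift would induce a local lift of the obstruction.
    rintro ⟨C, hC⟩
    obtain ⟨X', Y', B, hAB, hB, -⟩ := hB
    exact hB (PartialField.IsGlobalLift.exists_isLocalLift
      (φ := hφ.toMonoidWithZeroHom (hup.map_one hφ)) hφ hC hAB)
  · refine Or.inl ⟨?_, hB⟩
    -- The induction runs over index types in `Type`, so rows and columns are first renamed by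
    -- `Fin`; the lift is carried back at the end.
    have hl := PartialField.minorLaws_of_liftable_obstructions
      (φ := hφ.toMonoidWithZeroHom (hup.map_one hφ)) hup (A := A) (fun X' Y' B hAB hs => by
        by_contra hno
        exact hB ⟨X', Y', B, hAB, hno, hs⟩) (Fintype.equivFin X).symm (Fintype.equivFin Y).symm
    obtain ⟨C, hC, hg⟩ := PartialField.liftsBelow hφ hup _ _ _ (Nat.lt_succ_self _) _
      (hA.submatrix (Fintype.equivFin X).symm.toEmbedding (Fintype.equivFin Y).symm.toEmbedding) hl
    exact ⟨_, hg.isGlobalLift hφ (Fintype.equivFin X) (Fintype.equivFin Y) hC⟩
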